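/- Let $k$ be a commutative ring and $\delta\in k$. **$FB$-modules.** Let $FB$ be the category of finite sets and bijections. An $FB$-module is a functor $M\colon FB\to \mathrm{Mod}_k$. The tensor product is $(M\otimes N)(S)=\bigoplus_{T\subseteq S}M(T)\otimes_k N(S\setminus T)$, with the evident associativity and symmetry. Let $\mathbf V$ be the $FB$-module with $\mathbf V(S)=k$ if $\#S=1$ and $0$ otherwise. Then $\mathrm{Sym}(\mathbf V)=\bigoplus_n \mathrm{Sym}^n(\mathbf V)$ and $\mathrm{Div}(\mathbf V)=\bigoplus_n\mathrm{Div}^n(\mathbf V)$ are free of rank one on every finite set $S$, with basis vectors $t^S$ and $t^{[S]}$ (lying in degree $n=\#S$); the multiplications $m$, the comultiplications $\Delta$ and the averaging map are $$t^A\otimes t^B\mapsto t^{A\sqcup B},\quad t^S\mapsto\sum_{S=A\sqcup B}t^A\otimes t^B,\quad t^{[A]}\otimes t^{[B]}\mapsto t^{[A\sqcup B]},\quad t^{[S]}\mapsto\sum_{S=A\sqcup B}t^{[A]}\otimes t^{[B]},\quad \mathrm{avg}(t^S)=t^{[S]}.$$ **The curried Weyl Lie algebra.** Write $\mathrm{Sym}=\mathrm{Sym}(\mathbf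 V)$ and $\mathrm{Div}=\mathrm{Div}(\mathbf V)$. A representation of the curried Weyl Lie algebra $\underline{\mathfrak a}(\mathbf V\oplus\mathbf V^*)$ is an $FB$-module $M$ with a map of $FB$-modules $a\colon \mathrm{Sym}\otimes M\to \mathrm{Div}\otimes M$ such that $$a_1a_2-a_2a_1=a'-a''$$ as maps $\mathrm{Sym}\otimes\mathrm{Sym}\otimes M\to\mathrm{Div}\otimes\mathrm{Div}\otimes M$. Here $a_1$ (resp. $a_2$) is $a$ applied to the first (resp. second) factor and $M$. The map $a'$ is the composition $$\begin{aligned}\mathrm{Sym}\otimes\mathrm{Sym}\otimes M&\xrightarrow{\mathrm{id}\otimes\Delta\otimes\mathrm{id}}\mathrm{Sym}\otimes\mathrm{Sym}\otimes\mathrm{Sym}\otimes M\xrightarrow{\tau\otimes\mathrm{id}\otimes\mathrm{id}}\mathrm{Sym}\otimes\mathrm{Sym}\otimes\mathrm{Sym}\otimes M\\&\xrightarrow{\mathrm{id}\otimes m\otimes\mathrm{id}}\mathrm{Sym}\otimes\mathrm{Sym}\otimes M\xrightarrow{\mathrm{id}\otimes a}\mathrm{Sym}\otimes\mathrm{Div}\otimes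 M\xrightarrow{\mathrm{id}\otimes\Delta\otimes\mathrm{id}}\mathrm{Sym}\otimes\mathrm{Div}\otimes\mathrm{Div}\otimes M\\&\xrightarrow{\mathrm{avg}\otimes\mathrm{id}\otimes\mathrm{id}\otimes\mathrm{id}}\mathrm{Div}\otimes\mathrm{Div}\otimes\mathrm{Div}\otimes M\xrightarrow{m\otimes\mathrm{id}\otimes\mathrm{id}}\mathrm{Div}\otimes\mathrm{Div}\otimes M,\end{aligned}$$ where $\tau$ exchanges the first two tensor factors, and $a''=\tau a'\tau$. A morphism of representations is a map of $FB$-modules that commutes with the maps $a$. For subsets $A,B$ of a finite set $S$ let $\phi^S_{A,B}\colon M(S\setminus B)\to M(S\setminus A)$ be the maps with $$a(t^B\otimes x)=\sum_{A\subseteq S}t^{[A]}\otimes\phi^S_{A,B}(x).$$ Let $\mathrm{Rep}^\delta(\underline{\mathfrak a}(\mathbf V\oplus\mathbf V^*))'$ be the full subcategory of the representations $M$ that * have central character $\delta$: the composition $M\cong\mathrm{Sym}^0(\mathbf V)\otimes M\to\mathrm{Sym}(\mathbf V)\otimes M\xrightarrow{a}\mathrm{Div}(\mathbf V)\otimes M\to\mathrm{Div}^0(\mathbf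 V)\otimes M\cong M$ is $\delta\cdot\mathrm{id}_M$; * are $0$-standard: the composition $\mathbf V\otimes M\to\mathrm{Sym}(\mathbf V)\otimes M\xrightarrow{a}\mathrm{Div}(\mathbf V)\otimes M\to\mathbf V\otimes M$ sends $t^j\otimes x$, for $j\in S$ and $x\in M(S\setminus\{j\})$, to $\sum_{i\in S,\,i\ne j}t^i\otimes(\iota_{i,j})_*(x)$, where $\iota_{i,j}\colon S\setminus\{j\}\to S\setminus\{i\}$ sends $i$ to $j$ and fixes all other elements; * have vanishing $\omega$ operation: for every finite set $S$ and disjoint $A,B\subseteq S$, the map $\omega^S_{A,B}=-\phi^{S\sqcup\{*\}}_{A\sqcup\{*\},B\sqcup\{*\}}\colon M(S\setminus B)\to M(S\setminus A)$ is zero. **The partition category.** The $k$-linear category $\mathfrak P(\delta)$ has the finite sets as objects; $\mathrm{Hom}(S,T)$ is the free $k$-module on the set-partitions of $S\sqcup T$. The composition of a partition of $S\sqcup T$ with one of $T\sqcup U$ is obtained by joining them along $T$ to a partition of $S\sqcup T\sqcup U$, restricting it to $S\sqcup U$, and multiplying by $\delta^c$, where $c$ is the number of parts of the joined partition that are contained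 in $T$. It contains the bijections of finite sets. $\mathrm{Rep}(\mathfrak P(\delta))$ is the category of $k$-linear functors $\mathfrak P(\delta)\to\mathrm{Mod}_k$. For disjoint $A,B\subseteq S$, not both empty, let $\eta^S_{A,B}\colon S\setminus B\to S\setminus A$ be the morphism given by the partition in which $A\sqcup B$ is a single part and which is the identity on $S\setminus(A\cup B)$. **Corollary.** There is a natural isomorphism of categories $$\mathrm{Rep}^{\delta}(\underline{\mathfrak a}(\mathbf V\oplus\mathbf V^*))'\;\cong\;\mathrm{Rep}(\mathfrak P(\delta)).$$ It is compatible with the forgetful functors to $FB$-modules, and if $M$ corresponds to $N$, then $\phi^S_{A,B}$ is the action of $\eta^S_{A,B}$ on $N$ for all finite sets $S$ and all disjoint $A,B\subseteq S$ that are not both empty. -/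

import Mathlib

open CategoryTheory
open scoped TensorProduct DirectSum

universe u

noncomputable section

/-- The objects of the category `FB` of finite sets and bijections. -/
structure FB : Type (u + 1) where
  carrier : Type u
  [finite : Finite carrier]

namespace FB

instance : CoeSort FB.{u} (Type u) := ⟨FB.carrier⟩

instance (S : FB.{u}) : Finite S := S.finite

instance (S : FB.{u}) : Fintype S := Fintype.ofFinite S

/-- The morphisms of `FB` are the bijections. -/
@[ext]
structure Hom (S T : FB.{u}) where
  toEquiv : S ≃ T

instance : Category FB.{u} where
  Hom := Hom
  id S := ⟨Equiv.refl S⟩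
  comp f g := ⟨f.toEquiv.trans g.toEquiv⟩

/-- A subset of a finite set, as a finite set. -/
abbrev sub (S : FB.{u}) (T : Set S) : FB.{u} := ⟨T⟩

/-- The disjoint union of two finite sets. -/
abbrev sum (S T : FB.{u}) : FB.{u} := ⟨S ⊕ T⟩

theorem hom_ext {S T : FB.{u}} {f g : S ⟶ T} (h : ∀ s, f.toEquiv s = g.toEquiv s) : f = g :=
  Hom.ext (Equiv.ext h)

@[simp] theorem comp_toEquiv {S T U : FB.{u}} (f : S ⟶ T) (g : T ⟶ U) :
    (f ≫ g).toEquiv = f.toEquiv.trans g.toEquiv := rfl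

@[simp] theorem id_toEquiv (S : FB.{u}) : (𝟙 S : S ⟶ S).toEquiv = Equiv.refl S := rfl

end FB

/-- `FB`-modules (linear species) over `k`; morphisms are natural transformations. -/
abbrev Species (k : Type u) [CommRing k] := FB.{u} ⥤ ModuleCat.{u} k

namespace Species

variable {k : Type u} [CommRing k]

section tensor

variable (M N P Q : Species k)

/-- The `k`-module `(M ⊗ N)(S) = ⨁_{T ⊆ S} M(T) ⊗ N(S \ T)`. -/
def TensorAt (S : FB.{u}) : ModuleCat.{u} k :=
  ModuleCat.of k (⨁ T : Set S, (M.obj (S.sub T) ⊗[k] N.obj (S.sub Tᶜ)))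

variable {M N P Q}

open scoped Classical in
/-- The inclusion of the summand of `(M ⊗ N)(S)` indexed by `T ⊆ S`. -/
def summand {S : FB.{u}} (T : Set S) :
    M.obj (S.sub T) →ₗ[k] N.obj (S.sub Tᶜ) →ₗ[k] TensorAt M N S :=
  (TensorProduct.mk k _ _).compr₂
    (DirectSum.lof k (Set S) (fun T => M.obj (S.sub T) ⊗[k] N.obj (S.sub Tᶜ)) T)

theorem tensor_ext {S : FB.{u}} {X : ModuleCat.{u} k} {f g : TensorAt M N S ⟶ X}
    (h : ∀ (T : Set S) x y, f (summand T x y) = g (summand T x y)) : f = g := by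
  classical
  refine ModuleCat.hom_ext <| DirectSum.linearMap_ext k fun T =>
    TensorProduct.ext' fun x y => ?_
  refine Eq.trans ?_ ((h T x y).trans ?_)
  · simp only [summand]
    congr!
  · simp only [summand]
    congr!

open scoped Classical in
/-- The linear map out of `(M ⊗ N)(S)` with given restrictions to the summands. -/
def tensorLift {S : FB.{u}} {X : ModuleCat.{u} k}
    (f : ∀ T : Set S, M.obj (S.sub T) →ₗ[k] N.obj (S.sub Tᶜ) →ₗ[k] X) :
    TensorAt M N S ⟶ X :=
  ModuleCat.ofHom (DirectSum.toModule k (Set S) X fun T => TensorProduct.lift (f T))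

@[simp] theorem tensorLift_summand {S : FB.{u}} {X : ModuleCat.{u} k}
    (f : ∀ T : Set S, M.obj (S.sub T) →ₗ[k] N.obj (S.sub Tᶜ) →ₗ[k] X) (T : Set S) (x y) :
    tensorLift f (summand T x y) = f T x y := by
  classical
  refine (DirectSum.toModule_lof k
    (φ := fun T : Set S => (TensorProduct.lift (f T) : _ →ₗ[k] X)) T (x ⊗ₜ[k] y)).trans ?_
  exact TensorProduct.lift.tmul x y

/-- The image of the first summand under a bijection `A ⊔ B ≃ S`. -/
def leftPart {A B S : FB.{u}} (e : A ⊕ B ≃ S) : Set S := {s | ∃ a, e (.inl a) = s}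

/-- `A` is in bijection with its image under `A ⊔ B ≃ S`. -/
def leftEquiv {A B S : FB.{u}} (e : A ⊕ B ≃ S) : A ≃ S.sub (leftPart e) :=
  Equiv.ofBijective (fun a => ⟨e (.inl a), a, rfl⟩)
    ⟨fun a b h => by simpa using congrArg Subtype.val h, fun ⟨s, a, h⟩ => ⟨a, Subtype.ext h⟩⟩

/-- `B` is in bijection with the complement of the image of `A` under `A ⊔ B ≃ S`. -/
def rightEquiv {A B S : FB.{u}} (e : A ⊕ B ≃ S) : B ≃ S.sub (leftPart e)ᶜ :=
  Equiv.ofBijective (fun b => ⟨e (.inr b), by rintro ⟨a, h⟩; simp at h⟩)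
    ⟨fun a b h => by simpa using congrArg Subtype.val h, fun ⟨s, h⟩ => by
      obtain ⟨t, rfl⟩ := e.surjective s
      rcases t with a | b
      · exact absurd ⟨a, rfl⟩ h
      · exact ⟨b, rfl⟩⟩

/-- The element `x ⊗ y` of `(M ⊗ N)(S)` for `x ∈ M(A)` and `y ∈ N(B)`, where `A ⊔ B ≃ S`. -/
def tmul {A B S : FB.{u}} (e : A ⊕ B ≃ S) :
    M.obj A →ₗ[k] N.obj B →ₗ[k] TensorAt M N S :=
  (summand (leftPart e)).compl₁₂ (M.map ⟨leftEquiv e⟩).hom (N.map ⟨rightEquiv e⟩).hom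

theorem summand_congr {A B S : FB.{u}} {T T' : Set S} (h : T = T')
    (a : A ≃ S.sub T) (a' : A ≃ S.sub T') (b : B ≃ S.sub Tᶜ) (b' : B ≃ S.sub T'ᶜ)
    (ha : ∀ t, (a t : S) = a' t) (hb : ∀ t, (b t : S) = b' t) (x : M.obj A) (y : N.obj B) :
    (summand T (M.map ⟨a⟩ x) (N.map ⟨b⟩ y) : TensorAt M N S) =
      summand T' (M.map ⟨a'⟩ x) (N.map ⟨b'⟩ y) := by
  subst h
  obtain rfl : a = a' := Equiv.ext fun t => Subtype.ext (ha t)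
  obtain rfl : b = b' := Equiv.ext fun t => Subtype.ext (hb t)
  rfl

theorem map_map (M : Species k) {A B C : FB.{u}} (f : A ⟶ B) (g : B ⟶ C) (x : M.obj A) :
    M.map g (M.map f x) = M.map (f ≫ g) x := by simp

theorem tmul_congr {A B A' B' S : FB.{u}} (e : A ⊕ B ≃ S) (e' : A' ⊕ B' ≃ S)
    (a : A ⟶ A') (b : B ⟶ B')
    (h : ∀ t, e t = e' (Sum.map a.toEquiv b.toEquiv t)) (x : M.obj A) (y : N.obj B) :
    tmul e x y = tmul e' (M.map a x) (N.map b y) := by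
  simp only [tmul, LinearMap.compl₁₂_apply]
  change summand _ (M.map _ x) (N.map _ y) = summand _ (M.map _ (M.map _ x)) (N.map _ (N.map _ y))
  rw [map_map, map_map]
  refine summand_congr ?_ _ _ _ _ ?_ ?_ x y
  · ext s
    constructor
    · rintro ⟨t, rfl⟩
      exact ⟨a.toEquiv t, by simp [h]⟩
    · rintro ⟨t, rfl⟩
      exact ⟨a.toEquiv.symm t, by simp [h]⟩
  · intro t
    exact h (.inl t)
  · intro t
    exact h (.inr t)

theorem summand_eq_tmul {S : FB.{u}} (T : Set S) [DecidablePred (· ∈ T)]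
    (x : M.obj (S.sub T)) (y : N.obj (S.sub Tᶜ)) :
    summand T x y = tmul (A := S.sub T) (B := S.sub Tᶜ) (Equiv.Set.sumCompl T) x y := by
  simp only [tmul, LinearMap.compl₁₂_apply]
  have := summand_congr (M := M) (N := N) (A := S.sub T) (B := S.sub Tᶜ) (S := S) (T := T)
    (T' := leftPart (A := S.sub T) (B := S.sub Tᶜ) (Equiv.Set.sumCompl T))
    (by ext s; simp [leftPart]) (Equiv.refl _) (leftEquiv _) (Equiv.refl _) (rightEquiv _)
    (fun t => by simp [leftEquiv]) (fun t => by simp [rightEquiv]) x y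
  refine Eq.trans ?_ this
  have h1 : M.map ⟨Equiv.refl (S.sub T)⟩ = 𝟙 _ := M.map_id _
  have h2 : N.map ⟨Equiv.refl (S.sub Tᶜ)⟩ = 𝟙 _ := N.map_id _
  rw [h1, h2]; rfl

open scoped Classical in
variable (M N) in
/-- The tensor product of species. -/
abbrev tensorObj : Species k where
  obj S := TensorAt M N S
  map {S S'} g := tensorLift fun T =>
    tmul (A := S.sub T) (B := S.sub Tᶜ) ((Equiv.Set.sumCompl T).trans g.toEquiv)
  map_id S := by
    refine tensor_ext fun T x y => ?_
    rw [tensorLift_summand, summand_eq_tmul]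
    rfl
  map_comp {S S' S''} f g := by
    refine tensor_ext fun T x y => ?_
    rw [ModuleCat.comp_apply, tensorLift_summand, tensorLift_summand]
    conv_rhs => rw [tmul]
    rw [LinearMap.compl₁₂_apply, tensorLift_summand]
    refine tmul_congr _ _ _ _ ?_ x y
    rintro (t | t) <;> rfl

infixr:70 " ⊗ₛ " => tensorObj

theorem tensorObj_map_summand {S S' : FB.{u}} (g : S ⟶ S') (T : Set S)
    [DecidablePred (· ∈ T)] (x : M.obj (S.sub T)) (y : N.obj (S.sub Tᶜ)) :
    (M ⊗ₛ N).map g (summand T x y : TensorAt M N S) =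
      tmul (A := S.sub T) (B := S.sub Tᶜ) ((Equiv.Set.sumCompl T).trans g.toEquiv) x y := by
  rw [tensorLift_summand]
  congr!

theorem tensorObj_map_tmul {A B S S' : FB.{u}} (e : A ⊕ B ≃ S) (g : S ⟶ S')
    (x : M.obj A) (y : N.obj B) :
    (M ⊗ₛ N).map g (tmul e x y : TensorAt M N S) = tmul (e.trans g.toEquiv) x y := by
  classical
  rw [tmul, LinearMap.compl₁₂_apply, tensorObj_map_summand]
  refine (tmul_congr _ _ _ _ ?_ x y).symm
  rintro (t | t) <;> rfl

theorem tmul_naturality {A B S A' B' S' : FB.{u}} (e : A ⊕ B ≃ S) (e' : A' ⊕ B' ≃ S')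
    (a : A ⟶ A') (b : B ⟶ B') (g : S ⟶ S')
    (h : ∀ t, g.toEquiv (e t) = e' (Sum.map a.toEquiv b.toEquiv t)) (x : M.obj A) (y : N.obj B) :
    (M ⊗ₛ N).map g (tmul e x y : TensorAt M N S) = tmul e' (M.map a x) (N.map b y) := by
  rw [tensorObj_map_tmul]
  exact tmul_congr _ _ _ _ h x y

open scoped Classical in
/-- The morphism `M ⊗ N ⟶ P` sending `x ⊗ y` to `f e x y`, for a family of bilinear maps
`f e : M(A) × N(B) → P(S)`, one for each `e : A ⊔ B ≃ S`, that is natural in `A`, `B` and `S`. -/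
def tensorDesc
    (f : ∀ {A B S : FB.{u}} (_ : A ⊕ B ≃ S), M.obj A →ₗ[k] N.obj B →ₗ[k] P.obj S)
    (h : ∀ {A B S A' B' S' : FB.{u}} (e : A ⊕ B ≃ S) (e' : A' ⊕ B' ≃ S')
      (a : A ⟶ A') (b : B ⟶ B') (g : S ⟶ S')
      (_ : ∀ t, g.toEquiv (e t) = e' (Sum.map a.toEquiv b.toEquiv t))
      (x : M.obj A) (y : N.obj B), P.map g (f e x y) = f e' (M.map a x) (N.map b y)) :
    M ⊗ₛ N ⟶ P where
  app S := tensorLift fun T =>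
    f (A := S.sub T) (B := S.sub Tᶜ) (Equiv.Set.sumCompl T)
  naturality S S' g := by
    refine tensor_ext fun T x y => ?_
    rw [ModuleCat.comp_apply, ModuleCat.comp_apply]
    rw [tensorObj_map_summand, tensorLift_summand, tmul, LinearMap.compl₁₂_apply,
      tensorLift_summand]
    refine (h _ _ _ _ _ ?_ x y).symm
    rintro (t | t) <;> rfl

theorem tensorDesc_tmul
    (f : ∀ {A B S : FB.{u}} (_ : A ⊕ B ≃ S), M.obj A →ₗ[k] N.obj B →ₗ[k] P.obj S)
    (h) {A B S : FB.{u}} (e : A ⊕ B ≃ S) (x : M.obj A) (y : N.obj B) :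
    (tensorDesc (P := P) f h).app S (tmul e x y : TensorAt M N S) = f e x y := by
  classical
  rw [tmul, LinearMap.compl₁₂_apply]
  change tensorLift _ (summand _ _ _) = _
  rw [tensorLift_summand]
  have := h e (Equiv.Set.sumCompl (leftPart e)) (A' := S.sub _) (B' := S.sub _)
    ⟨leftEquiv e⟩ ⟨rightEquiv e⟩ (𝟙 S) (by rintro (t | t) <;> rfl) x y
  rw [P.map_id] at this
  refine Eq.trans ?_ this.symm
  congr!

/-- The tensor product of two morphisms of species: `x ⊗ y ↦ f(x) ⊗ g(y)`. -/
def tensorHom {M' N' : Species k} (f : M ⟶ M') (g : N ⟶ N') : M ⊗ₛ N ⟶ M' ⊗ₛ N' :=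
  tensorDesc (P := M' ⊗ₛ N')
    (fun {A B _} e => (tmul e).compl₁₂ (f.app A).hom (g.app B).hom)
    (fun e e' a b g' h x y => by
      simp only [LinearMap.compl₁₂_apply]
      refine (tmul_naturality e e' a b g' h _ _).trans ?_
      have h1 : f.app _ (M.map a x) = M'.map a (f.app _ x) := NatTrans.naturality_apply f a x
      have h2 : g.app _ (N.map b y) = N'.map b (g.app _ y) := NatTrans.naturality_apply g b y
      exact (congrArg₂ (fun x y => tmul e' x y) h1 h2).symm)

variable (M N P)

/-- The symmetry `x ⊗ y ↦ y ⊗ x`. -/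
def braid : M ⊗ₛ N ⟶ N ⊗ₛ M :=
  tensorDesc (P := N ⊗ₛ M) (fun {A B _} e => (tmul ((Equiv.sumComm B A).trans e)).flip)
    (fun e e' a b g h x y => by
      simp only [LinearMap.flip_apply]
      refine tmul_naturality _ _ b a g ?_ _ _
      rintro (t | t) <;> simp [h])

variable {M N P} in
/-- The element `x ⊗ (y ⊗ z)` of `(M ⊗ (N ⊗ P))(S)`, where `A ⊔ (B ⊔ C) ≃ S`. -/
def tmulRight {A B C S : FB.{u}} (e : A ⊕ (B ⊕ C) ≃ S) :
    M.obj A →ₗ[k] N.obj B →ₗ[k] P.obj C →ₗ[k] (M ⊗ₛ (N ⊗ₛ P)).obj S :=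
  LinearMap.mk₂ k
    (fun x y => (tmul (M := M) (N := N ⊗ₛ P) (A := A) (B := B.sum C) e x).comp
      (tmul (M := N) (N := P) (S := B.sum C) (Equiv.refl _) y))
    (fun _ _ _ => LinearMap.ext fun _ => by simp) (fun _ _ _ => LinearMap.ext fun _ => by simp)
    (fun _ _ _ => LinearMap.ext fun _ => by simp) (fun _ _ _ => LinearMap.ext fun _ => by simp)

variable {M N P} in
/-- The element `(x ⊗ y) ⊗ z` of `((M ⊗ N) ⊗ P)(S)`, where `(A ⊔ B) ⊔ C ≃ S`. -/
def tmulLeft {A B C S : FB.{u}} (e : (A ⊕ B) ⊕ C ≃ S) :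
    M.obj A →ₗ[k] N.obj B →ₗ[k] P.obj C →ₗ[k] ((M ⊗ₛ N) ⊗ₛ P).obj S :=
  (tmul (M := M) (N := N) (S := A.sum B) (Equiv.refl _)).compr₂
    (tmul (M := M ⊗ₛ N) (N := P) (A := A.sum B) (B := C) e)

variable {M N P} in
theorem tmulRight_apply {A B C S : FB.{u}} (e : A ⊕ (B ⊕ C) ≃ S)
    (x : M.obj A) (y : N.obj B) (z : P.obj C) :
    tmulRight e x y z = tmul (M := M) (N := N ⊗ₛ P) (A := A) (B := B.sum C) e x
      (tmul (M := N) (N := P) (S := B.sum C) (Equiv.refl _) y z) := rfl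

variable {M N P} in
theorem tmulLeft_apply {A B C S : FB.{u}} (e : (A ⊕ B) ⊕ C ≃ S)
    (x : M.obj A) (y : N.obj B) (z : P.obj C) :
    tmulLeft e x y z = tmul (M := M ⊗ₛ N) (N := P) (A := A.sum B) (B := C) e
      (tmul (M := M) (N := N) (S := A.sum B) (Equiv.refl _) x y) z := rfl

variable {M N P} in
theorem tmulRight_naturality {A B C S A' B' C' S' : FB.{u}} (e : A ⊕ (B ⊕ C) ≃ S)
    (e' : A' ⊕ (B' ⊕ C') ≃ S') (a : A ⟶ A') (b : B ⟶ B') (c : C ⟶ C') (g : S ⟶ S')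
    (h : ∀ t, g.toEquiv (e t) =
      e' (Sum.map a.toEquiv (Sum.map b.toEquiv c.toEquiv) t))
    (x : M.obj A) (y : N.obj B) (z : P.obj C) :
    (M ⊗ₛ (N ⊗ₛ P)).map g (tmulRight e x y z) =
      tmulRight e' (M.map a x) (N.map b y) (P.map c z) := by
  rw [tmulRight_apply, tmulRight_apply,
    tmul_naturality (M := M) (N := N ⊗ₛ P) (B := B.sum C) (B' := B'.sum C') e e' a
      ⟨b.toEquiv.sumCongr c.toEquiv⟩ g (by rintro (t | t | t) <;> simp [h])]
  congr 1
  exact tmul_naturality (S := B.sum C) (S' := B'.sum C') (Equiv.refl _) (Equiv.refl _) b c _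
    (by rintro (t | t) <;> rfl) y z

variable {M N P} in
theorem tmulLeft_naturality {A B C S A' B' C' S' : FB.{u}} (e : (A ⊕ B) ⊕ C ≃ S)
    (e' : (A' ⊕ B') ⊕ C' ≃ S') (a : A ⟶ A') (b : B ⟶ B') (c : C ⟶ C') (g : S ⟶ S')
    (h : ∀ t, g.toEquiv (e t) =
      e' (Sum.map (Sum.map a.toEquiv b.toEquiv) c.toEquiv t))
    (x : M.obj A) (y : N.obj B) (z : P.obj C) :
    ((M ⊗ₛ N) ⊗ₛ P).map g (tmulLeft e x y z) =
      tmulLeft e' (M.map a x) (N.map b y) (P.map c z) := by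
  rw [tmulLeft_apply, tmulLeft_apply,
    tmul_naturality (M := M ⊗ₛ N) (N := P) (A := A.sum B) (A' := A'.sum B') e e'
      ⟨a.toEquiv.sumCongr b.toEquiv⟩ c g (by rintro ((t | t) | t) <;> simp [h])]
  congr 2
  exact tmul_naturality (S := A.sum B) (S' := A'.sum B') (Equiv.refl _) (Equiv.refl _) a b _
    (by rintro (t | t) <;> rfl) x y

variable {M N} in
/-- Two linear maps out of `(M ⊗ N)(S)` agree if they agree on all elements `x ⊗ y`. -/
theorem tensor_ext_linear {S : FB.{u}} {X : Type u} [AddCommGroup X] [Module k X]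
    {f g : (M ⊗ₛ N).obj S →ₗ[k] X}
    (h : ∀ {A B : FB.{u}} (e : A ⊕ B ≃ S) (x : M.obj A) (y : N.obj B),
      f (tmul e x y) = g (tmul e x y)) : f = g := by
  classical
  have : (ModuleCat.ofHom f : (M ⊗ₛ N).obj S ⟶ ModuleCat.of k X) = ModuleCat.ofHom g := by
    refine tensor_ext fun T x y => ?_
    rw [summand_eq_tmul]
    exact h _ x y
  exact congrArg ModuleCat.Hom.hom this

open scoped Classical in
/-- The auxiliary trilinear map for the associator. -/
def assocAux {D C S : FB.{u}} (e : D ⊕ C ≃ S) :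
    (M ⊗ₛ N).obj D →ₗ[k] P.obj C →ₗ[k] (M ⊗ₛ (N ⊗ₛ P)).obj S :=
  (tensorLift (X := ModuleCat.of k (P.obj C →ₗ[k] (M ⊗ₛ (N ⊗ₛ P)).obj S)) fun T =>
    tmulRight (A := D.sub T) (B := D.sub Tᶜ) (C := C)
      ((Equiv.sumAssoc _ _ _).symm.trans
        (((Equiv.Set.sumCompl T).sumCongr (Equiv.refl C)).trans e))).hom

theorem assocAux_tmul {A B C D S : FB.{u}} (d : A ⊕ B ≃ D) (e : D ⊕ C ≃ S)
    (x : M.obj A) (y : N.obj B) (z : P.obj C) :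
    assocAux M N P e (tmul d x y) z =
      tmulRight ((Equiv.sumAssoc A B C).symm.trans ((d.sumCongr (Equiv.refl C)).trans e)) x y z := by
  classical
  have h1 := tensorLift_summand (X := ModuleCat.of k (P.obj C →ₗ[k] (M ⊗ₛ (N ⊗ₛ P)).obj S))
    (fun T => tmulRight (M := M) (N := N) (A := D.sub T) (B := D.sub Tᶜ) (C := C)
      ((Equiv.sumAssoc _ _ _).symm.trans
        (((Equiv.Set.sumCompl T).sumCongr (Equiv.refl C)).trans e)))
    (leftPart d) (M.map ⟨leftEquiv d⟩ x) (N.map ⟨rightEquiv d⟩ y)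
  refine (LinearMap.congr_fun h1 z).trans ?_
  have h2 := tmulRight_naturality (M := M) (N := N) (P := P)
    ((Equiv.sumAssoc A B C).symm.trans ((d.sumCongr (Equiv.refl C)).trans e))
    (A' := D.sub (leftPart d)) (B' := D.sub (leftPart d)ᶜ) (C' := C)
    ((Equiv.sumAssoc _ _ _).symm.trans
        (((Equiv.Set.sumCompl (leftPart d)).sumCongr (Equiv.refl C)).trans e))
    ⟨leftEquiv d⟩ ⟨rightEquiv d⟩ (𝟙 C) (𝟙 S) (by rintro (t | t | t) <;> rfl) x y z
  rw [P.map_id, (M ⊗ₛ (N ⊗ₛ P)).map_id] at h2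
  exact h2.symm

/-- The associator `(x ⊗ y) ⊗ z ↦ x ⊗ (y ⊗ z)`. -/
def assoc : (M ⊗ₛ N) ⊗ₛ P ⟶ M ⊗ₛ (N ⊗ₛ P) :=
  tensorDesc (P := M ⊗ₛ (N ⊗ₛ P)) (fun e => assocAux M N P e)
    (fun {D C S D' C' S'} e e' a b g h t z => by
      refine LinearMap.congr_fun (f := ((M ⊗ₛ (N ⊗ₛ P)).map g).hom ∘ₗ (assocAux M N P e).flip z)
        (g := (assocAux M N P e').flip (P.map b z) ∘ₗ ((M ⊗ₛ N).map a).hom)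
        (tensor_ext_linear fun {A B} d x y => ?_) t
      change (M ⊗ₛ (N ⊗ₛ P)).map g (assocAux M N P e (tmul d x y) z) =
        assocAux M N P e' ((M ⊗ₛ N).map a (tmul d x y)) (P.map b z)
      rw [tensorObj_map_tmul, assocAux_tmul, assocAux_tmul,
        tmulRight_naturality _
          ((Equiv.sumAssoc A B C').symm.trans
            (((d.trans a.toEquiv).sumCongr (Equiv.refl C')).trans e')) (𝟙 A) (𝟙 B) b g]
      · rw [M.map_id, N.map_id]; rfl
      · rintro (t | t | t) <;> simp [h])

theorem assoc_tmulLeft {A B C S : FB.{u}} (e : (A ⊕ B) ⊕ C ≃ S)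
    (x : M.obj A) (y : N.obj B) (z : P.obj C) :
    (assoc M N P).app S (tmulLeft e x y z) =
      tmulRight ((Equiv.sumAssoc A B C).symm.trans e) x y z := by
  refine (tensorDesc_tmul _ _ _ _ _).trans ((assocAux_tmul ..).trans ?_)
  congr 4
  ext (t | t | t) <;> rfl

/-- The inverse of the associator, `x ⊗ (y ⊗ z) ↦ (x ⊗ y) ⊗ z`. -/
def assocInv : M ⊗ₛ (N ⊗ₛ P) ⟶ (M ⊗ₛ N) ⊗ₛ P :=
  braid M (N ⊗ₛ P) ≫ tensorHom (braid N P) (𝟙 M) ≫ assoc P N M ≫ braid P (N ⊗ₛ M) ≫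
    tensorHom (braid N M) (𝟙 P)

end tensor

theorem tensorHom_tmul {M N M' N' : Species k} (f : M ⟶ M') (g : N ⟶ N') {A B S : FB.{u}}
    (e : A ⊕ B ≃ S) (x : M.obj A) (y : N.obj B) :
    (tensorHom f g).app S (tmul e x y) = tmul e (f.app A x) (g.app B y) :=
  tensorDesc_tmul _ _ _ _ _

theorem braid_tmul {M N : Species k} {A B S : FB.{u}}
    (e : A ⊕ B ≃ S) (x : M.obj A) (y : N.obj B) :
    (braid M N).app S (tmul e x y) = tmul ((Equiv.sumComm B A).trans e) y x :=
  tensorDesc_tmul _ _ _ _ _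

theorem tensorHom_id (M N : Species k) : tensorHom (𝟙 M) (𝟙 N) = 𝟙 (M ⊗ₛ N) := by
  ext S : 2
  refine ModuleCat.hom_ext (tensor_ext_linear fun e x y => ?_)
  exact tensorHom_tmul _ _ e x y

theorem tensorHom_comp_right (L : Species k) {M N P : Species k} (f : M ⟶ N) (g : N ⟶ P) :
    tensorHom (𝟙 L) f ≫ tensorHom (𝟙 L) g = tensorHom (𝟙 L) (f ≫ g) := by
  ext S : 2
  refine ModuleCat.hom_ext (tensor_ext_linear fun e x y => ?_)
  change (tensorHom (𝟙 L) g).app S ((tensorHom (𝟙 L) f).app S (tmul e x y)) =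
    (tensorHom (𝟙 L) (f ≫ g)).app S (tmul e x y)
  rw [tensorHom_tmul, tensorHom_tmul, tensorHom_tmul]
  rfl

/-- Exchange of the first two factors, `x ⊗ (y ⊗ z) ↦ y ⊗ (x ⊗ z)`. -/
def swap (M N P : Species k) : M ⊗ₛ (N ⊗ₛ P) ⟶ N ⊗ₛ (M ⊗ₛ P) :=
  assocInv M N P ≫ tensorHom (braid M N) (𝟙 P) ≫ assoc N M P

section symmetricAlgebra

variable (k)

/-- The symmetric algebra `Sym(𝐕) = ⨁ₙ Symⁿ(𝐕)` on the standard species `𝐕`: the space `Symⁿ(𝐕)(S)`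
is `0` unless `n = #S`, in which case it is free on one element `t^S`, fixed by all bijections.
Thus `Sym(𝐕)(S) = k`, with `1 : k` in the role of `t^S`. -/
abbrev Sym : Species k := (Functor.const FB.{u}).obj (ModuleCat.of k k)

/-- The divided power algebra `Div(𝐕) = ⨁ₙ Divⁿ(𝐕)`: likewise `Div(𝐕)(S)` is free on one
element `t^[S]` fixed by all bijections. -/
abbrev Div : Species k := (Functor.const FB.{u}).obj (ModuleCat.of k k)

/-- The averaging map `Sym(𝐕) ⟶ Div(𝐕)`, `t^S ↦ t^[S]`. -/
def avg : Sym k ⟶ Div k := 𝟙 _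

/-- The multiplication `t^A ⊗ t^B ↦ t^(A ⊔ B)` of `Sym(𝐕)`. -/
def symMul : Sym k ⊗ₛ Sym k ⟶ Sym k :=
  tensorDesc (P := Sym k) (fun _ => LinearMap.mul k k) (fun _ _ _ _ _ _ _ _ => rfl)

/-- The multiplication `t^[A] ⊗ t^[B] ↦ t^[A ⊔ B]` of `Div(𝐕)`. -/
def divMul : Div k ⊗ₛ Div k ⟶ Div k :=
  tensorDesc (P := Div k) (fun _ => LinearMap.mul k k) (fun _ _ _ _ _ _ _ _ => rfl)

/-- The basis vector `t^S` of `Sym(𝐕)(S)`. -/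
def symBasis (S : FB.{u}) : (Sym k).obj S := (1 : k)

/-- The element `∑_{S = A ⊔ B} t^A ⊗ t^B`. -/
def comulElt (S : FB.{u}) : (Sym k ⊗ₛ Sym k).obj S :=
  ∑ T : Set S, summand T (symBasis k (S.sub T)) (symBasis k (S.sub Tᶜ))

theorem comulElt_naturality {S S' : FB.{u}} (g : S ⟶ S') :
    (Sym k ⊗ₛ Sym k).map g (comulElt k S) = comulElt k S' := by
  classical
  unfold comulElt
  rw [map_sum]
  refine Fintype.sum_equiv (Equiv.Set.congr g.toEquiv) _ _ fun T => ?_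
  rw [summand_eq_tmul, summand_eq_tmul]
  refine tmul_naturality (M := Sym k) (N := Sym k) (A := S.sub T) (B := S.sub Tᶜ)
    (A' := S'.sub (g.toEquiv '' T)) (B' := S'.sub (g.toEquiv '' T)ᶜ) _ _
    ⟨g.toEquiv.image T⟩
    ⟨(g.toEquiv.image Tᶜ).trans (Equiv.setCongr (Set.image_compl_eq g.toEquiv.bijective))⟩ g ?_
    (symBasis k _) (symBasis k _)
  rintro (t | t) <;> rfl

/-- The comultiplication `t^S ↦ ∑_{S = A ⊔ B} t^A ⊗ t^B` of `Sym(𝐕)`. -/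
def symComul : Sym k ⟶ Sym k ⊗ₛ Sym k where
  app S := ModuleCat.ofHom (LinearMap.toSpanSingleton k _ (comulElt k S))
  naturality S S' g := by
    refine ModuleCat.hom_ext (LinearMap.ext fun c => ?_)
    change c • comulElt k S' = (Sym k ⊗ₛ Sym k).map g (c • comulElt k S)
    rw [map_smul, comulElt_naturality]

/-- The comultiplication `t^[S] ↦ ∑_{S = A ⊔ B} t^[A] ⊗ t^[B]` of `Div(𝐕)`. -/
def divComul : Div k ⟶ Div k ⊗ₛ Div k := symComul k

/-- The standard species `𝐕`, which is `k` on sets of cardinality `1` and `0` on all other sets.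
(The value on `S` is `k` or `0`, as a submodule of `k`.) -/
def stdSpecies : Species k where
  obj S := ModuleCat.of k
    ({ carrier := {c | Nat.card S ≠ 1 → c = 0}
       add_mem' := fun ha hb h => by rw [ha h, hb h, add_zero]
       zero_mem' := fun _ => rfl
       smul_mem' := fun c x hx h => by rw [hx h, smul_zero] } : Submodule k k)
  map g := ModuleCat.ofHom
    { toFun := fun c => ⟨c.1, fun h => c.2 (by rwa [Nat.card_congr g.toEquiv])⟩
      map_add' := fun _ _ => rfl
      map_smul' := fun _ _ => rfl }

/-- The inclusion of the summand `𝐕 = Sym¹(𝐕)` of `Sym(𝐕)`. -/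
def stdIncl : stdSpecies k ⟶ Sym k where
  app S := ModuleCat.ofHom (Submodule.subtype _)

/-- The projection of `Div(𝐕)` to its summand `Div¹(𝐕) = 𝐕`. -/
def divProj : Div k ⟶ stdSpecies k where
  app S := ModuleCat.ofHom
    { toFun := fun c : k => ⟨if Nat.card S = 1 then c else 0, fun h => if_neg h⟩
      map_add' := fun a b => Subtype.ext (by split_ifs <;> simp)
      map_smul' := fun a b => Subtype.ext (by split_ifs <;> simp) }
  naturality S S' g := by
    refine ModuleCat.hom_ext (LinearMap.ext fun c => Subtype.ext ?_)
    change (if Nat.card S' = 1 then _ else _) = (if Nat.card S = 1 then _ else _)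
    rw [Nat.card_congr g.toEquiv]
    rfl

end symmetricAlgebra

section weyl

/-- `m ⊗ id` on `Sym(𝐕) ⊗ (Sym(𝐕) ⊗ M)`. -/
def symMulLeft (M : Species k) : Sym k ⊗ₛ (Sym k ⊗ₛ M) ⟶ Sym k ⊗ₛ M :=
  assocInv _ _ _ ≫ tensorHom (symMul k) (𝟙 M)

/-- `m ⊗ id` on `Div(𝐕) ⊗ (Div(𝐕) ⊗ M)`. -/
def divMulLeft (M : Species k) : Div k ⊗ₛ (Div k ⊗ₛ M) ⟶ Div k ⊗ₛ M :=
  assocInv _ _ _ ≫ tensorHom (divMul k) (𝟙 M)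

/-- `Δ ⊗ id` on `Sym(𝐕) ⊗ M`. -/
def symComulLeft (M : Species k) : Sym k ⊗ₛ M ⟶ Sym k ⊗ₛ (Sym k ⊗ₛ M) :=
  tensorHom (symComul k) (𝟙 M) ≫ assoc _ _ _

/-- `Δ ⊗ id` on `Div(𝐕) ⊗ M`. -/
def divComulLeft (M : Species k) : Div k ⊗ₛ M ⟶ Div k ⊗ₛ (Div k ⊗ₛ M) :=
  tensorHom (divComul k) (𝟙 M) ≫ assoc _ _ _

/-- `id ⊗ f` -/
abbrev whiskerLeft (L : Species k) {M N : Species k} (f : M ⟶ N) : L ⊗ₛ M ⟶ L ⊗ₛ N :=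
  tensorHom (𝟙 L) f

variable {M : Species k} (a : Sym k ⊗ₛ M ⟶ Div k ⊗ₛ M)

/-- `a₁ a₂ : Sym(𝐕) ⊗ Sym(𝐕) ⊗ M ⟶ Div(𝐕) ⊗ Div(𝐕) ⊗ M`: first apply `a` to the second and
third factors, then `a` to the first and third factors. -/
def act₁₂ : Sym k ⊗ₛ (Sym k ⊗ₛ M) ⟶ Div k ⊗ₛ (Div k ⊗ₛ M) :=
  whiskerLeft (Sym k) a ≫ swap (Sym k) (Div k) M ≫ whiskerLeft (Div k) a ≫
    swap (Div k) (Div k) M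

/-- `a₂ a₁ : Sym(𝐕) ⊗ Sym(𝐕) ⊗ M ⟶ Div(𝐕) ⊗ Div(𝐕) ⊗ M`: first apply `a` to the first and
third factors, then `a` to the second and third factors. -/
def act₂₁ : Sym k ⊗ₛ (Sym k ⊗ₛ M) ⟶ Div k ⊗ₛ (Div k ⊗ₛ M) :=
  swap (Sym k) (Sym k) M ≫ whiskerLeft (Sym k) a ≫ swap (Sym k) (Div k) M ≫
    whiskerLeft (Div k) a

/-- The composition `a'` of
`id ⊗ Δ ⊗ id : Sym ⊗ Sym ⊗ M ⟶ Sym ⊗ Sym ⊗ Sym ⊗ M`,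
`τ ⊗ id ⊗ id : Sym ⊗ Sym ⊗ Sym ⊗ M ⟶ Sym ⊗ Sym ⊗ Sym ⊗ M`,
`id ⊗ m ⊗ id : Sym ⊗ Sym ⊗ Sym ⊗ M ⟶ Sym ⊗ Sym ⊗ M`,
`id ⊗ a : Sym ⊗ Sym ⊗ M ⟶ Sym ⊗ Div ⊗ M`,
`id ⊗ Δ ⊗ id : Sym ⊗ Div ⊗ M ⟶ Sym ⊗ Div ⊗ Div ⊗ M`,
`avg ⊗ id ⊗ id ⊗ id : Sym ⊗ Div ⊗ Div ⊗ M ⟶ Div ⊗ Div ⊗ Div ⊗ M`,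
`m ⊗ id ⊗ id : Div ⊗ Div ⊗ Div ⊗ M ⟶ Div ⊗ Div ⊗ M`. -/
def act' : Sym k ⊗ₛ (Sym k ⊗ₛ M) ⟶ Div k ⊗ₛ (Div k ⊗ₛ M) :=
  whiskerLeft (Sym k) (symComulLeft M) ≫
  swap (Sym k) (Sym k) (Sym k ⊗ₛ M) ≫
  whiskerLeft (Sym k) (symMulLeft M) ≫
  whiskerLeft (Sym k) a ≫
  whiskerLeft (Sym k) (divComulLeft M) ≫
  tensorHom (avg k) (𝟙 (Div k ⊗ₛ (Div k ⊗ₛ M))) ≫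
  divMulLeft (Div k ⊗ₛ M)

/-- `a'' = τ a' τ`, where `τ` exchanges the first two tensor factors. -/
def act'' : Sym k ⊗ₛ (Sym k ⊗ₛ M) ⟶ Div k ⊗ₛ (Div k ⊗ₛ M) :=
  swap (Sym k) (Sym k) M ≫ act' a ≫ swap (Div k) (Div k) M

end weyl

section weylRep

variable (k)

/-- A representation of the curried Weyl Lie algebra `𝔞(𝐕 ⊕ 𝐕*)`: a species `M` with a map
`a : Sym(𝐕) ⊗ M ⟶ Div(𝐕) ⊗ M` such that `[a₁, a₂] = a' - a''`. -/
structure WeylRep where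
  /-- The underlying species. -/
  species : Species k
  /-- The structure map. -/
  act : Sym k ⊗ₛ species ⟶ Div k ⊗ₛ species
  /-- The relation `[a₁, a₂] = a' - a''`. -/
  rel : act₁₂ act - act₂₁ act = act' act - act'' act

namespace WeylRep

variable {k}

/-- A morphism of representations is a map of species that commutes with the structure maps. -/
@[ext]
structure Hom (M N : WeylRep k) where
  hom : M.species ⟶ N.species
  comm : whiskerLeft (Sym k) hom ≫ N.act = M.act ≫ whiskerLeft (Div k) hom

instance : Category (WeylRep k) where
  Hom := Hom
  id M := ⟨𝟙 _, by
    unfold whiskerLeft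
    rw [tensorHom_id]
    exact (Category.id_comp _).trans (Category.comp_id _).symm⟩
  comp f g := ⟨f.hom ≫ g.hom, by
    unfold whiskerLeft
    rw [← tensorHom_comp_right, Category.assoc]
    exact (congrArg _ g.comm).trans (((Category.assoc _ _ _).symm.trans
      (congrArg (· ≫ _) f.comm)).trans (Category.assoc _ _ _))⟩
  id_comp f := Hom.ext (Category.id_comp _)
  comp_id f := Hom.ext (Category.comp_id _)
  assoc f g h := Hom.ext (Category.assoc _ _ _)

variable (k) in
/-- The forgetful functor to species. -/
def forget : WeylRep k ⥤ Species k where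
  obj M := M.species
  map f := f.hom

end WeylRep

section operations

variable {k} {M : Species k}

/-- The coefficient of `t^A` of an element of `(Sym(𝐕) ⊗ M)(S)`, an element of `M(S \ A)`. -/
def coeff {S : FB.{u}} (A : Set S) : (Sym k ⊗ₛ M).obj S ⟶ M.obj (S.sub Aᶜ) :=
  ModuleCat.ofHom ((TensorProduct.lid k (M.obj (S.sub Aᶜ))).toLinearMap ∘ₗ
    DirectSum.component k (Set S)
      (fun T => (Sym k).obj (S.sub T) ⊗[k] M.obj (S.sub Tᶜ)) A)

/-- The map `M(S \ B) → (Sym(𝐕) ⊗ M)(S)`, `x ↦ t^B ⊗ x`. -/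
def symTmul {S : FB.{u}} (B : Set S) : M.obj (S.sub Bᶜ) ⟶ (Sym k ⊗ₛ M).obj S :=
  ModuleCat.ofHom (summand (M := Sym k) (N := M) B (symBasis k (S.sub B)))

variable (a : Sym k ⊗ₛ M ⟶ Div k ⊗ₛ M)

/-- The symmetric operation `φ^S_{A,B} : M(S \ B) → M(S \ A)` corresponding to `a`, defined by
`a(t^B ⊗ x) = ∑_A t^A ⊗ φ^S_{A,B}(x)`. -/
def operation {S : FB.{u}} (A B : Set S) : M.obj (S.sub Bᶜ) ⟶ M.obj (S.sub Aᶜ) :=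
  symTmul B ≫ a.app S ≫ coeff A

/-- The disjoint union `S ⊔ [n]`. -/
abbrev addFin (S : FB.{u}) (n : ℕ) : FB.{u} := ⟨S ⊕ Fin n⟩

/-- The subset `A ⊔ [n]` of `S ⊔ [n]`. -/
def extendSet {S : FB.{u}} (n : ℕ) (A : Set S) : Set (addFin S n) := {s | ∀ x, s = .inl x → x ∈ A}

/-- The identification of `S \ A` with `(S ⊔ [n]) \ (A ⊔ [n])`. -/
def extendEquiv {S : FB.{u}} (n : ℕ) (A : Set S) :
    S.sub Aᶜ ≃ (addFin S n).sub (extendSet n A)ᶜ :=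
  Equiv.ofBijective (fun s => ⟨.inl s.1, fun h => s.2 (h _ rfl)⟩)
    ⟨fun s s' h => Subtype.ext (Sum.inl_injective (congrArg Subtype.val h)), by
      rintro ⟨s | s, hs⟩
      · exact ⟨⟨s, fun h => hs fun x hx => by rwa [← Sum.inl_injective hx]⟩, rfl⟩
      · exact absurd (fun x hx => by simp at hx) hs⟩

/-- The simple operation `φ[n]`, given by `φ[n]^S_{A,B} = φ^{S ⊔ [n]}_{A ⊔ [n], B ⊔ [n]}` for disjoint
`A, B ⊆ S`. -/
def simpleOperation (n : ℕ) {S : FB.{u}} (A B : Set S) :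
    M.obj (S.sub Bᶜ) ⟶ M.obj (S.sub Aᶜ) :=
  M.map ⟨extendEquiv n B⟩ ≫ operation a (extendSet n A) (extendSet n B) ≫
    M.map ⟨(extendEquiv n A).symm⟩

/-- The operation `ω = -φ[1]` attached to a representation of the curried Weyl Lie algebra (the
companion operation being `α = φ[0] + φ[1]`). -/
def omegaOperation {S : FB.{u}} (A B : Set S) : M.obj (S.sub Bᶜ) ⟶ M.obj (S.sub Aᶜ) :=
  -simpleOperation a 1 A B

/-- The composition `M ≅ Sym⁰(𝐕) ⊗ M ⟶ Sym(𝐕) ⊗ M`, evaluated on `S`. -/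
def symZeroIncl (M : Species k) (S : FB.{u}) : M.obj S ⟶ (Sym k ⊗ₛ M).obj S :=
  M.map ⟨(Equiv.subtypeUnivEquiv (p := (· ∈ (∅ : Set S)ᶜ)) (fun _ h => h)).symm⟩ ≫ symTmul ∅

/-- The composition `Div(𝐕) ⊗ M ⟶ Div⁰(𝐕) ⊗ M ≅ M`, evaluated on `S`. -/
def divZeroProj (M : Species k) (S : FB.{u}) : (Div k ⊗ₛ M).obj S ⟶ M.obj S :=
  coeff ∅ ≫ M.map ⟨Equiv.subtypeUnivEquiv (p := (· ∈ (∅ : Set S)ᶜ)) (fun _ h => h)⟩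

/-- The restriction of `a` to a map `𝐕 ⊗ M ⟶ 𝐕 ⊗ M`, which is the structure map of the underlying
representation of the curried general linear Lie algebra. -/
def glRestrict : stdSpecies k ⊗ₛ M ⟶ stdSpecies k ⊗ₛ M :=
  tensorHom (stdIncl k) (𝟙 M) ≫ a ≫ tensorHom (divProj k) (𝟙 M)

/-- The basis vector `t^i` of `𝐕({i})`. -/
def stdBasis {S : FB.{u}} (i : S) : (stdSpecies k).obj (S.sub {i}) :=
  (⟨1, fun h => absurd (by simp) h⟩ : {c : k // Nat.card (S.sub {i}) ≠ 1 → c = 0})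

open scoped Classical in
/-- The bijection `ι_{i,j} : S \ {j} → S \ {i}` which sends `i` to `j` (if `i ≠ j`) and fixes all other
elements. -/
def iota {S : FB.{u}} (i j : S) : S.sub {j}ᶜ ≃ S.sub {i}ᶜ :=
  (Equiv.swap i j).subtypeEquiv fun s => by
    simp [Equiv.swap_apply_eq_iff]

open scoped Classical in
/-- A map `b : 𝐕 ⊗ M ⟶ 𝐕 ⊗ M` is the `δ`-standard structure on `M` if
`b(t^j ⊗ x) = δ t^j ⊗ x + ∑_{i ≠ j} t^i ⊗ (ι_{i,j})_* x` for all `j ∈ S` and `x ∈ M(S \ {j})`. -/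
def IsStandardGl (δ : k) (b : stdSpecies k ⊗ₛ M ⟶ stdSpecies k ⊗ₛ M) : Prop :=
  ∀ (S : FB.{u}) (j : S) (x : M.obj (S.sub {j}ᶜ)),
    b.app S (summand {j} (stdBasis j) x) =
      δ • summand {j} (stdBasis j) x +
        ∑ i ∈ Finset.univ.erase j, summand {i} (stdBasis i) (M.map ⟨iota i j⟩ x)

end operations

namespace WeylRep

variable {k}

/-- The representation `M` has central character `χ`. -/
def HasCentralCharacter (χ : k) (M : WeylRep k) : Prop :=
  ∀ S : FB.{u}, symZeroIncl M.species S ≫ M.act.app S ≫ divZeroProj M.species S =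
    χ • 𝟙 (M.species.obj S)

/-- The representation `M` is `δ`-standard. -/
def IsStandard (δ : k) (M : WeylRep k) : Prop := IsStandardGl δ (glRestrict M.act)

/-- The `ω` operation of `M` vanishes. -/
def OmegaVanishes (M : WeylRep k) : Prop :=
  ∀ (S : FB.{u}) (A B : Set S), Disjoint A B → omegaOperation M.act A B = 0

/-- The full subcategory `Rep^δ(𝔞(𝐕 ⊕ 𝐕*))'` of the representations of the curried Weyl Lie algebra
that have central character `δ`, are `0`-standard, and have vanishing `ω` operation. -/
abbrev PrimeRep (δ : k) :=
  ObjectProperty.FullSubcategory fun M : WeylRep k =>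
    M.HasCentralCharacter δ ∧ M.IsStandard 0 ∧ M.OmegaVanishes

end WeylRep

end weylRep

end Species

/-- Number of equivalence classes of `r` that do not meet `K`. -/
def Setoid.countAvoiding {X : Type u} (r : Setoid X) (K : Set X) : ℕ :=
  ((Quotient.mk r '' K)ᶜ : Set (Quotient r)).ncard

namespace PartitionDiagram

section general

variable {T T' : Type u}

/-- The restriction of an equivalence relation to `K`, all points off `K` being singletons. -/
def restrict (p : Setoid T) (K : Set T) : Setoid T where
  r x y := x = y ∨ (x ∈ K ∧ y ∈ K ∧ p x y)
  iseqv :=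
    { refl := fun x => .inl rfl
      symm := by
        rintro x y (h | ⟨hx, hy, h⟩)
        · exact .inl h.symm
        · exact .inr ⟨hy, hx, p.symm' h⟩
      trans := by
        rintro x y z (rfl | ⟨hx, hy, h⟩) (rfl | ⟨hy', hz, h'⟩)
        · exact .inl rfl
        · exact .inr ⟨hy', hz, h'⟩
        · exact .inr ⟨hx, hy, h⟩
        · exact .inr ⟨hx, hz, p.trans' h h'⟩ }

theorem sup_avoid {p q : Setoid T} {K : Set T} (hq : ∀ x y, q x y → x = y ∨ (x ∈ K ∧ y ∈ K))
    {x y : T} (hx : ∀ a ∈ K, ¬ p x a) (h : (p ⊔ q) x y) : p x y := by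
  let u : Setoid T :=
    { r := fun x y => p x y ∨ ((∃ a ∈ K, p x a) ∧ ∃ b ∈ K, p y b)
      iseqv :=
        { refl := fun x => .inl (p.refl' x)
          symm := by
            rintro x y (h | ⟨h, h'⟩)
            · exact .inl (p.symm' h)
            · exact .inr ⟨h', h⟩
          trans := by
            rintro x y z (h | ⟨h1, h2⟩) (h' | ⟨h1', h2'⟩)
            · exact .inl (p.trans' h h')
            · obtain ⟨a, ha, h3⟩ := h1'
              exact .inr ⟨⟨a, ha, p.trans' h h3⟩, h2'⟩
            · obtain ⟨a, ha, h3⟩ := h2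
              exact .inr ⟨h1, a, ha, p.trans' (p.symm' h') h3⟩
            · exact .inr ⟨h1, h2'⟩ } }
  have hu : p ⊔ q ≤ u := sup_le (fun x y h => .inl h) (fun x y h => by
    rcases hq x y h with rfl | ⟨hx, hy⟩
    · exact .inl (p.refl' x)
    · exact .inr ⟨⟨x, hx, p.refl' x⟩, y, hy, p.refl' y⟩)
  rcases hu h with h | ⟨⟨a, ha, h1⟩, -⟩
  · exact h
  · exact absurd h1 (hx a ha)

theorem sup_restrict {p q : Setoid T} {K : Set T}
    (hq : ∀ x y, q x y → x = y ∨ (x ∈ K ∧ y ∈ K)) :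
    restrict (p ⊔ q) K = restrict p K ⊔ q := by
  apply le_antisymm
  · set w := restrict p K ⊔ q with hw
    have hpw : restrict p K ≤ w := le_sup_left
    have hqw : q ≤ w := le_sup_right
    have key : ∀ {a b}, a ∈ K → b ∈ K → p a b → w a b := fun ha hb h => hpw (.inr ⟨ha, hb, h⟩)
    let u : Setoid T :=
      { r := fun x y => p x y ∨ ∃ a ∈ K, ∃ b ∈ K, p x a ∧ w a b ∧ p b y
        iseqv :=
          { refl := fun x => .inl (p.refl' x)
            symm := by
              rintro x y (h | ⟨a, ha, b, hb, h1, h2, h3⟩)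
              · exact .inl (p.symm' h)
              · exact .inr ⟨b, hb, a, ha, p.symm' h3, w.symm' h2, p.symm' h1⟩
            trans := by
              rintro x y z (h | ⟨a, ha, b, hb, h1, h2, h3⟩) (h' | ⟨c, hc, d, hd, h1', h2', h3'⟩)
              · exact .inl (p.trans' h h')
              · exact .inr ⟨c, hc, d, hd, p.trans' h h1', h2', h3'⟩
              · exact .inr ⟨a, ha, b, hb, h1, h2, p.trans' h3 h'⟩
              · exact .inr ⟨a, ha, d, hd, h1,
                  w.trans' h2 (w.trans' (key hb hc (p.trans' h3 h1')) h2'), h3'⟩ } }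
    have hu : p ⊔ q ≤ u := sup_le (fun x y h => .inl h) (fun x y h => by
      rcases hq x y h with rfl | ⟨hx, hy⟩
      · exact .inl (p.refl' x)
      · exact .inr ⟨x, hx, y, hy, p.refl' x, hqw h, p.refl' y⟩)
    rintro x y (rfl | ⟨hx, hy, h⟩)
    · exact w.refl' x
    · rcases hu h with h | ⟨a, ha, b, hb, h1, h2, h3⟩
      · exact key hx hy h
      · exact w.trans' (key hx ha h1) (w.trans' h2 (key hb hy h3))
  · refine sup_le ?_ fun x y h => ?_
    · rintro x y (rfl | ⟨hx, hy, h⟩)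
      · exact .inl rfl
      · exact .inr ⟨hx, hy, (le_sup_left : p ≤ p ⊔ q) h⟩
    · rcases hq x y h with rfl | ⟨hx, hy⟩
      · exact .inl rfl
      · exact .inr ⟨hx, hy, (le_sup_right : q ≤ p ⊔ q) h⟩

/-- Counting classes with the help of any map with the given kernel. -/
theorem countAvoiding_eq {Q : Type u} (p : Setoid T) (K : Set T) (f : T → Q)
    (hf : ∀ x y, f x = f y ↔ p x y) : p.countAvoiding K = (Set.range f \ f '' K).ncard := by
  let F : Quotient p → Q := Quotient.lift f fun x y h => (hf x y).2 h
  have hF : F.Injective := by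
    rintro ⟨x⟩ ⟨y⟩ h
    exact Quotient.sound ((hf x y).1 h)
  rw [Setoid.countAvoiding, ← Set.ncard_image_of_injective _ hF]
  congr 1
  ext z
  constructor
  · rintro ⟨⟨x⟩, hx, rfl⟩
    refine ⟨⟨x, rfl⟩, ?_⟩
    rintro ⟨y, hy, h⟩
    exact hx ⟨y, hy, Quotient.sound ((hf _ _).1 h)⟩
  · rintro ⟨⟨x, rfl⟩, hx⟩
    refine ⟨Quotient.mk p x, ?_, rfl⟩
    rintro ⟨y, hy, h⟩
    exact hx ⟨y, hy, (hf _ _).2 (Quotient.exact h)⟩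

theorem countAvoiding_sup {p q : Setoid T} {K : Set T}
    (hq : ∀ x y, q x y → x = y ∨ (x ∈ K ∧ y ∈ K)) :
    (p ⊔ q).countAvoiding K = p.countAvoiding K := by
  let F : Quotient p → Quotient (p ⊔ q) :=
    Quotient.map' id fun x y h => (le_sup_left : p ≤ p ⊔ q) h
  have himg : F '' (Quotient.mk p '' K)ᶜ = (Quotient.mk (p ⊔ q) '' K)ᶜ := by
    ext z
    constructor
    · rintro ⟨⟨x⟩, hx, rfl⟩ ⟨y, hy, h⟩
      have h1 : (p ⊔ q) x y := (p ⊔ q).symm' (Quotient.exact h)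
      have h2 := sup_avoid hq (fun a ha h3 => hx ⟨a, ha, Quotient.sound (p.symm' h3)⟩) h1
      exact hx ⟨y, hy, Quotient.sound (p.symm' h2)⟩
    · obtain ⟨x, rfl⟩ := Quotient.exists_rep z
      intro hx
      refine ⟨Quotient.mk p x, ?_, rfl⟩
      rintro ⟨y, hy, h⟩
      exact hx ⟨y, hy, Quotient.sound ((le_sup_left : p ≤ p ⊔ q) (Quotient.exact h))⟩
  rw [Setoid.countAvoiding, ← himg, Setoid.countAvoiding, Set.InjOn.ncard_image]
  rintro ⟨x⟩ hx ⟨y⟩ hy h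
  exact Quotient.sound (sup_avoid hq
    (fun a ha h3 => hx ⟨a, ha, Quotient.sound (p.symm' h3)⟩) (Quotient.exact h))

theorem map_rel {i : T' → T} (hi : i.Injective) (g : Setoid T') {x y : T} :
    (g.map i) x y ↔ x = y ∨ ∃ a b, g a b ∧ i a = x ∧ i b = y := by
  constructor
  · let u : Setoid T :=
      { r := fun x y => x = y ∨ ∃ a b, g a b ∧ i a = x ∧ i b = y
        iseqv :=
          { refl := fun x => .inl rfl
            symm := by
              rintro x y (h | ⟨a, b, h, rfl, rfl⟩)
              · exact .inl h.symm
              · exact .inr ⟨b, a, g.symm' h, rfl, rfl⟩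
            trans := by
              rintro x y z (rfl | ⟨a, b, h, rfl, rfl⟩) (rfl | ⟨c, d, h', hc, rfl⟩)
              · exact .inl rfl
              · exact .inr ⟨c, d, h', hc, rfl⟩
              · exact .inr ⟨a, b, h, rfl, rfl⟩
              · obtain rfl := hi hc
                exact .inr ⟨a, d, g.trans' h h', rfl, rfl⟩ } }
    intro h
    have hu : g.map i ≤ u := Setoid.eqvGen_le fun x y ⟨a, b, h, h1, h2⟩ => .inr ⟨a, b, h, h1, h2⟩
    exact hu h
  · rintro (rfl | ⟨a, b, h, rfl, rfl⟩)
    · exact (g.map i).refl' x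
    · exact Relation.EqvGen.rel _ _ ⟨a, b, h, rfl, rfl⟩

theorem countAvoiding_map {i : T' → T} (hi : i.Injective) (g : Setoid T') (K : Set T)
    (hK : ∀ x, x ∉ K → x ∈ Set.range i) :
    (g.map i).countAvoiding K = g.countAvoiding (i ⁻¹' K) := by
  rw [countAvoiding_eq g (i ⁻¹' K) (fun x => Quotient.mk (g.map i) (i x)) fun x y => ?_]
  · rw [Setoid.countAvoiding]
    congr 1
    ext z
    obtain ⟨x, rfl⟩ := Quotient.exists_rep z
    constructor
    · intro hx
      have hxK : x ∉ K := fun h => hx ⟨x, h, rfl⟩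
      obtain ⟨y, rfl⟩ := hK x hxK
      refine ⟨⟨y, rfl⟩, ?_⟩
      rintro ⟨w, hw, h⟩
      exact hx ⟨i w, hw, h⟩
    · rintro ⟨⟨y, hy⟩, hx⟩ ⟨w, hw, h⟩
      rw [← hy] at hx h
      rcases (map_rel hi g).1 (Quotient.exact h) with rfl | ⟨a, b, hab, rfl, hb⟩
      · exact hx ⟨y, hw, rfl⟩
      · exact hx ⟨a, hw, h⟩
  · refine Quotient.eq.trans ?_
    rw [map_rel hi]
    constructor
    · rintro (h | ⟨a, b, h, h1, h2⟩)
      · rw [hi h]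
      · rwa [← hi h1, ← hi h2]
    · exact fun h => .inr ⟨x, y, h, rfl, rfl⟩

theorem map_le_iff {i : T' → T} {g : Setoid T'} {p : Setoid T} :
    g.map i ≤ p ↔ g ≤ p.comap i := by
  constructor
  · intro h x y hxy
    exact h (Relation.EqvGen.rel _ _ ⟨x, y, hxy, rfl, rfl⟩)
  · intro h
    refine Setoid.eqvGen_le ?_
    rintro _ _ ⟨a, b, hab, rfl, rfl⟩
    exact h hab

theorem map_sup (i : T' → T) (g g' : Setoid T') : (g ⊔ g').map i = g.map i ⊔ g'.map i := by
  apply le_antisymm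
  · rw [map_le_iff]
    exact sup_le (map_le_iff.1 le_sup_left) (map_le_iff.1 le_sup_right)
  · exact sup_le (map_le_iff.2 ((le_sup_left : g ≤ g ⊔ g').trans (map_le_iff.1 le_rfl)))
      (map_le_iff.2 ((le_sup_right : g' ≤ g ⊔ g').trans (map_le_iff.1 le_rfl)))

theorem map_map' {T'' : Type u} (j : T'' → T') (i : T' → T) (g : Setoid T'') :
    (g.map j).map i = g.map (i ∘ j) := by
  apply le_antisymm
  · rw [map_le_iff, map_le_iff]
    exact fun x y h => map_le_iff.1 (le_refl (g.map (i ∘ j))) h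
  · rw [map_le_iff]
    exact (map_le_iff.1 (le_refl (g.map j))).trans fun x y h =>
      map_le_iff.1 (le_refl ((g.map j).map i)) h

theorem comap_restrict {i : T' → T} (p : Setoid T) (K : Set T) (hi : i.Injective)
    (hK : ∀ x, i x ∈ K) : (restrict p K).comap i = p.comap i := by
  ext x y
  constructor
  · rintro (h | ⟨-, -, h⟩)
    · rw [hi h]
    · exact h
  · exact fun h => .inr ⟨hK x, hK y, h⟩

theorem map_comap {i : T' → T} (p : Setoid T) (hi : i.Injective) :
    (p.comap i).map i = restrict p (Set.range i) := by
  ext x y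
  rw [map_rel hi]
  constructor
  · rintro (h | ⟨a, b, h, rfl, rfl⟩)
    · exact .inl h
    · exact .inr ⟨⟨a, rfl⟩, ⟨b, rfl⟩, h⟩
  · rintro (h | ⟨⟨a, rfl⟩, ⟨b, rfl⟩, h⟩)
    · exact .inl h
    · exact .inr ⟨a, b, h, rfl, rfl⟩

theorem map_restrict {i : T' → T} (hi : i.Injective) (g : Setoid T') (K : Set T) :
    (restrict g (i ⁻¹' K)).map i = restrict (g.map i) K := by
  ext x y
  rw [map_rel hi]
  constructor
  · rintro (h | ⟨a, b, h | ⟨ha, hb, h⟩, rfl, rfl⟩)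
    · exact .inl h
    · exact .inl (congrArg i h)
    · exact .inr ⟨ha, hb, (map_rel hi g).2 (.inr ⟨a, b, h, rfl, rfl⟩)⟩
  · rintro (h | ⟨hx, hy, h⟩)
    · exact .inl h
    · rcases (map_rel hi g).1 h with h | ⟨a, b, h', rfl, rfl⟩
      · exact .inl h
      · exact .inr ⟨a, b, .inr ⟨hx, hy, h'⟩, rfl, rfl⟩

theorem countAvoiding_add [Finite T] (R : Setoid T) (j : T' → T) (O : Set T') :
    R.countAvoiding (Set.range j) + (R.comap j).countAvoiding O = R.countAvoiding (j '' O) := by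
  rw [countAvoiding_eq (R.comap j) O (fun x => Quotient.mk R (j x)) fun x y => Quotient.eq,
    Setoid.countAvoiding, Setoid.countAvoiding, ← Set.ncard_union_eq]
  · congr 1
    ext z
    simp only [Set.mem_union, Set.mem_compl_iff, Set.mem_sdiff, Set.mem_image, Set.mem_range]
    constructor
    · rintro (h | ⟨-, h⟩)
      · rintro ⟨_, ⟨a, -, rfl⟩, h'⟩
        exact h ⟨_, ⟨a, rfl⟩, h'⟩
      · rintro ⟨_, ⟨a, ha, rfl⟩, h'⟩
        exact h ⟨a, ha, h'⟩
    · intro h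
      by_cases hz : ∃ y, Quotient.mk R (j y) = z
      · refine .inr ⟨hz, ?_⟩
        rintro ⟨a, ha, h'⟩
        exact h ⟨_, ⟨a, ha, rfl⟩, h'⟩
      · refine .inl ?_
        rintro ⟨_, ⟨a, rfl⟩, h'⟩
        exact hz ⟨a, h'⟩
  · rw [Set.disjoint_left]
    rintro z hz ⟨⟨y, rfl⟩, -⟩
    exact hz ⟨_, ⟨y, rfl⟩, rfl⟩

theorem assoc_aux {T₃ A B : Type u} {g : Setoid T₃} {i : T₃ → T} (hi : i.Injective)
    {o : A → T₃} (ho : o.Injective) {j : T' → T} (hj : j.Injective) {a : A → T'}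
    (hcomm : j ∘ a = i ∘ o) (hr : Set.range o = i ⁻¹' Set.range j)
    (hK : ∀ x, x ∉ Set.range j → x ∈ Set.range i) {b : B → T'} (hb : b.Injective) (h : Setoid B) :
    (g.comap o).map a ⊔ h.map b = (g.map i ⊔ h.map (j ∘ b)).comap j ∧
    g.countAvoiding (Set.range o) = (g.map i ⊔ h.map (j ∘ b)).countAvoiding (Set.range j) := by
  have hsupp : ∀ x y, h.map (j ∘ b) x y →
      x = y ∨ (x ∈ Set.range j ∧ y ∈ Set.range j) := by
    intro x y hxy
    rcases (map_rel (hj.comp hb) h).1 hxy with h | ⟨c, d, -, rfl, rfl⟩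
    · exact .inl h
    · exact .inr ⟨⟨_, rfl⟩, ⟨_, rfl⟩⟩
  constructor
  · rw [← comap_restrict _ (Set.range j) hj (fun x => ⟨x, rfl⟩), sup_restrict hsupp,
      ← map_restrict hi, ← hr, ← map_comap _ ho, map_map', ← hcomm, ← map_map', ← map_map',
      ← map_sup, Setoid.comap_map_eq _ _ hj]
  · rw [countAvoiding_sup hsupp, countAvoiding_map hi g _ hK, hr]

end general

variable {W X Y Z : Type u}

/-- The equivalence relation on `X ⊔ Y ⊔ Z` generated by one on `X ⊔ Y` and one on `Y ⊔ Z`. -/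
def glue (r : Setoid (X ⊕ Y)) (s : Setoid (Y ⊕ Z)) : Setoid (X ⊕ (Y ⊕ Z)) :=
  r.map (Sum.map id Sum.inl) ⊔ s.map Sum.inr

/-- The inclusion `X ⊔ Z → X ⊔ Y ⊔ Z`. -/
def outer : X ⊕ Z → X ⊕ (Y ⊕ Z) := Sum.map id Sum.inr

/-- The diagram underlying the composition of two partition diagrams. -/
def comp (r : Setoid (X ⊕ Y)) (s : Setoid (Y ⊕ Z)) : Setoid (X ⊕ Z) := (glue r s).comap outer

/-- The number of parts of the glued diagram that are contained in the middle set `Y`. -/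
def loops (r : Setoid (X ⊕ Y)) (s : Setoid (Y ⊕ Z)) : ℕ :=
  (glue r s).countAvoiding (Set.range outer)

/-- The identity diagram on `X`: the parts are the pairs of corresponding elements. -/
def one (X : Type u) : Setoid (X ⊕ X) := Setoid.ker (Sum.elim id id)

/-- The partition diagram of a bijection. -/
def graph (e : X ≃ Y) : Setoid (X ⊕ Y) := Setoid.ker (Sum.elim e id)

theorem glue_le {r : Setoid (X ⊕ Y)} {s : Setoid (Y ⊕ Z)} {p : Setoid (X ⊕ (Y ⊕ Z))} :
    glue r s ≤ p ↔ r ≤ p.comap (Sum.map id Sum.inl) ∧ s ≤ p.comap Sum.inr := by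
  rw [glue, sup_le_iff, map_le_iff, map_le_iff]

theorem glue_left {r : Setoid (X ⊕ Y)} {s : Setoid (Y ⊕ Z)} {x y} (h : r x y) :
    glue r s (Sum.map id Sum.inl x) (Sum.map id Sum.inl y) := (glue_le.1 le_rfl).1 h

theorem glue_right {r : Setoid (X ⊕ Y)} {s : Setoid (Y ⊕ Z)} {x y} (h : s x y) :
    glue r s (Sum.inr x) (Sum.inr y) := (glue_le.1 le_rfl).2 h

theorem glue_graph (e : X ≃ Y) (s : Setoid (Y ⊕ Z)) :
    glue (graph e) s = s.comap (Sum.elim (fun x => Sum.inl (e x)) id) := by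
  apply le_antisymm
  · rw [glue_le]
    constructor
    · rintro (x | x) (y | y) h <;>
      · have h : Sum.elim e id _ = Sum.elim e id _ := h
        simp at h
        simp [Setoid.comap_rel, h]
    · exact fun x y h => h
  · have key : ∀ x : X ⊕ (Y ⊕ Z), glue (graph e) s x
        (Sum.inr (Sum.elim (fun x => Sum.inl (e x)) id x)) := by
      rintro (x | x)
      · exact glue_left (r := graph e) (x := .inl x) (y := .inr (e x)) rfl
      · exact Setoid.refl' _ _
    intro x y h
    exact Setoid.trans' _ (key x) (Setoid.trans' _ (glue_right h) (Setoid.symm' _ (key y)))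

theorem glue_one (r : Setoid (X ⊕ Y)) :
    glue r (one Y) = r.comap (Sum.elim Sum.inl (Sum.elim Sum.inr Sum.inr)) := by
  apply le_antisymm
  · rw [glue_le]
    constructor
    · rintro (x | x) (y | y) h <;> exact h
    · rintro (x | x) (y | y) h <;>
      · have h : Sum.elim id id _ = Sum.elim id id _ := h
        simp at h
        simp [Setoid.comap_rel, h]
  · have key : ∀ x : X ⊕ (Y ⊕ Y), glue r (one Y) x
        (Sum.map id Sum.inl (Sum.elim Sum.inl (Sum.elim Sum.inr Sum.inr) x)) := by
      rintro (x | x | x)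
      · exact Setoid.refl' _ _
      · exact Setoid.refl' _ _
      · exact glue_right (s := one Y) (x := .inr x) (y := .inl x) rfl
    intro x y h
    exact Setoid.trans' _ (key x) (Setoid.trans' _ (glue_left h) (Setoid.symm' _ (key y)))

theorem graph_refl (X : Type u) : graph (Equiv.refl X) = one X := rfl

theorem countAvoiding_eq_zero {T : Type u} (p : Setoid T) (K : Set T)
    (h : ∀ x, ∃ y ∈ K, p y x) : p.countAvoiding K = 0 := by
  have : Quotient.mk p '' K = Set.univ := by
    rw [Set.eq_univ_iff_forall]
    rintro ⟨x⟩
    obtain ⟨y, hy, hxy⟩ := h x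
    exact ⟨y, hy, Quotient.sound hxy⟩
  rw [Setoid.countAvoiding, this, Set.compl_univ, Set.ncard_empty]

theorem graph_comp (e : X ≃ Y) (s : Setoid (Y ⊕ Z)) :
    comp (graph e) s = s.comap (Sum.map e id) := by
  rw [comp, glue_graph, ← Setoid.comap_comp]
  congr 1
  funext x
  rcases x with x | x <;> rfl

theorem loops_graph (e : X ≃ Y) (s : Setoid (Y ⊕ Z)) : loops (graph e) s = 0 := by
  refine countAvoiding_eq_zero _ _ ?_
  rw [glue_graph]
  rintro (x | x | x)
  · exact ⟨_, ⟨.inl x, rfl⟩, Setoid.refl' _ _⟩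
  · refine ⟨_, ⟨.inl (e.symm x), rfl⟩, ?_⟩
    simp [Setoid.comap_rel, outer]
  · exact ⟨_, ⟨.inr x, rfl⟩, Setoid.refl' _ _⟩

theorem one_comp (s : Setoid (X ⊕ Y)) : comp (one X) s = s := by
  rw [← graph_refl, graph_comp]
  ext (x | x) (y | y) <;> rfl

theorem loops_one_left (s : Setoid (X ⊕ Y)) : loops (one X) s = 0 := by
  rw [← graph_refl, loops_graph]

theorem comp_one (r : Setoid (X ⊕ Y)) : comp r (one Y) = r := by
  rw [comp, glue_one]
  ext (x | x) (y | y) <;> rfl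

theorem loops_one_right (r : Setoid (X ⊕ Y)) : loops r (one Y) = 0 := by
  refine countAvoiding_eq_zero _ _ ?_
  rw [glue_one]
  rintro (x | x | x)
  · exact ⟨_, ⟨.inl x, rfl⟩, Setoid.refl' _ _⟩
  · exact ⟨_, ⟨.inr x, rfl⟩, Setoid.refl' _ _⟩
  · exact ⟨_, ⟨.inr x, rfl⟩, Setoid.refl' _ _⟩

theorem graph_comp_graph (e : X ≃ Y) (f : Y ≃ Z) : comp (graph e) (graph f) = graph (e.trans f) := by
  rw [graph_comp]
  ext (x | x) (y | y) <;> rfl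

theorem outer_injective : (outer : X ⊕ Z → X ⊕ (Y ⊕ Z)).Injective :=
  Sum.map_injective.2 ⟨Function.injective_id, Sum.inr_injective⟩

/-- The equivalence relation on `W ⊔ X ⊔ Y ⊔ Z` generated by three composable diagrams. -/
def glue₃ (r : Setoid (W ⊕ X)) (s : Setoid (X ⊕ Y)) (t : Setoid (Y ⊕ Z)) :
    Setoid (W ⊕ (X ⊕ (Y ⊕ Z))) :=
  r.map (Sum.map id Sum.inl) ⊔ s.map (Sum.inr ∘ Sum.map id Sum.inl) ⊔ t.map (Sum.inr ∘ Sum.inr)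

theorem glue_comp_left (r : Setoid (W ⊕ X)) (s : Setoid (X ⊕ Y)) (t : Setoid (Y ⊕ Z)) :
    glue (comp r s) t = (glue₃ r s t).comap (Sum.map id Sum.inr) ∧
    loops r s = (glue₃ r s t).countAvoiding (Set.range (Sum.map id Sum.inr)) := by
  have := assoc_aux (g := glue r s) (i := Sum.map id (Sum.map id Sum.inl))
    (T := W ⊕ (X ⊕ (Y ⊕ Z))) (o := outer) (a := Sum.map id Sum.inl)
    (j := (Sum.map id Sum.inr : W ⊕ (Y ⊕ Z) → W ⊕ (X ⊕ (Y ⊕ Z)))) (b := Sum.inr)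
    (Sum.map_injective.2 ⟨Function.injective_id,
      Sum.map_injective.2 ⟨Function.injective_id, Sum.inl_injective⟩⟩) outer_injective
    (Sum.map_injective.2 ⟨Function.injective_id, Sum.inr_injective⟩)
    (by funext x; rcases x with x | x <;> rfl)
    (by ext (x | x | x) <;> simp [outer])
    (by rintro (x | x | x | x) <;> simp)
    Sum.inr_injective t
  have hg : (glue r s).map (Sum.map id (Sum.map id Sum.inl)) ⊔
      t.map ((Sum.map id Sum.inr : W ⊕ (Y ⊕ Z) → W ⊕ (X ⊕ (Y ⊕ Z))) ∘ Sum.inr) = glue₃ r s t := by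
    rw [glue, map_sup, map_map', map_map', glue₃]
    have : (Sum.map id (Sum.map id Sum.inl) ∘ Sum.map id Sum.inl :
        W ⊕ X → W ⊕ (X ⊕ (Y ⊕ Z))) = Sum.map id Sum.inl := by
      funext x
      rcases x with x | x <;> rfl
    rw [this]
    rfl
  rwa [hg] at this

theorem glue_comp_right (r : Setoid (W ⊕ X)) (s : Setoid (X ⊕ Y)) (t : Setoid (Y ⊕ Z)) :
    glue r (comp s t) = (glue₃ r s t).comap (Sum.map id (Sum.map id Sum.inr)) ∧
    loops s t =
      (glue₃ r s t).countAvoiding (Set.range (Sum.map id (Sum.map id Sum.inr))) := by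
  have := assoc_aux (g := glue s t) (i := Sum.inr)
    (T := W ⊕ (X ⊕ (Y ⊕ Z))) (o := outer) (a := Sum.inr)
    (j := (Sum.map id (Sum.map id Sum.inr) : W ⊕ (X ⊕ Z) → W ⊕ (X ⊕ (Y ⊕ Z))))
    (b := Sum.map id Sum.inl)
    Sum.inr_injective outer_injective
    (Sum.map_injective.2 ⟨Function.injective_id,
      Sum.map_injective.2 ⟨Function.injective_id, Sum.inr_injective⟩⟩)
    (by funext x; rcases x with x | x <;> rfl)
    (by ext (x | x | x) <;> simp [outer])
    (by rintro (x | x | x | x) <;> simp)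
    (Sum.map_injective.2 ⟨Function.injective_id, Sum.inl_injective⟩) r
  have hg : (glue s t).map Sum.inr ⊔
      r.map ((Sum.map id (Sum.map id Sum.inr) : W ⊕ (X ⊕ Z) → W ⊕ (X ⊕ (Y ⊕ Z))) ∘
        Sum.map id Sum.inl) = glue₃ r s t := by
    rw [glue, map_sup, map_map', map_map', glue₃, sup_comm, ← sup_assoc]
    have : (Sum.map id (Sum.map id Sum.inr) ∘ Sum.map id Sum.inl :
        W ⊕ X → W ⊕ (X ⊕ (Y ⊕ Z))) = Sum.map id Sum.inl := by
      funext x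
      rcases x with x | x <;> rfl
    rw [this]
  rw [hg, sup_comm] at this
  exact this

theorem comp_assoc (r : Setoid (W ⊕ X)) (s : Setoid (X ⊕ Y)) (t : Setoid (Y ⊕ Z)) :
    comp (comp r s) t = comp r (comp s t) := by
  have : (Sum.map id Sum.inr ∘ outer : W ⊕ Z → W ⊕ (X ⊕ (Y ⊕ Z))) =
      Sum.map id (Sum.map id Sum.inr) ∘ outer := by
    funext x
    rcases x with x | x <;> rfl
  change (glue (comp r s) t).comap outer = (glue r (comp s t)).comap outer
  rw [(glue_comp_left r s t).1, (glue_comp_right r s t).1]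
  exact congrArg (fun i => (glue₃ r s t).comap i) this

theorem loops_assoc [Finite W] [Finite X] [Finite Y] [Finite Z]
    (r : Setoid (W ⊕ X)) (s : Setoid (X ⊕ Y)) (t : Setoid (Y ⊕ Z)) :
    loops r s + loops (comp r s) t = loops s t + loops r (comp s t) := by
  rw [(glue_comp_left r s t).2, (glue_comp_right r s t).2, loops, loops,
    (glue_comp_left r s t).1, (glue_comp_right r s t).1, countAvoiding_add, countAvoiding_add,
    ← Set.range_comp, ← Set.range_comp]
  have : (Sum.map id Sum.inr ∘ outer : W ⊕ Z → W ⊕ (X ⊕ (Y ⊕ Z))) =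
      Sum.map id (Sum.map id Sum.inr) ∘ outer := by
    funext x
    rcases x with x | x <;> rfl
  rw [this]

end PartitionDiagram

/-- The partition category `𝔓(δ)`. Its objects are the finite sets. -/
structure PartitionCat {k : Type u} [CommRing k] (δ : k) : Type (u + 1) where
  /-- The underlying finite set. -/
  set : FB.{u}

namespace PartitionCat

variable {k : Type u} [CommRing k] (δ : k)

/-- The `k`-module of morphisms `X ⟶ Y`, free on the partition diagrams from `X` to `Y`, i.e. on the
set partitions (equivalence relations) of `X ⊔ Y`. -/
abbrev HomModule (k : Type u) [CommRing k] (X Y : FB.{u}) : Type u := Setoid (X ⊕ Y) →₀ k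

/-- Composition of morphisms: bilinear, with `r ≫ s = δ ^ (number of removed parts) • (comp r s)`
for diagrams `r` and `s`. -/
def compₗ (X Y Z : FB.{u}) : HomModule k X Y →ₗ[k] HomModule k Y Z →ₗ[k] HomModule k X Z :=
  Finsupp.lsum k fun r => LinearMap.toSpanSingleton k _ <| Finsupp.lsum k fun s =>
    LinearMap.toSpanSingleton k _ <|
      Finsupp.single (PartitionDiagram.comp r s) (δ ^ PartitionDiagram.loops r s)

@[simp] theorem compₗ_single {X Y Z : FB.{u}} (r : Setoid (X ⊕ Y)) (s : Setoid (Y ⊕ Z)) (a b : k) :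
    compₗ δ X Y Z (Finsupp.single r a) (Finsupp.single s b) =
      Finsupp.single (PartitionDiagram.comp r s) (a * b * δ ^ PartitionDiagram.loops r s) := by
  simp only [compₗ, Finsupp.lsum_single, LinearMap.toSpanSingleton_apply, LinearMap.smul_apply,
    Finsupp.smul_single, smul_eq_mul, mul_assoc]

theorem compₗ_add_left (X Y Z : FB.{u}) (f f' : HomModule k X Y) (g : HomModule k Y Z) :
    compₗ δ X Y Z (f + f') g = compₗ δ X Y Z f g + compₗ δ X Y Z f' g := by
  rw [map_add, LinearMap.add_apply]

theorem compₗ_smul_left (X Y Z : FB.{u}) (c : k) (f : HomModule k X Y) (g : HomModule k Y Z) :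
    compₗ δ X Y Z (c • f) g = c • compₗ δ X Y Z f g := by
  rw [map_smul, LinearMap.smul_apply]

variable {δ}

instance : Category (PartitionCat δ) where
  Hom X Y := HomModule k X.set Y.set
  id X := Finsupp.single (PartitionDiagram.one X.set) 1
  comp f g := compₗ δ _ _ _ f g
  id_comp {X Y} f := by
    have : compₗ δ X.set X.set Y.set (Finsupp.single (PartitionDiagram.one X.set) 1) =
        LinearMap.id := by
      refine Finsupp.lhom_ext fun s b => ?_
      simp [PartitionDiagram.one_comp, PartitionDiagram.loops_one_left]
    exact LinearMap.congr_fun this f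
  comp_id {X Y} f := by
    have : (compₗ δ X.set Y.set Y.set).flip (Finsupp.single (PartitionDiagram.one Y.set) 1) =
        LinearMap.id := by
      refine Finsupp.lhom_ext fun s b => ?_
      simp [PartitionDiagram.comp_one, PartitionDiagram.loops_one_right]
    exact LinearMap.congr_fun this f
  assoc {W X Y Z} f g h := by
    induction f using Finsupp.induction_linear with
    | zero => simp
    | add f f' hf hf' => simp only [map_add, LinearMap.add_apply, hf, hf']
    | single r a =>
      induction g using Finsupp.induction_linear with
      | zero => simp
      | add g g' hg hg' => simp only [map_add, LinearMap.add_apply, hg, hg']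
      | single s b =>
        induction h using Finsupp.induction_linear with
        | zero => simp
        | add h h' hh hh' => simp only [map_add, hh, hh']
        | single t c =>
          simp only [compₗ_single]
          rw [PartitionDiagram.comp_assoc]
          congr 1
          have := congrArg (δ ^ ·) (PartitionDiagram.loops_assoc r s t)
          simp only [pow_add] at this
          linear_combination a * b * c * this

instance : Preadditive (PartitionCat δ) where
  homGroup X Y := inferInstanceAs (AddCommGroup (HomModule k X.set Y.set))
  add_comp X Y Z := compₗ_add_left δ X.set Y.set Z.set
  comp_add X Y Z f := map_add (compₗ δ X.set Y.set Z.set f)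

instance : Linear k (PartitionCat δ) where
  homModule X Y := inferInstanceAs (Module k (HomModule k X.set Y.set))
  smul_comp X Y Z := compₗ_smul_left δ X.set Y.set Z.set
  comp_smul X Y Z f c := map_smul (compₗ δ X.set Y.set Z.set f) c

/-- The morphism given by a partition diagram. -/
def ofDiagram {X Y : FB.{u}} (r : Setoid (X ⊕ Y)) :
    (⟨X⟩ : PartitionCat δ) ⟶ ⟨Y⟩ :=
  (Finsupp.single r 1 : HomModule k X Y)

variable (δ) in
/-- The functor from `FB` to the partition category. -/
def ofFB : FB.{u} ⥤ PartitionCat δ where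
  obj X := ⟨X⟩
  map e := ofDiagram (PartitionDiagram.graph e.toEquiv)
  map_comp {X Y Z} e f := by
    change Finsupp.single _ 1 = compₗ δ X Y Z (Finsupp.single _ 1) (Finsupp.single _ 1)
    rw [compₗ_single, PartitionDiagram.graph_comp_graph, PartitionDiagram.loops_graph]
    simp

/-- The equivalence relation on `S` whose only non-trivial class is `A`. -/
def blockSetoid {S : Type u} (A : Set S) : Setoid S where
  r x y := x = y ∨ (x ∈ A ∧ y ∈ A)
  iseqv :=
    { refl := fun x => .inl rfl
      symm := by
        rintro x y (h | ⟨hx, hy⟩)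
        · exact .inl h.symm
        · exact .inr ⟨hy, hx⟩
      trans := by
        rintro x y z (rfl | ⟨hx, hy⟩) (rfl | ⟨hy', hz⟩)
        · exact .inl rfl
        · exact .inr ⟨hy', hz⟩
        · exact .inr ⟨hx, hy⟩
        · exact .inr ⟨hx, hz⟩ }

variable (δ) in
/-- For disjoint `A, B ⊆ S`, the morphism `η^S_{A,B} : S \ B ⟶ S \ A` in which `A ⊔ B` forms a single
block and the remaining diagram is the identity of `S \ (A ∪ B)`. -/
def eta {S : FB.{u}} (A B : Set S) : (⟨S.sub Bᶜ⟩ : PartitionCat δ) ⟶ ⟨S.sub Aᶜ⟩ :=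
  ofDiagram ((blockSetoid (A ∪ B)).comap (Sum.elim Subtype.val Subtype.val))

end PartitionCat

section representations

variable {k : Type u} [CommRing k] (δ : k)

/-- The representations of the partition category: `k`-linear functors to `k`-modules. -/
abbrev PartitionRep :=
  ObjectProperty.FullSubcategory fun F : PartitionCat δ ⥤ ModuleCat.{u} k =>
    F.Additive ∧ F.Linear k

namespace PartitionRep

variable {δ}

/-- The underlying `FB`-module of a representation of the partition category. -/
abbrev species (N : PartitionRep δ) : Species k := PartitionCat.ofFB δ ⋙ N.obj

variable (δ) in
/-- The forgetful functor to `FB`-modules. -/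
def forget : PartitionRep δ ⥤ Species k :=
  ObjectProperty.ι _ ⋙ (Functor.whiskeringLeft _ _ _).obj (PartitionCat.ofFB δ)

end PartitionRep

end representations

end

/-! Since Sym(𝐕) and Div(𝐕) are free of rank one on every finite set, both sides of a structure map
`a` are ⨁_{U ⊆ S} M(U) when evaluated on S, and `a` is a matrix of maps M(U) → M(V) for U, V ⊆ S,
namely φ^S_{S \ V, S \ U}. In terms of these coefficients, [a₁, a₂] = a' - a'' becomes a family of
quadratic relations (`weyl_rel_sets`): a difference of two composites, each through a single
intermediate set, equals a difference of two sums of coefficients over the smaller ambient sets S \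
E.

The vanishing of ω says that the coefficient M(U) → M(V) is zero when U ∪ V misses exactly one point
of S. The relation itself propagates this to any positive number of missed points
(`op_eq_zero_of_ncard`). So the ambient set of a nonzero coefficient is forced to be U ∪ V, and each
of the two sums keeps at most one term. Picture the coefficient M(U) → M(V) as a diagram with the
single block U △ V and the identity on U ∩ V. The relations then degenerate to two laws: two
successive blocks that share a point merge into one block (`opn_comp_of_univ`), and two disjoint
blocks commute (`opn_comm_of_univ`). The central character says that the empty block acts by δ, and
0-standardness says that a block {i, j} with one source and one target point acts as a bijection.
These data are recorded in `BlockAction`, through which both sides of the correspondence pass.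

From a block action to the partition category: a partition of X ⊔ Y acts as the product of its
blocks, which are commuting endomorphisms of ⨁_U M(U) for U ⊆ X ⊔ Y. To compose with a second
diagram, its parts are applied one by one inside X ⊔ Y ⊔ Z; each part merges the blocks that it
meets (`blockOp_blockProd`), exactly as classes merge in the joined partition
(`parts_sup_blockSetoid`). At the end the classes contained in Y have neither source nor target
points, are empty blocks, and contribute the factor δ^c (`diagram_comp`). Conversely, the one-block
diagrams of a representation of 𝔓(δ) obey the two laws (`PartitionRep.blockAction`), and every
diagram is built from them (`el_partial`).

From a block action to the Weyl side: extend the operations by zero to pairs with U ∪ V ≠ S. The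
resulting `a` satisfies the Weyl relation because each instance of it is a merging law, a
commutation law, or trivial (`op_rel`).

The passages are mutually inverse because each one preserves the single-block operations
(`diagram_blockDiagram`, `blockAction_diagram`, `PrimeRep.op_eq`). None of them changes the
underlying species or the underlying maps, which is why the functors compose to identities on the
nose. -/

noncomputable section

namespace Species

variable {k : Type u} [CommRing k] {M N : Species k}

/-! ### Elements and coefficients of Sym(𝐕) ⊗ M indexed by injections. -/

section extension

/-- An injection identifies its source with the complement of the complement of its image. -/
def embEquiv {X S : FB.{u}} (u : X ↪ S) : X ≃ S.sub (Set.range u)ᶜᶜ :=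
  (Equiv.ofInjective u u.injective).trans (Equiv.setCongr (compl_compl _).symm)

/-- For an injection `u : X ↪ S`, the map `x ↦ t^(S \ u(X)) ⊗ x` from `M(X)` to
`(Sym(𝐕) ⊗ M)(S)`. -/
def el {X S : FB.{u}} (u : X ↪ S) : M.obj X →ₗ[k] (Sym k ⊗ₛ M).obj S :=
  summand (M := Sym k) (N := M) (Set.range u)ᶜ (symBasis k _) ∘ₗ (M.map ⟨embEquiv u⟩).hom

/-- For an injection `u : X ↪ S`, the coefficient of `t^(S \ u(X))`, as an element of `M(X)`. -/
def cf {X S : FB.{u}} (u : X ↪ S) : (Sym k ⊗ₛ M).obj S →ₗ[k] M.obj X :=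
  (M.map ⟨(embEquiv u).symm⟩).hom ∘ₗ (coeff (M := M) (Set.range u)ᶜ).hom

theorem coeff_summand_self {S : FB.{u}} (A : Set S) (c : k) (x : M.obj (S.sub Aᶜ)) :
    coeff (M := M) A (summand (M := Sym k) A (c : (Sym k).obj (S.sub A)) x) = c • x := by
  classical
  simp only [coeff, summand]
  refine (congrArg (TensorProduct.lid k (M.obj (S.sub Aᶜ))) (DirectSum.component.lof_self k
    (M := fun T : Set S => (Sym k).obj (S.sub T) ⊗[k] M.obj (S.sub Tᶜ)) A (c ⊗ₜ[k] x))).trans ?_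
  exact TensorProduct.lid_tmul _ _

theorem coeff_summand_ne {S : FB.{u}} {A B : Set S} (h : A ≠ B) (c : k)
    (x : M.obj (S.sub Bᶜ)) :
    coeff (M := M) A (summand (M := Sym k) B (c : (Sym k).obj (S.sub B)) x) = 0 := by
  classical
  simp only [coeff, summand]
  refine (congrArg (TensorProduct.lid k (M.obj (S.sub Aᶜ))) ((DirectSum.component.of k
    (M := fun T : Set S => (Sym k).obj (S.sub T) ⊗[k] M.obj (S.sub Tᶜ)) A B (c ⊗ₜ[k] x)).trans
      (dif_neg h.symm))).trans ?_
  exact map_zero _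

theorem map_refl {X : FB.{u}} (x : M.obj X) : M.map ⟨Equiv.refl X⟩ x = x := by
  change M.map (𝟙 X) x = x
  simp

theorem map_trans {X Y Z : FB.{u}} (e : X ≃ Y) (f : Y ≃ Z) (x : M.obj X) :
    M.map ⟨f⟩ (M.map ⟨e⟩ x) = M.map (⟨e.trans f⟩ : X ⟶ Z) x := map_map M _ _ x

theorem map_symm_map {X Y : FB.{u}} (e : X ≃ Y) (x : M.obj X) :
    M.map (⟨e.symm⟩ : Y ⟶ X) (M.map (⟨e⟩ : X ⟶ Y) x) = x := by
  rw [map_trans, Equiv.self_trans_symm, map_refl]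

theorem map_map_symm {X Y : FB.{u}} (e : X ≃ Y) (x : M.obj Y) :
    M.map (⟨e⟩ : X ⟶ Y) (M.map (⟨e.symm⟩ : Y ⟶ X) x) = x := by
  rw [map_trans, Equiv.symm_trans_self, map_refl]

theorem cf_el_self {X S : FB.{u}} (u : X ↪ S) (x : M.obj X) : cf u (el u x) = x := by
  simp only [cf, el, LinearMap.comp_apply]
  refine (congrArg (M.map ⟨(embEquiv u).symm⟩) (coeff_summand_self _ (1 : k) _)).trans ?_
  rw [one_smul]
  exact map_symm_map _ _

theorem cf_el_ne {X Y S : FB.{u}} (u : X ↪ S) (v : Y ↪ S) (h : Set.range u ≠ Set.range v)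
    (y : M.obj Y) : cf u (el v y) = 0 := by
  simp only [cf, el, LinearMap.comp_apply]
  refine (congrArg (M.map ⟨(embEquiv u).symm⟩) (coeff_summand_ne
    (fun h' => h (compl_injective h')) (1 : k) _)).trans ?_
  exact map_zero _

theorem leftPart_eq {A X S : FB.{u}} (e : A ⊕ X ≃ S) :
    leftPart e = (Set.range (e ∘ Sum.inr))ᶜ := by
  ext s
  obtain ⟨t | t, rfl⟩ := e.surjective s <;> simp [leftPart]

/-- The first tensor factor is a scalar, so a pure tensor only remembers how the second factor sits
in S. -/
theorem tmul_eq_el {A X S : FB.{u}} (e : A ⊕ X ≃ S) (u : X ↪ S) (h : ∀ x, e (.inr x) = u x)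
    (c : k) (x : M.obj X) :
    (tmul (M := Sym k) (N := M) e (c : (Sym k).obj A) x : (Sym k ⊗ₛ M).obj S) = c • el u x := by
  have hr : leftPart e = (Set.range u)ᶜ := by
    rw [leftPart_eq]
    congr 2
    funext x
    exact h x
  have := summand_congr (M := Sym k) (N := M) hr (leftEquiv e)
    ((leftEquiv e).trans (Equiv.setCongr hr)) (rightEquiv e) (embEquiv u) (fun _ => rfl)
    (fun t => h t) (symBasis k A) x
  have h2 : (tmul (M := Sym k) (N := M) e (symBasis k A) x : (Sym k ⊗ₛ M).obj S) = el u x := this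
  rw [← h2, ← LinearMap.map_smul₂]
  congr 2
  exact (mul_one c).symm

/-- A reparametrisation of the source is absorbed by the functoriality of M. Up to this transport
`el u` depends only on the image of `u`, so injections can replace subsets and no cast between equal
subsets is ever needed. -/
theorem el_trans {X Y S : FB.{u}} (e : X ≃ Y) (u : Y ↪ S) (x : M.obj X) :
    el (e.toEmbedding.trans u) x = el u (M.map (⟨e⟩ : X ⟶ Y) x) := by
  have hr : Set.range (e.toEmbedding.trans u) = Set.range u := by
    ext s
    simp only [Set.mem_range, Function.Embedding.trans_apply, Equiv.coe_toEmbedding]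
    exact e.exists_congr_left.trans (by simp)
  have := summand_congr (M := Sym k) (N := M) (congrArg (·ᶜ) hr) (Equiv.refl _)
    (Equiv.setCongr (congrArg (·ᶜ) hr)) (embEquiv (e.toEmbedding.trans u))
    (e.trans (embEquiv u)) (fun _ => rfl) (fun _ => rfl) (symBasis k _) x
  simp only [el, LinearMap.comp_apply]
  refine this.trans ?_
  rw [← map_trans]
  rfl

theorem exists_equiv_of_range_eq {X Y S : Type*} (u : X ↪ S) (v : Y ↪ S)
    (h : Set.range u = Set.range v) : ∃ e : X ≃ Y, e.toEmbedding.trans v = u := by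
  refine ⟨(Equiv.ofInjective u u.injective).trans ((Equiv.setCongr h).trans
    (Equiv.ofInjective v v.injective).symm), ?_⟩
  ext x
  simp only [Function.Embedding.trans_apply, Equiv.coe_toEmbedding, Equiv.trans_apply]
  exact Equiv.apply_ofInjective_symm v.injective _

theorem cf_trans {X Y S : FB.{u}} (e : X ≃ Y) (u : Y ↪ S) (z : (Sym k ⊗ₛ M).obj S) :
    M.map (⟨e⟩ : X ⟶ Y) (cf (e.toEmbedding.trans u) z) = cf u z := by
  have hr : Set.range (e.toEmbedding.trans u) = Set.range u := by
    ext s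
    simp only [Set.mem_range, Function.Embedding.trans_apply, Equiv.coe_toEmbedding]
    exact e.exists_congr_left.trans (by simp)
  refine LinearMap.congr_fun (f := (M.map (⟨e⟩ : X ⟶ Y)).hom ∘ₗ cf (e.toEmbedding.trans u))
    (g := cf u) (tensor_ext_linear fun {A B} d c y => ?_) z
  let w : B ↪ S := (Function.Embedding.inr (α := A)).trans d.toEmbedding
  rw [tmul_eq_el d w (fun _ => rfl), map_smul, map_smul, LinearMap.comp_apply]
  congr 1
  by_cases hw : Set.range u = Set.range w
  · obtain ⟨f, hf⟩ := exists_equiv_of_range_eq w u hw.symm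
    have h1 : f.toEmbedding.trans u = (f.trans e.symm).toEmbedding.trans (e.toEmbedding.trans u) := by
      ext; simp
    rw [← hf, el_trans, cf_el_self, ← el_trans, h1, el_trans, cf_el_self]
    exact (map_trans _ _ _).trans (by congr 3; exact FB.hom_ext fun _ => by simp)
  · rw [cf_el_ne _ _ hw, cf_el_ne _ _ (hr ▸ hw)]
    exact map_zero _

/-- The inclusion of a subset. -/
abbrev incl {S : FB.{u}} (U : Set S) : S.sub U ↪ S := Function.Embedding.subtype _

theorem range_incl {S : FB.{u}} (U : Set S) : Set.range (incl U) = U := Subtype.range_val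

theorem linear_ext_el {S : FB.{u}} {X : Type u} [AddCommGroup X] [Module k X]
    {f g : (Sym k ⊗ₛ M).obj S →ₗ[k] X}
    (h : ∀ {Y : FB.{u}} (u : Y ↪ S) (y : M.obj Y), f (el u y) = g (el u y)) : f = g := by
  refine tensor_ext_linear fun {A B} d c y => ?_
  rw [tmul_eq_el d ((Function.Embedding.inr (α := A)).trans d.toEmbedding) (fun _ => rfl),
    map_smul, map_smul, h]

/-- This is the decomposition of (Sym ⊗ M)(S) as ⨁_U M(U): on `el u y` only the term with U the
image of `u` is nonzero. -/
theorem sum_el_cf {S : FB.{u}} (z : (Sym k ⊗ₛ M).obj S) :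
    ∑ U : Set S, el (incl U) (cf (incl U) z) = z := by
  classical
  have : ∑ U : Set S, el (incl U) ∘ₗ cf (incl U) = (LinearMap.id : (Sym k ⊗ₛ M).obj S →ₗ[k] _) := by
    refine linear_ext_el fun {Y} u y => ?_
    simp only [LinearMap.sum_apply, LinearMap.comp_apply]
    rw [Finset.sum_eq_single (Set.range u)]
    · obtain ⟨e, he⟩ := exists_equiv_of_range_eq u (incl (Set.range u)) (range_incl _).symm
      rw [← he, el_trans, he, cf_el_self]
      rfl
    · intro U _ hU
      rw [cf_el_ne _ _ (by rwa [range_incl]), map_zero]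
    · simp
  exact (LinearMap.sum_apply _ _ _).symm.trans (LinearMap.congr_fun this z)

theorem ext_cf {S : FB.{u}} {z z' : (Sym k ⊗ₛ M).obj S}
    (h : ∀ U : Set S, cf (incl U) z = cf (incl U) z') : z = z' := by
  rw [← sum_el_cf z, ← sum_el_cf z']
  simp only [h]

theorem map_el {X S S' : FB.{u}} (g : S ≃ S') (u : X ↪ S) (x : M.obj X) :
    (Sym k ⊗ₛ M).map (⟨g⟩ : S ⟶ S') (el u x) = el (u.trans g.toEmbedding) x := by
  classical
  let e : (S.sub (Set.range u)ᶜ) ⊕ X ≃ S := (Equiv.sumComm _ _).trans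
    (((Equiv.ofInjective u u.injective).sumCongr (Equiv.refl _)).trans (Equiv.Set.sumCompl _))
  have h1 := tmul_eq_el (M := M) (A := S.sub (Set.range u)ᶜ) e u (fun _ => rfl) 1 x
  have h2 := tmul_eq_el (M := M) (A := S.sub (Set.range u)ᶜ) (e.trans g)
    (u.trans g.toEmbedding) (fun _ => rfl) 1 x
  rw [one_smul] at h1 h2
  rw [← h1, ← h2]
  exact tensorObj_map_tmul (M := Sym k) (N := M) e ⟨g⟩ _ _

theorem cf_map {X S S' : FB.{u}} (g : S ≃ S') (u : X ↪ S) (z : (Sym k ⊗ₛ M).obj S) :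
    cf (u.trans g.toEmbedding) ((Sym k ⊗ₛ M).map (⟨g⟩ : S ⟶ S') z) = cf u z := by
  refine LinearMap.congr_fun (f := cf (u.trans g.toEmbedding) ∘ₗ
    ((Sym k ⊗ₛ M).map (⟨g⟩ : S ⟶ S')).hom) (g := cf u) (linear_ext_el fun {Y} v y => ?_) z
  refine (congrArg (cf _) (map_el g v y)).trans ?_
  by_cases h : Set.range v = Set.range u
  · obtain ⟨e, rfl⟩ := exists_equiv_of_range_eq v u h
    rw [el_trans, cf_el_self]
    exact (congrArg (cf _) (el_trans e (u.trans g.toEmbedding) y)).trans (cf_el_self _ _)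
  · rw [cf_el_ne _ _ (Ne.symm h), cf_el_ne]
    intro h'
    apply h
    simp only [Function.Embedding.coe_trans, Set.range_comp, Equiv.coe_toEmbedding] at h'
    exact (g.injective.image_injective h').symm

theorem tensorHom_el (f : M ⟶ N) {X S : FB.{u}} (u : X ↪ S) (x : M.obj X) :
    (whiskerLeft (Sym k) f).app S (el u x) = el u (f.app X x) := by
  classical
  let e : (S.sub (Set.range u)ᶜ) ⊕ X ≃ S := (Equiv.sumComm _ _).trans
    (((Equiv.ofInjective u u.injective).sumCongr (Equiv.refl _)).trans (Equiv.Set.sumCompl _))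
  have h1 := tmul_eq_el (M := M) (A := S.sub (Set.range u)ᶜ) e u (fun _ => rfl) 1 x
  have h2 := tmul_eq_el (M := N) (A := S.sub (Set.range u)ᶜ) e u (fun _ => rfl) 1 (f.app X x)
  rw [one_smul] at h1 h2
  rw [← h1, ← h2]
  exact tensorHom_tmul _ _ _ _ _

theorem cf_tensorHom (f : M ⟶ N) {X S : FB.{u}} (u : X ↪ S) (z : (Sym k ⊗ₛ M).obj S) :
    cf u ((whiskerLeft (Sym k) f).app S z) = f.app X (cf u z) := by
  refine LinearMap.congr_fun (f := cf u ∘ₗ ((whiskerLeft (Sym k) f).app S).hom)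
    (g := (f.app X).hom ∘ₗ cf u) (linear_ext_el fun {Y} v y => ?_) z
  refine (congrArg (cf u) (tensorHom_el f v y)).trans ?_
  rw [LinearMap.comp_apply]
  by_cases h : Set.range v = Set.range u
  · obtain ⟨e, rfl⟩ := exists_equiv_of_range_eq v u h
    rw [el_trans, el_trans, cf_el_self, cf_el_self]
    exact (NatTrans.naturality_apply f _ y).symm
  · rw [cf_el_ne _ _ (Ne.symm h), cf_el_ne _ _ (Ne.symm h)]
    exact (map_zero _).symm

end extension

end Species

namespace Species

variable {k : Type u} [CommRing k] {M N P : Species k}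

/-! ### The associator and the symmetry on pure tensors. -/

section associativity

theorem tmul_tmul_left {A B C D S : FB.{u}} (d : A ⊕ B ≃ D) (e : D ⊕ C ≃ S)
    (x : M.obj A) (y : N.obj B) (z : P.obj C) :
    tmul (M := M ⊗ₛ N) (N := P) e (tmul d x y) z =
      tmulLeft ((d.sumCongr (Equiv.refl C)).trans e) x y z := by
  rw [tmulLeft_apply]
  refine (Eq.trans (tmul_congr (M := M ⊗ₛ N) (N := P) (A := A.sum B) _ e ⟨d⟩ (𝟙 C)
    (by rintro (t | t) <;> rfl) _ _) ?_).symm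
  congr 1
  · congr 1
    exact tensorObj_map_tmul (S := A.sum B) _ ⟨d⟩ x y
  · simp

theorem tmul_tmul_right {A B C D S : FB.{u}} (d : B ⊕ C ≃ D) (e : A ⊕ D ≃ S)
    (x : M.obj A) (y : N.obj B) (z : P.obj C) :
    tmul (M := M) (N := N ⊗ₛ P) e x (tmul d y z) =
      tmulRight (((Equiv.refl A).sumCongr d).trans e) x y z := by
  rw [tmulRight_apply]
  refine (Eq.trans (tmul_congr (M := M) (N := N ⊗ₛ P) (B := B.sum C) _ e (𝟙 A) ⟨d⟩
    (by rintro (t | t) <;> rfl) _ _) ?_).symm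
  congr 1
  · simp
  · exact tensorObj_map_tmul (S := B.sum C) _ ⟨d⟩ y z

theorem assoc_tmul_tmul {A B C D S : FB.{u}} (d : A ⊕ B ≃ D) (e : D ⊕ C ≃ S)
    (x : M.obj A) (y : N.obj B) (z : P.obj C) :
    (assoc M N P).app S (tmul (M := M ⊗ₛ N) (N := P) e (tmul d x y) z) =
      tmulRight ((Equiv.sumAssoc A B C).symm.trans ((d.sumCongr (Equiv.refl C)).trans e)) x y z := by
  rw [tmul_tmul_left, assoc_tmulLeft]

theorem braid_tensorHom_tmul {A B C D S : FB.{u}} (d : A ⊕ B ≃ D) (e : D ⊕ C ≃ S)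
    (x : M.obj A) (y : N.obj B) (z : P.obj C) :
    (tensorHom (braid M N) (𝟙 P)).app S (tmul (M := M ⊗ₛ N) (N := P) e (tmul d x y) z) =
      tmul (M := N ⊗ₛ M) (N := P) e (tmul ((Equiv.sumComm B A).trans d) y x) z := by
  rw [tensorHom_tmul, braid_tmul]
  rfl

theorem assocInv_tmulRight {A B C S : FB.{u}} (e : A ⊕ (B ⊕ C) ≃ S)
    (x : M.obj A) (y : N.obj B) (z : P.obj C) :
    (assocInv M N P).app S (tmulRight e x y z) =
      tmulLeft ((Equiv.sumAssoc A B C).trans e) x y z := by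
  change (tensorHom (braid N M) (𝟙 P)).app S ((braid P (N ⊗ₛ M)).app S ((assoc P N M).app S
    ((tensorHom (braid N P) (𝟙 M)).app S ((braid M (N ⊗ₛ P)).app S (tmulRight e x y z))))) = _
  rw [tmulRight_apply, braid_tmul, braid_tensorHom_tmul, assoc_tmul_tmul, tmulRight_apply,
    braid_tmul, braid_tensorHom_tmul, tmul_tmul_left]
  congr 4
  ext ((t | t) | t) <;> rfl

/-- The bijection exchanging the first two of three summands. -/
def sumSwap (A B C : Type u) : B ⊕ (A ⊕ C) ≃ A ⊕ (B ⊕ C) :=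
  (Equiv.sumAssoc B A C).symm.trans
    (((Equiv.sumComm B A).sumCongr (Equiv.refl C)).trans (Equiv.sumAssoc A B C))

theorem swap_tmulRight {A B C S : FB.{u}} (e : A ⊕ (B ⊕ C) ≃ S)
    (x : M.obj A) (y : N.obj B) (z : P.obj C) :
    (swap M N P).app S (tmulRight e x y z) = tmulRight ((sumSwap A B C).trans e) y x z := by
  change (assoc N M P).app S ((tensorHom (braid M N) (𝟙 P)).app S ((assocInv M N P).app S
    (tmulRight e x y z))) = _
  rw [assocInv_tmulRight, tmulLeft_apply, braid_tensorHom_tmul, assoc_tmul_tmul]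
  rfl

end associativity

/-! ### Exchange, multiplication and comultiplication on elements t^(S \ Y) ⊗ t^(Y \ X) ⊗ x. -/

section nested

theorem tmulRight_eq_el {A B C S : FB.{u}} (e : A ⊕ (B ⊕ C) ≃ S) (z : M.obj C) :
    tmulRight (M := Sym k) (N := Sym k) e (symBasis k A) (symBasis k B) z =
      el (X := B.sum C) (Function.Embedding.inr.trans e.toEmbedding)
        (el (S := B.sum C) Function.Embedding.inr z) := by
  rw [tmulRight_apply]
  have h1 := tmul_eq_el (M := M) (S := B.sum C) (Equiv.refl (B ⊕ C)) Function.Embedding.inr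
    (fun _ => rfl) 1 z
  rw [one_smul] at h1
  refine (congrArg _ h1).trans ?_
  have h2 := tmul_eq_el (M := Sym k ⊗ₛ M) (X := B.sum C) e
    (Function.Embedding.inr.trans e.toEmbedding) (fun _ => rfl) 1
    (el (S := B.sum C) Function.Embedding.inr z)
  rw [one_smul] at h2
  exact h2

/-- For X ↪ Y ↪ S the element is t^(S \ Y) ⊗ t^(Y \ X) ⊗ x. It is determined by the image of Y in S,
the composite X ↪ S, and x. -/
theorem el_el_congr {X Y Y' S : FB.{u}} {u : Y ↪ S} {v : X ↪ Y} {u' : Y' ↪ S} {v' : X ↪ Y'}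
    (hr : Set.range u = Set.range u') (h : v.trans u = v'.trans u') (x : M.obj X) :
    el u (el v x) = el u' (el v' x) := by
  obtain ⟨e, rfl⟩ := exists_equiv_of_range_eq u u' hr
  rw [el_trans]
  refine congrArg (el u') ((map_el e v x).trans ?_)
  congr 2
  ext t
  exact u'.injective (DFunLike.congr_fun h t)

/-- The complement of the image of `u`, together with the source of `u`, makes up the target. -/
def complEquiv {X S : FB.{u}} (u : X ↪ S) : (S.sub (Set.range u)ᶜ) ⊕ X ≃ S :=
  open scoped Classical in
  (Equiv.sumComm _ _).trans
    (((Equiv.ofInjective u u.injective).sumCongr (Equiv.refl _)).trans (Equiv.Set.sumCompl _))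

theorem el_eq_tmul {X S : FB.{u}} (u : X ↪ S) (x : M.obj X) :
    el u x = tmul (M := Sym k) (A := S.sub (Set.range u)ᶜ) (complEquiv u) (symBasis k _) x := by
  have := tmul_eq_el (M := M) (A := S.sub (Set.range u)ᶜ) (complEquiv u) u (fun _ => rfl) 1 x
  rw [one_smul] at this
  exact this.symm

theorem el_el_eq_tmulRight {X Y S : FB.{u}} (u : Y ↪ S) (v : X ↪ Y) (x : M.obj X) :
    el u (el v x) = tmulRight (M := Sym k) (N := Sym k)
      (A := S.sub (Set.range u)ᶜ) (B := Y.sub (Set.range v)ᶜ)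
      (((Equiv.refl _).sumCongr (complEquiv v)).trans (complEquiv u))
      (symBasis k _) (symBasis k _) x := by
  rw [el_eq_tmul u, el_eq_tmul v, tmul_tmul_right]

/-- Exchanging the exponents S \ Y and Y \ X keeps X in place and replaces the middle set Y by the
complement of Y \ X. -/
theorem swap_el_el {X Y Y' S : FB.{u}} (u : Y ↪ S) (v : X ↪ Y) (u' : Y' ↪ S) (v' : X ↪ Y')
    (h : v.trans u = v'.trans u') (hr : Set.range u' = (Set.range u)ᶜ ∪ Set.range (v.trans u))
    (x : M.obj X) :
    (swap (Sym k) (Sym k) M).app S (el u (el v x)) = el u' (el v' x) := by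
  rw [el_el_eq_tmulRight u v, swap_tmulRight, tmulRight_eq_el]
  refine el_el_congr ?_ ?_ x
  · rw [hr]
    ext s
    constructor
    · rintro ⟨t | t, rfl⟩
      · exact .inl t.2
      · exact .inr ⟨t, rfl⟩
    · rintro (hs | ⟨t, rfl⟩)
      · exact ⟨.inl ⟨s, hs⟩, rfl⟩
      · exact ⟨.inr t, rfl⟩
  · rw [← h]
    rfl

/-- Since (S \ Y) ⊔ (Y \ X) = S \ X, multiplication forgets the middle set. -/
theorem symMulLeft_el_el {X Y S : FB.{u}} (u : Y ↪ S) (v : X ↪ Y) (x : M.obj X) :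
    (symMulLeft M).app S (el u (el v x)) = el (v.trans u) x := by
  rw [el_el_eq_tmulRight u v]
  change (tensorHom (symMul k) (𝟙 M)).app S ((assocInv _ _ _).app S _) = _
  rw [assocInv_tmulRight, tmulLeft_apply, tensorHom_tmul]
  have h := tensorDesc_tmul (M := Sym k) (N := Sym k) (P := Sym k) (fun _ => LinearMap.mul k k)
    (fun _ _ _ _ _ _ _ _ => rfl) (A := S.sub (Set.range u)ᶜ) (B := Y.sub (Set.range v)ᶜ)
    (S := (S.sub (Set.range u)ᶜ).sum (Y.sub (Set.range v)ᶜ)) (Equiv.refl _)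
    (symBasis k _) (symBasis k _)
  have h1 : (symMul k).app _ (tmul (M := Sym k) (N := Sym k) (A := S.sub (Set.range u)ᶜ)
    (B := Y.sub (Set.range v)ᶜ) (S := (S.sub (Set.range u)ᶜ).sum (Y.sub (Set.range v)ᶜ))
    (Equiv.refl _) (symBasis k _) (symBasis k _)) = (1 : k) := h.trans (one_mul (1 : k))
  rw [h1]
  refine (tmul_eq_el (M := M) (A := (S.sub (Set.range u)ᶜ).sum (Y.sub (Set.range v)ᶜ))
    _ (v.trans u) (fun _ => rfl) 1 _).trans ?_
  rw [one_smul]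
  rfl

theorem cf_el_equiv {X Y S : FB.{u}} {u : X ↪ S} {v : Y ↪ S} (e : Y ≃ X)
    (h : e.toEmbedding.trans u = v) (y : M.obj Y) : cf u (el v y) = M.map (⟨e⟩ : Y ⟶ X) y := by
  rw [← h, el_trans, cf_el_self]

theorem range_equiv_trans {X Y S : Type*} (e : X ≃ Y) (u : Y ↪ S) :
    Set.range (e.toEmbedding.trans u) = Set.range u := by
  ext s
  simp only [Set.mem_range, Function.Embedding.trans_apply, Equiv.coe_toEmbedding]
  exact e.exists_congr_left.trans (by simp)

theorem range_trans {X Y S : Type*} (v : X ↪ Y) (u : Y ↪ S) :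
    Set.range (v.trans u) = u '' Set.range v := Set.range_comp u v

theorem cf_el_cancel {X Y Z S : FB.{u}} (u : Z ↪ S) (v : X ↪ Z) (t : Y ↪ Z) (y : M.obj Y) :
    cf (v.trans u) (el (t.trans u) y) = cf v (el t y) := by
  by_cases h : Set.range t = Set.range v
  · obtain ⟨e, rfl⟩ := exists_equiv_of_range_eq t v h
    rw [cf_el_equiv e rfl]
    exact cf_el_equiv e rfl y
  · rw [cf_el_ne _ _ (Ne.symm h), cf_el_ne]
    rw [range_trans, range_trans]
    exact fun h' => h (u.injective.image_injective h').symm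

theorem cf_cf_el_el {X X' Y Y' S : FB.{u}} (u : Y ↪ S) (v : X ↪ Y) (s : Y' ↪ S) (t : X' ↪ Y')
    (h : Set.range s = Set.range u) (x : M.obj X') :
    cf v (cf u (el s (el t x))) = cf (v.trans u) (el (t.trans s) x) := by
  obtain ⟨e, rfl⟩ := exists_equiv_of_range_eq s u h
  rw [el_trans, cf_el_self]
  exact (congrArg (cf v) (map_el e t x)).trans (cf_el_cancel u v (t.trans e.toEmbedding) x).symm

/-- The transpose of `swap_el_el`. For a fixed image of X, the middle sets Y and (S \ Y) ∪ X
determine each other, so a coefficient after the exchange is a single coefficient before it. -/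
theorem cf_cf_swap {X Y Y' S : FB.{u}} (u : Y ↪ S) (v : X ↪ Y) (u' : Y' ↪ S) (v' : X ↪ Y')
    (h : v.trans u = v'.trans u') (hr : Set.range u' = (Set.range u)ᶜ ∪ Set.range (v.trans u))
    (z : (Sym k ⊗ₛ (Sym k ⊗ₛ M)).obj S) :
    cf v' (cf u' ((swap (Sym k) (Sym k) M).app S z)) = cf v (cf u z) := by
  refine LinearMap.congr_fun (f := cf v' ∘ₗ cf u' ∘ₗ ((swap (Sym k) (Sym k) M).app S).hom)
    (g := cf v ∘ₗ cf u) (linear_ext_el fun {Y1} s y => ?_) z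
  refine LinearMap.congr_fun (f := cf v' ∘ₗ cf u' ∘ₗ ((swap (Sym k) (Sym k) M).app S).hom ∘ₗ el s)
    (g := cf v ∘ₗ cf u ∘ₗ el s) (linear_ext_el fun {X1} t x => ?_) y
  let s' := incl ((Set.range s)ᶜ ∪ Set.range (t.trans s))
  let t' : X1 ↪ S.sub ((Set.range s)ᶜ ∪ Set.range (t.trans s)) :=
    (t.trans s).codRestrict _ fun a => .inr ⟨a, rfl⟩
  change cf v' (cf u' ((swap (Sym k) (Sym k) M).app S (el s (el t x)))) = cf v (cf u (el s (el t x)))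
  have hs' : Set.range s' = _ := range_incl _
  rw [swap_el_el s t s' t' rfl hs']
  have hts : t'.trans s' = t.trans s := rfl
  by_cases hw : Set.range (v.trans u) = Set.range (t.trans s)
  · have hwu : Set.range (v.trans u) ⊆ Set.range u := by
      rw [range_trans]; exact Set.image_subset_range _ _
    have hws : Set.range (t.trans s) ⊆ Set.range s := by
      rw [range_trans]; exact Set.image_subset_range _ _
    by_cases hs : Set.range s = Set.range u
    · rw [cf_cf_el_el _ _ _ _ hs, cf_cf_el_el, hts, h]
      rw [hs', hr, hs, hw]
    · rw [cf_el_ne u s (Ne.symm hs), cf_el_ne u' s', map_zero, map_zero]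
      rw [hs', hr, ← hw]
      intro h'
      apply hs
      ext x
      have h1 := Set.ext_iff.1 h' x
      have h2 := @hwu x
      have h3 := @hws x
      rw [← hw] at h3
      simp only [Set.mem_union, Set.mem_compl_iff] at h1
      tauto
  · have key : ∀ {Y2 Y3 : FB.{u}} (u2 : Y2 ↪ S) (v2 : X ↪ Y2) (s2 : Y3 ↪ S) (t2 : X1 ↪ Y3),
        v2.trans u2 = v.trans u → t2.trans s2 = t.trans s → cf v2 (cf u2 (el s2 (el t2 x))) = 0 := by
      intro Y2 Y3 u2 v2 s2 t2 h1 h2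
      by_cases hs : Set.range s2 = Set.range u2
      · rw [cf_cf_el_el _ _ _ _ hs, cf_el_ne]
        rwa [h1, h2]
      · rw [cf_el_ne u2 s2 (Ne.symm hs), map_zero]
    rw [key u v s t rfl rfl, key u' v' s' t' h.symm hts]

/-- The exponent S \ Y' that is moved to the front comes from y and so lies in Y; it equals Y \ W
for W = Y ∩ Y'. The exponent left behind is S \ Y = Y' \ W. -/
theorem cf_swap_el {Y Y' W S : FB.{u}} (u : Y ↪ S) (u' : Y' ↪ S) (w' : W ↪ Y) (w : W ↪ Y')
    (h : w'.trans u = w.trans u') (hr : Set.range (w'.trans u) = Set.range u ∩ Set.range u')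
    (hu : Set.range u ∪ Set.range u' = Set.univ) (y : (Sym k ⊗ₛ M).obj Y) :
    cf u' ((swap (Sym k) (Sym k) M).app S (el u y)) = el w (cf w' y) := by
  have hr' : Set.range u' = (Set.range u)ᶜ ∪ Set.range (w'.trans u) := by
    rw [hr]
    ext s
    have := Set.ext_iff.1 hu s
    simp only [Set.mem_union, Set.mem_univ, iff_true] at this
    simp only [Set.mem_union, Set.mem_compl_iff, Set.mem_inter_iff]
    tauto
  refine LinearMap.congr_fun (f := cf u' ∘ₗ ((swap (Sym k) (Sym k) M).app S).hom ∘ₗ el u)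
    (g := el w ∘ₗ cf w') (linear_ext_el fun {X1} t x => ?_) y
  change cf u' ((swap (Sym k) (Sym k) M).app S (el u (el t x))) = el w (cf w' (el t x))
  by_cases ht : Set.range t = Set.range w'
  · obtain ⟨e, rfl⟩ := exists_equiv_of_range_eq t w' ht
    rw [el_trans, swap_el_el u w' u' w h hr', cf_el_self, cf_el_self]
  · rw [cf_el_ne w' t (Ne.symm ht), map_zero, swap_el_el u t
      (incl ((Set.range u)ᶜ ∪ Set.range (t.trans u)))
      ((t.trans u).codRestrict _ fun a => .inr ⟨a, rfl⟩) rfl (range_incl _), cf_el_ne]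
    rw [range_incl, hr']
    intro h'
    apply ht
    rw [range_trans, range_trans] at h'
    apply u.injective.image_injective
    ext s
    have h1 := Set.ext_iff.1 h' s
    have h2 : s ∈ u '' Set.range t → s ∈ Set.range u := fun h => Set.image_subset_range _ _ h
    have h3 : s ∈ u '' Set.range w' → s ∈ Set.range u := fun h => Set.image_subset_range _ _ h
    simp only [Set.mem_union, Set.mem_compl_iff] at h1
    tauto

/-- The exponent S \ Y' moved to the front comes from y and lies in Y, which forces Y ∪ Y' = S. -/
theorem cf_swap_el_zero {Y Y' S : FB.{u}} (u : Y ↪ S) (u' : Y' ↪ S)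
    (hu : Set.range u ∪ Set.range u' ≠ Set.univ) (y : (Sym k ⊗ₛ M).obj Y) :
    cf u' ((swap (Sym k) (Sym k) M).app S (el u y)) = 0 := by
  refine LinearMap.congr_fun (f := cf u' ∘ₗ ((swap (Sym k) (Sym k) M).app S).hom ∘ₗ el u)
    (g := 0) (linear_ext_el fun {X1} t x => ?_) y
  change cf u' ((swap (Sym k) (Sym k) M).app S (el u (el t x))) = 0
  rw [swap_el_el u t
      (incl ((Set.range u)ᶜ ∪ Set.range (t.trans u)))
      ((t.trans u).codRestrict _ fun a => .inr ⟨a, rfl⟩) rfl (range_incl _), cf_el_ne]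
  rw [range_incl]
  intro h'
  apply hu
  rw [h', ← Set.union_assoc, Set.union_compl_self, Set.univ_union]

theorem cf_symMulLeft_el {Y Y' S : FB.{u}} (i : Y ↪ S) (u : Y' ↪ Y) (q : (Sym k ⊗ₛ M).obj Y) :
    cf (u.trans i) ((symMulLeft M).app S (el i q)) = cf u q := by
  refine LinearMap.congr_fun (f := cf (u.trans i) ∘ₗ ((symMulLeft M).app S).hom ∘ₗ el i)
    (g := cf u) (linear_ext_el fun {X1} t x => ?_) q
  refine (congrArg (cf (u.trans i)) (symMulLeft_el_el i t x)).trans ?_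
  rw [cf_el_cancel]

theorem cf_symMulLeft_el_zero {Y Y' S : FB.{u}} (i : Y ↪ S) (u : Y' ↪ S)
    (h : ¬ Set.range u ⊆ Set.range i) (q : (Sym k ⊗ₛ M).obj Y) :
    cf u ((symMulLeft M).app S (el i q)) = 0 := by
  refine LinearMap.congr_fun (f := cf u ∘ₗ ((symMulLeft M).app S).hom ∘ₗ el i)
    (g := 0) (linear_ext_el fun {X1} t x => ?_) q
  refine (congrArg (cf u) (symMulLeft_el_el i t x)).trans ?_
  rw [cf_el_ne]
  · rfl
  · intro h'
    apply h
    rw [h', range_trans]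
    exact Set.image_subset_range _ _

open scoped Classical in
-- A splitting with first part E has Eᶜ as its middle set. Summing over all E ⊆ S, with zero for
-- those meeting the image of `u`, avoids subsets of a complement.
theorem symComulLeft_el {X S : FB.{u}} (u : X ↪ S) (x : M.obj X) :
    (symComulLeft M).app S (el u x) = ∑ E : Set S,
      if h : ∀ a, u a ∈ Eᶜ then el (incl Eᶜ) (el (u.codRestrict Eᶜ h : X ↪ S.sub Eᶜ) x) else 0 := by
  rw [el_eq_tmul]
  change (assoc _ _ _).app S ((tensorHom (symComul k) (𝟙 M)).app S _) = _
  rw [tensorHom_tmul]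
  have h1 : (symComul k).app (S.sub (Set.range u)ᶜ) (symBasis k _) =
      comulElt k (S.sub (Set.range u)ᶜ) := one_smul k _
  rw [h1, comulElt, map_sum, LinearMap.sum_apply, map_sum]
  refine Finset.sum_of_injOn (fun T : Set (S.sub (Set.range u)ᶜ) => (Subtype.val '' T : Set S))
    (fun T _ T' _ h => Subtype.val_injective.image_injective h) (fun _ _ => Finset.mem_univ _)
    ?_ ?_
  · intro E _ hE
    rw [dif_neg]
    intro h
    refine hE ⟨Subtype.val ⁻¹' E, by simp, ?_⟩
    beta_reduce
    rw [Subtype.image_preimage_val, Set.inter_eq_right]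
    rintro s hs ⟨a, rfl⟩
    exact h a hs
  · intro T _
    have h : ∀ a, u a ∈ (Subtype.val '' T : Set S)ᶜ := by
      rintro a ⟨s, -, hs⟩
      exact s.2 ⟨a, hs.symm⟩
    rw [dif_pos h, summand_eq_tmul]
    refine (assoc_tmul_tmul (M := Sym k) (N := Sym k) (A := (S.sub (Set.range u)ᶜ).sub T)
      (B := (S.sub (Set.range u)ᶜ).sub Tᶜ) _ _ _ _ _).trans ?_
    rw [tmulRight_eq_el]
    change el _ (el _ x) = _
    refine el_el_congr ?_ ?_ x
    swap
    · rfl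
    rw [range_incl]
    ext s
    constructor
    · rintro ⟨t | t, rfl⟩
      · rintro ⟨s, hs, h⟩
        have : s = t.1 := Subtype.ext h
        exact t.2 (this ▸ hs)
      · exact h t
    · intro hs
      by_cases hsu : s ∈ Set.range u
      · obtain ⟨t, rfl⟩ := hsu
        exact ⟨.inr t, rfl⟩
      · exact ⟨.inl ⟨⟨s, hsu⟩, fun h => hs ⟨_, h, rfl⟩⟩, rfl⟩

/-- Comultiplication is transpose to multiplication: exactly one splitting contributes to a given
pair of exponents. -/
theorem cf_cf_symComulLeft {X Y S : FB.{u}} (u : Y ↪ S) (v : X ↪ Y) (z : (Sym k ⊗ₛ M).obj S) :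
    cf v (cf u ((symComulLeft M).app S z)) = cf (v.trans u) z := by
  classical
  refine LinearMap.congr_fun (f := cf v ∘ₗ cf u ∘ₗ ((symComulLeft M).app S).hom)
    (g := cf (v.trans u)) (linear_ext_el fun {X1} t x => ?_) z
  refine (congrArg (fun z => cf v (cf u z)) (symComulLeft_el t x)).trans ?_
  rw [map_sum, map_sum, Finset.sum_eq_single (Set.range u)ᶜ]
  · split_ifs with h
    · rw [cf_cf_el_el _ _ _ _ (by rw [range_incl, compl_compl])]
      rfl
    · rw [map_zero, map_zero, cf_el_ne]
      intro h'
      apply h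
      intro a
      rw [compl_compl]
      have : t a ∈ Set.range (v.trans u) := h' ▸ ⟨a, rfl⟩
      rw [range_trans] at this
      exact Set.image_subset_range _ _ this
  · intro E _ hE
    split_ifs with h
    · rw [cf_el_ne, map_zero]
      rw [range_incl]
      exact fun h' => hE (by rw [h', compl_compl])
    · rw [map_zero, map_zero]
  · simp

end nested

end Species

namespace Species

variable {k : Type u} [CommRing k] {M : Species k}

/-! ### The Weyl relation in terms of matrix coefficients. -/

section weylCoefficients

variable (a : Sym k ⊗ₛ M ⟶ Div k ⊗ₛ M)

/-- The operation `φ^S_{S \ v(Y), S \ u(X)} : M(X) → M(Y)` for injections `u : X ↪ S` and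
`v : Y ↪ S`. -/
def op {X Y S : FB.{u}} (u : X ↪ S) (v : Y ↪ S) : M.obj X →ₗ[k] M.obj Y :=
  cf v ∘ₗ (a.app S).hom ∘ₗ el u

theorem op_apply {X Y S : FB.{u}} (u : X ↪ S) (v : Y ↪ S) (x : M.obj X) :
    op a u v x = cf v (a.app S (el u x)) := rfl

open scoped Classical in
/-- The operation `op` with ambient set `T ⊆ S`; it is zero unless `T` contains the images of `u`
and `v`. -/
def opn {X Y S : FB.{u}} (T : Set S) (u : X ↪ S) (v : Y ↪ S) : M.obj X →ₗ[k] M.obj Y :=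
  if h : (∀ x, u x ∈ T) ∧ ∀ y, v y ∈ T then
    op a (S := S.sub T) (u.codRestrict T h.1) (v.codRestrict T h.2) else 0

theorem op_map {X Y S S' : FB.{u}} (g : S ≃ S') (u : X ↪ S) (v : Y ↪ S) :
    op a (u.trans g.toEmbedding) (v.trans g.toEmbedding) = op a u v := by
  ext x
  rw [op_apply, op_apply, ← map_el, ← cf_map g v]
  congr 1
  exact NatTrans.naturality_apply a _ _

theorem op_equiv_left {X X' Y S : FB.{u}} (e : X' ≃ X) (u : X ↪ S) (v : Y ↪ S) (x : M.obj X') :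
    op a (e.toEmbedding.trans u) v x = op a u v (M.map (⟨e⟩ : X' ⟶ X) x) := by
  rw [op_apply, op_apply, el_trans]

theorem op_equiv_right {X Y Y' S : FB.{u}} (e : Y' ≃ Y) (u : X ↪ S) (v : Y ↪ S) (x : M.obj X) :
    M.map (⟨e⟩ : Y' ⟶ Y) (op a u (e.toEmbedding.trans v) x) = op a u v x := by
  rw [op_apply, op_apply, cf_trans]

/-- This turns a coefficient whose ambient set is the source of an injection into one whose ambient
set is a subset of S, so that all coefficients in the relation can be compared inside a single S. -/
theorem opn_eq_op {X Y S S' : FB.{u}} {T : Set S} (j : S' ↪ S) (hj : Set.range j = T)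
    (u : X ↪ S') (v : Y ↪ S') : opn a T (u.trans j) (v.trans j) = op a u v := by
  subst hj
  rw [opn, dif_pos ⟨fun x => ⟨u x, rfl⟩, fun y => ⟨v y, rfl⟩⟩]
  exact op_map a (S' := S.sub (Set.range j)) (Equiv.ofInjective j j.injective) u v

theorem opn_eq_zero {X Y S : FB.{u}} {T : Set S} {u : X ↪ S} {v : Y ↪ S}
    (h : ¬ Set.range u ∪ Set.range v ⊆ T) : opn a T u v = 0 := by
  rw [opn, dif_neg]
  rintro ⟨h1, h2⟩
  rw [Set.union_subset_iff, Set.range_subset_iff, Set.range_subset_iff] at h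
  exact h ⟨h1, h2⟩

variable {X Y X' Y' S : FB.{u}}

/-- The first application of `a` works over Y and creates the output exponent Y' \ X'. The second
works over what is left, T = X' ∪ Y'ᶜ. The intermediate summand is therefore M(K) for the single set
K = Y ∩ T. -/
theorem cf_act₁₂ (u : Y ↪ S) (v : X ↪ Y) (u' : Y' ↪ S) (v' : X' ↪ Y') (x : M.obj X)
    (h : Set.range u' ⊆ Set.range u ∪ Set.range (v'.trans u')) :
    cf v' (cf u' ((act₁₂ a).app S (el u (el v x)))) =
      opn a (Set.range (v'.trans u') ∪ (Set.range u')ᶜ)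
        (incl (Set.range u ∩ (Set.range (v'.trans u') ∪ (Set.range u')ᶜ))) (v'.trans u')
        (opn a (Set.range u) (v.trans u)
          (incl (Set.range u ∩ (Set.range (v'.trans u') ∪ (Set.range u')ᶜ))) x) := by
  set T := Set.range (v'.trans u') ∪ (Set.range u')ᶜ with hT
  set K := Set.range u ∩ T with hK
  let q : S.sub K ↪ S.sub T := Set.embeddingOfSubset K T Set.inter_subset_right
  let q' : S.sub K ↪ Y := (Set.embeddingOfSubset K _ Set.inter_subset_left).trans
    (Equiv.ofInjective u u.injective).symm.toEmbedding
  have hq' : q'.trans u = incl K := by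
    ext s
    exact Equiv.apply_ofInjective_symm u.injective _
  have hv' : Set.range (v'.trans u') ⊆ Set.range u' := by
    rw [range_trans]; exact Set.image_subset_range _ _
  change cf v' (cf u' ((swap (Sym k) (Sym k) M).app S ((whiskerLeft (Sym k) a).app S
    ((swap (Sym k) (Sym k) M).app S ((whiskerLeft (Sym k) a).app S (el u (el v x))))))) = _
  rw [tensorHom_el, cf_cf_swap (S := S) (incl T)
    ((v'.trans u').codRestrict T fun s => .inl ⟨s, rfl⟩ : X' ↪ S.sub T) u' v' rfl,
    cf_tensorHom, cf_swap_el u (incl T) q' q hq']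
  · have h1 := opn_eq_op a (T := T) (incl T) (range_incl T) q
      ((v'.trans u').codRestrict T fun s => .inl ⟨s, rfl⟩ : X' ↪ S.sub T)
    have h2 := opn_eq_op a u rfl v q'
    rw [hq'] at h2
    change opn a T (incl K) (v'.trans u') = _ at h1
    rw [h1, h2]
    rfl
  · rw [hq', range_incl, range_incl]
  · rw [range_incl, hT]
    ext s
    have := @h s
    simp only [Set.mem_union, Set.mem_compl_iff, Set.mem_univ, iff_true] at this ⊢
    tauto
  · change _ = _ ∪ Set.range (v'.trans u')
    rw [range_incl, hT]
    ext s
    have := @hv' s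
    simp only [Set.mem_union, Set.mem_compl_iff] at this ⊢
    tauto

/-- The exponent Y' \ X' is created by an application of `a` over Y, so it has to lie in Y. -/
theorem cf_act₁₂_zero (u : Y ↪ S) (v : X ↪ Y) (u' : Y' ↪ S) (v' : X' ↪ Y') (x : M.obj X)
    (h : ¬ Set.range u' ⊆ Set.range u ∪ Set.range (v'.trans u')) :
    cf v' (cf u' ((act₁₂ a).app S (el u (el v x)))) = 0 := by
  set T := Set.range (v'.trans u') ∪ (Set.range u')ᶜ with hT
  have hv' : Set.range (v'.trans u') ⊆ Set.range u' := by
    rw [range_trans]; exact Set.image_subset_range _ _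
  change cf v' (cf u' ((swap (Sym k) (Sym k) M).app S ((whiskerLeft (Sym k) a).app S
    ((swap (Sym k) (Sym k) M).app S ((whiskerLeft (Sym k) a).app S (el u (el v x))))))) = _
  rw [tensorHom_el, cf_cf_swap (S := S) (incl T)
    ((v'.trans u').codRestrict T fun s => .inl ⟨s, rfl⟩ : X' ↪ S.sub T) u' v' rfl,
    cf_tensorHom, cf_swap_el_zero u (incl T), map_zero, map_zero]
  · rw [range_incl, hT]
    intro h'
    apply h
    intro s hs
    have := Set.ext_iff.1 h' s
    simp only [Set.mem_union, Set.mem_compl_iff, Set.mem_univ, iff_true] at this ⊢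
    tauto
  · change _ = _ ∪ Set.range (v'.trans u')
    rw [range_incl, hT]
    ext s
    have := @hv' s
    simp only [Set.mem_union, Set.mem_compl_iff] at this ⊢
    tauto

/-- Here the input exponent Y \ X waits while `a` is applied over T = X ∪ Yᶜ. The first output
exponent S \ Y' is created in that step, and the second application works over Y'. The intermediate
set is again forced, K = Y' ∩ T. -/
theorem cf_act₂₁ (u : Y ↪ S) (v : X ↪ Y) (u' : Y' ↪ S) (v' : X' ↪ Y') (x : M.obj X)
    (h : Set.range u ⊆ Set.range u' ∪ Set.range (v.trans u)) :
    cf v' (cf u' ((act₂₁ a).app S (el u (el v x)))) =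
      opn a (Set.range u')
        (incl (Set.range u' ∩ (Set.range (v.trans u) ∪ (Set.range u)ᶜ))) (v'.trans u')
        (opn a (Set.range (v.trans u) ∪ (Set.range u)ᶜ) (v.trans u)
          (incl (Set.range u' ∩ (Set.range (v.trans u) ∪ (Set.range u)ᶜ))) x) := by
  set T := Set.range (v.trans u) ∪ (Set.range u)ᶜ with hT
  set K := Set.range u' ∩ T with hK
  let q : S.sub K ↪ S.sub T := Set.embeddingOfSubset K T Set.inter_subset_right
  let q' : S.sub K ↪ Y' := (Set.embeddingOfSubset K _ Set.inter_subset_left).trans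
    (Equiv.ofInjective u' u'.injective).symm.toEmbedding
  have hq' : q'.trans u' = incl K := by
    ext s
    exact Equiv.apply_ofInjective_symm u'.injective _
  have hT' : T = (Set.range u)ᶜ ∪ Set.range (v.trans u) := Set.union_comm _ _
  change cf v' (cf u' ((whiskerLeft (Sym k) a).app S
    ((swap (Sym k) (Sym k) M).app S ((whiskerLeft (Sym k) a).app S
      ((swap (Sym k) (Sym k) M).app S (el u (el v x))))))) = _
  rw [swap_el_el u v (incl T)
    ((v.trans u).codRestrict T fun s => .inl ⟨s, rfl⟩ : X ↪ S.sub T) rfl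
    ((range_incl T).trans hT'), tensorHom_el, cf_tensorHom, cf_swap_el (incl T) u' q q' hq'.symm]
  · have h1 := opn_eq_op a (T := T) (incl T) (range_incl T)
      ((v.trans u).codRestrict T fun s => .inl ⟨s, rfl⟩ : X ↪ S.sub T) q
    have h2 := opn_eq_op a u' rfl q' v'
    rw [hq'] at h2
    change opn a T (v.trans u) (incl K) = _ at h1
    rw [h1, h2]
    rfl
  · change Set.range (incl K) = _
    rw [range_incl, range_incl, hK, Set.inter_comm]
  · rw [range_incl, hT]
    ext s
    have := @h s
    simp only [Set.mem_union, Set.mem_compl_iff, Set.mem_univ, iff_true] at this ⊢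
    tauto

/-- The waiting exponent Y \ X is consumed by the application of `a` over Y', so it has to lie in
Y'. -/
theorem cf_act₂₁_zero (u : Y ↪ S) (v : X ↪ Y) (u' : Y' ↪ S) (v' : X' ↪ Y') (x : M.obj X)
    (h : ¬ Set.range u ⊆ Set.range u' ∪ Set.range (v.trans u)) :
    cf v' (cf u' ((act₂₁ a).app S (el u (el v x)))) = 0 := by
  set T := Set.range (v.trans u) ∪ (Set.range u)ᶜ with hT
  have hT' : T = (Set.range u)ᶜ ∪ Set.range (v.trans u) := Set.union_comm _ _
  change cf v' (cf u' ((whiskerLeft (Sym k) a).app S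
    ((swap (Sym k) (Sym k) M).app S ((whiskerLeft (Sym k) a).app S
      ((swap (Sym k) (Sym k) M).app S (el u (el v x))))))) = _
  rw [swap_el_el u v (incl T)
    ((v.trans u).codRestrict T fun s => .inl ⟨s, rfl⟩ : X ↪ S.sub T) rfl
    ((range_incl T).trans hT'), tensorHom_el, cf_tensorHom, cf_swap_el_zero (incl T) u',
    map_zero, map_zero]
  rw [range_incl, hT]
  intro h'
  apply h
  intro s hs
  have := Set.ext_iff.1 h' s
  simp only [Set.mem_union, Set.mem_compl_iff, Set.mem_univ, iff_true] at this ⊢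
  tauto

theorem avg_tensorHom_apply (P : Species k) (z : (Sym k ⊗ₛ P).obj S) :
    (tensorHom (avg k) (𝟙 P)).app S z = z := by
  have h : tensorHom (avg k) (𝟙 P) = 𝟙 _ := tensorHom_id _ _
  rw [h]
  rfl

/-- The part of `act'` after the initial comultiplication. -/
def actTail : Sym k ⊗ₛ (Sym k ⊗ₛ (Sym k ⊗ₛ M)) ⟶ Div k ⊗ₛ (Div k ⊗ₛ M) :=
  swap (Sym k) (Sym k) (Sym k ⊗ₛ M) ≫
  whiskerLeft (Sym k) (symMulLeft M) ≫
  whiskerLeft (Sym k) a ≫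
  whiskerLeft (Sym k) (divComulLeft M) ≫
  tensorHom (avg k) (𝟙 (Div k ⊗ₛ (Div k ⊗ₛ M))) ≫
  divMulLeft (Div k ⊗ₛ M)

theorem actTail_el {Z Z' : FB.{u}} (u : Y ↪ S) (i : Z ↪ Y) (j : X ↪ Z) (u₁ : Z' ↪ S)
    (i' : Z ↪ Z') (h : i.trans u = i'.trans u₁)
    (hr : Set.range u₁ = (Set.range u)ᶜ ∪ Set.range (i.trans u)) (x : M.obj X) :
    (actTail a).app S (el u (el i (el j x))) =
      (symMulLeft (Sym k ⊗ₛ M)).app S (el u₁ ((symComulLeft M).app Z'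
        (a.app Z' (el (j.trans i') x)))) := by
  have h1 : (swap (Sym k) (Sym k) (Sym k ⊗ₛ M) ≫ whiskerLeft (Sym k) (symMulLeft M)).app S
      (el u (el i (el j x))) = el u₁ (el (j.trans i') x) := by
    change (whiskerLeft (Sym k) (symMulLeft M)).app S
      ((swap (Sym k) (Sym k) (Sym k ⊗ₛ M)).app S (el u (el i (el j x)))) = _
    rw [swap_el_el u i u₁ i' h hr, tensorHom_el, symMulLeft_el_el]
  have h2 : ∀ z : (Sym k ⊗ₛ M).obj Z',
      (whiskerLeft (Sym k) (divComulLeft M)).app S ((whiskerLeft (Sym k) a).app S (el u₁ z)) =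
        el u₁ ((symComulLeft M).app Z' (a.app Z' z)) := by
    intro z
    rw [tensorHom_el]
    exact tensorHom_el (symComulLeft M) u₁ (a.app Z' z)
  have h3 : (actTail a).app S (el u (el i (el j x))) = (divMulLeft (Div k ⊗ₛ M)).app S
      ((tensorHom (avg k) (𝟙 (Div k ⊗ₛ (Div k ⊗ₛ M)))).app S
        ((whiskerLeft (Sym k) (divComulLeft M)).app S ((whiskerLeft (Sym k) a).app S
          ((swap (Sym k) (Sym k) (Sym k ⊗ₛ M) ≫ whiskerLeft (Sym k) (symMulLeft M)).app S
            (el u (el i (el j x))))))) := rfl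
  rw [h3, h1, h2]
  exact congrArg ((symMulLeft (Sym k ⊗ₛ M)).app S) (avg_tensorHom_apply _ _)

theorem cf_actTail {Z : FB.{u}} (u : Y ↪ S) (i : Z ↪ Y) (j : X ↪ Z) (E : Set S)
    (hE : Eᶜ = (Set.range u)ᶜ ∪ Set.range (i.trans u))
    (u' : Y' ↪ S) (v' : X' ↪ Y') (x : M.obj X) (h : Disjoint E (Set.range u')) :
    cf v' (cf u' ((actTail a).app S (el u (el i (el j x))))) =
      opn a Eᶜ ((j.trans i).trans u) (v'.trans u') x := by
  have hu' : ∀ y, u' y ∈ Eᶜ := fun y hy => Set.disjoint_left.1 h hy ⟨y, rfl⟩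
  have hi : ∀ z, (i.trans u) z ∈ Eᶜ := fun z => hE ▸ .inr ⟨z, rfl⟩
  let i' : Z ↪ S.sub Eᶜ := (i.trans u).codRestrict Eᶜ hi
  let u₂ : Y' ↪ S.sub Eᶜ := u'.codRestrict Eᶜ hu'
  rw [actTail_el a u i j (incl Eᶜ) i' rfl ((range_incl _).trans hE)]
  refine (congrArg (cf v') (cf_symMulLeft_el (incl Eᶜ) u₂ _)).trans ?_
  rw [cf_cf_symComulLeft]
  exact (LinearMap.congr_fun (opn_eq_op a (incl Eᶜ) (range_incl Eᶜ) (j.trans i')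
    (v'.trans u₂)) x).symm

theorem cf_actTail_zero {Z : FB.{u}} (u : Y ↪ S) (i : Z ↪ Y) (j : X ↪ Z) (E : Set S)
    (hE : Eᶜ = (Set.range u)ᶜ ∪ Set.range (i.trans u))
    (u' : Y' ↪ S) (v' : X' ↪ Y') (x : M.obj X) (h : ¬ Disjoint E (Set.range u')) :
    cf v' (cf u' ((actTail a).app S (el u (el i (el j x))))) = 0 := by
  have hi : ∀ z, (i.trans u) z ∈ Eᶜ := fun z => hE ▸ .inr ⟨z, rfl⟩
  let i' : Z ↪ S.sub Eᶜ := (i.trans u).codRestrict Eᶜ hi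
  rw [actTail_el a u i j (incl Eᶜ) i' rfl ((range_incl _).trans hE), cf_symMulLeft_el_zero,
    map_zero]
  rw [range_incl]
  intro h'
  exact h (Set.disjoint_left.2 fun s hs hs' => h' hs' hs)

open scoped Classical in
-- E is the part of the second exponent that bypasses `a`: it lies in Y, the map `a` works over Eᶜ,
-- and E rejoins the first output exponent S \ Y', hence avoids Y'. A set E meeting the image of X
-- or X' may be left in the sum, because `opn` is zero there.
theorem cf_act' (u : Y ↪ S) (v : X ↪ Y) (u' : Y' ↪ S) (v' : X' ↪ Y') (x : M.obj X) :
    cf v' (cf u' ((act' a).app S (el u (el v x)))) =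
      ∑ E : Set S with E ⊆ Set.range u ∧ Disjoint E (Set.range u'),
        opn a Eᶜ (v.trans u) (v'.trans u') x := by
  change cf v' (cf u' ((actTail a).app S ((whiskerLeft (Sym k) (symComulLeft M)).app S
    (el u (el v x))))) = _
  rw [tensorHom_el, symComulLeft_el]
  simp only [map_sum]
  rw [Finset.sum_filter]
  refine Finset.sum_of_injOn (fun T : Set Y => u '' T)
    (fun T _ T' _ h => u.injective.image_injective h) (fun _ _ => Finset.mem_univ _) ?_ ?_
  · intro E _ hE
    rw [if_neg]
    rintro ⟨h, -⟩
    refine hE ⟨u ⁻¹' E, by simp, ?_⟩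
    beta_reduce
    rwa [Set.image_preimage_eq_inter_range, Set.inter_eq_left]
  · intro T _
    have hc : (u '' T)ᶜ = (Set.range u)ᶜ ∪ Set.range ((incl Tᶜ).trans u) := by
      rw [range_trans, range_incl]
      ext s
      by_cases hs : s ∈ Set.range u
      · obtain ⟨y, rfl⟩ := hs
        simp
      · have : s ∉ u '' T := fun h => hs (Set.image_subset_range _ _ h)
        simp only [Set.mem_compl_iff, this, not_false_eq_true, Set.mem_union, hs, true_or]
    have hsub : u '' T ⊆ Set.range u := Set.image_subset_range _ _
    by_cases h : ∀ a, v a ∈ Tᶜ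
    · rw [dif_pos h]
      by_cases h' : Disjoint (u '' T) (Set.range u')
      · rw [if_pos ⟨hsub, h'⟩, cf_actTail a u (incl Tᶜ)
          (v.codRestrict Tᶜ h : X ↪ Y.sub Tᶜ) (u '' T) hc u' v' x h']
        congr 1
      · rw [if_neg (fun h2 => h' h2.2), cf_actTail_zero a u (incl Tᶜ)
          (v.codRestrict Tᶜ h : X ↪ Y.sub Tᶜ) (u '' T) hc u' v' x h']
    · rw [dif_neg h, map_zero, map_zero, map_zero, map_zero, opn_eq_zero]
      · simp
      · intro h2
        refine h fun x hx => h2 (.inl ⟨x, rfl⟩) ⟨_, hx, rfl⟩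

open scoped Classical in
-- Conjugation by the exchange replaces Y by X ∪ Yᶜ and Y' by X' ∪ Y'ᶜ. For E disjoint from X and
-- X', being contained in the former and disjoint from the latter means E ∩ Y = ∅ and E ⊆ Y'.
theorem cf_act'' (u : Y ↪ S) (v : X ↪ Y) (u' : Y' ↪ S) (v' : X' ↪ Y') (x : M.obj X) :
    cf v' (cf u' ((act'' a).app S (el u (el v x)))) =
      ∑ E : Set S with E ⊆ Set.range u' ∧ Disjoint E (Set.range u),
        opn a Eᶜ (v.trans u) (v'.trans u') x := by
  set T := Set.range (v.trans u) ∪ (Set.range u)ᶜ with hT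
  set T' := Set.range (v'.trans u') ∪ (Set.range u')ᶜ with hT'
  have hv : Set.range (v.trans u) ⊆ Set.range u := by
    rw [range_trans]; exact Set.image_subset_range _ _
  have hv' : Set.range (v'.trans u') ⊆ Set.range u' := by
    rw [range_trans]; exact Set.image_subset_range _ _
  have h1 : T = (Set.range u)ᶜ ∪ Set.range (v.trans u) := Set.union_comm _ _
  change cf v' (cf u' ((swap (Sym k) (Sym k) M).app S ((act' a).app S
    ((swap (Sym k) (Sym k) M).app S (el u (el v x)))))) = _
  rw [swap_el_el u v (incl T)
    ((v.trans u).codRestrict T fun s => .inl ⟨s, rfl⟩ : X ↪ S.sub T) rfl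
    ((range_incl T).trans h1), cf_cf_swap (S := S) (incl T')
    ((v'.trans u').codRestrict T' fun s => .inl ⟨s, rfl⟩ : X' ↪ S.sub T') u' v' rfl, cf_act']
  · rw [range_incl, range_incl]
    change ∑ E : Set S with E ⊆ T ∧ Disjoint E T', opn a Eᶜ (v.trans u) (v'.trans u') x = _
    rw [Finset.sum_filter, Finset.sum_filter]
    refine Finset.sum_congr rfl fun E _ => ?_
    by_cases hE : Set.range (v.trans u) ∪ Set.range (v'.trans u') ⊆ Eᶜ
    · refine if_congr ?_ rfl rfl
      rw [Set.disjoint_left, Set.disjoint_left]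
      simp only [hT, hT', Set.subset_def, Set.mem_union, Set.mem_compl_iff] at hE ⊢
      constructor
      · rintro ⟨h2, h3⟩
        refine ⟨fun s hs => ?_, fun s hs hs' => ?_⟩
        · have := h3 hs; tauto
        · have := h2 s hs; have := hE s; tauto
      · rintro ⟨h2, h3⟩
        refine ⟨fun s hs => ?_, fun s hs hs' => ?_⟩
        · have := h3 hs; tauto
        · have := h2 s hs; have := hE s; tauto
    · rw [opn_eq_zero a hE]
      simp
  · change _ = _ ∪ Set.range (v'.trans u')
    rw [range_incl, hT']
    ext s
    have := @hv' s
    simp only [Set.mem_union, Set.mem_compl_iff] at this ⊢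
    tauto

theorem hom_ext_el_el {P : Species k} {F G : Sym k ⊗ₛ (Sym k ⊗ₛ M) ⟶ P}
    (h : ∀ {S X Y : FB.{u}} (u : Y ↪ S) (v : X ↪ Y) (x : M.obj X),
      F.app S (el u (el v x)) = G.app S (el u (el v x))) : F = G := by
  ext S : 2
  refine ModuleCat.hom_ext (linear_ext_el fun {Y} u y => ?_)
  exact LinearMap.congr_fun (f := (F.app S).hom ∘ₗ el u) (g := (G.app S).hom ∘ₗ el u)
    (linear_ext_el fun {X} v x => h u v x) y

theorem weyl_rel_iff : act₁₂ a - act₂₁ a = act' a - act'' a ↔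
    ∀ {S X Y X' Y' : FB.{u}} (u : Y ↪ S) (v : X ↪ Y) (u' : Y' ↪ S) (v' : X' ↪ Y') (x : M.obj X),
      cf v' (cf u' ((act₁₂ a).app S (el u (el v x)))) -
        cf v' (cf u' ((act₂₁ a).app S (el u (el v x)))) =
      cf v' (cf u' ((act' a).app S (el u (el v x)))) -
        cf v' (cf u' ((act'' a).app S (el u (el v x)))) := by
  constructor
  · intro h S X Y X' Y' u v u' v' x
    have := congrArg (fun f => cf v' (cf u' (f.app S (el u (el v x))))) h
    refine Eq.trans ?_ (this.trans ?_)
    · rw [← map_sub, ← map_sub]; rfl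
    · rw [← map_sub, ← map_sub]; rfl
  · intro h
    refine hom_ext_el_el fun {S X Y} u v x => ?_
    refine ext_cf fun U => ext_cf fun V => ?_
    have := h u v (incl U) (incl V) x
    rw [← map_sub, ← map_sub, ← map_sub, ← map_sub] at this
    exact this

end weylCoefficients

end Species

namespace Species

variable {k : Type u} [CommRing k] {M : Species k}

/-! ### If ω vanishes, a coefficient M(U) → M(V) is zero unless U ∪ V is everything. -/

section vanishing

variable (a : Sym k ⊗ₛ M ⟶ Div k ⊗ₛ M)

theorem symTmul_eq_el {S : FB.{u}} (B : Set S) (x : M.obj (S.sub Bᶜ)) :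
    symTmul B x = el (incl Bᶜ) x := by
  classical
  change summand (M := Sym k) (N := M) B (symBasis k (S.sub B)) x = _
  rw [summand_eq_tmul]
  refine (tmul_eq_el (M := M) (A := S.sub B) (X := S.sub Bᶜ) _ (incl Bᶜ) (fun _ => rfl) 1 x).trans ?_
  rw [one_smul]

theorem coeff_eq_cf {S : FB.{u}} (A : Set S) (z : (Sym k ⊗ₛ M).obj S) :
    coeff (M := M) A z = cf (incl Aᶜ) z := by
  refine LinearMap.congr_fun (f := (coeff (M := M) A).hom) (g := cf (incl Aᶜ))
    (linear_ext_el fun {Y} w y => ?_) z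
  by_cases h : Set.range w = Aᶜ
  · obtain ⟨e, rfl⟩ := exists_equiv_of_range_eq w (incl Aᶜ) (h.trans (range_incl _).symm)
    rw [el_trans, cf_el_self, ← symTmul_eq_el]
    exact (coeff_summand_self A 1 _).trans (one_smul _ _)
  · rw [cf_el_ne _ _ (by rw [range_incl]; exact Ne.symm h)]
    exact coeff_summand_ne (fun h' => h (by rw [h', compl_compl])) 1 _

theorem operation_eq_op {S : FB.{u}} (A B : Set S) (x : M.obj (S.sub Bᶜ)) :
    operation a A B x = op a (incl Bᶜ) (incl Aᶜ) x := by
  change coeff A (a.app S (symTmul B x)) = _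
  rw [symTmul_eq_el]
  exact coeff_eq_cf A _

variable {X X' Y Y' Z S S' : FB.{u}}

theorem opn_univ (u : X ↪ S) (v : Y ↪ S) : opn a Set.univ u v = op a u v :=
  opn_eq_op a (Function.Embedding.refl S) Set.range_id u v

theorem opn_trans (T : Set S) (j : S ↪ S') (u : X ↪ S) (v : Y ↪ S) :
    opn a (j '' T) (u.trans j) (v.trans j) = opn a T u v := by
  by_cases h : (∀ x, u x ∈ T) ∧ ∀ y, v y ∈ T
  · have h1 := opn_eq_op a (incl T) (range_incl T) (u.codRestrict T h.1) (v.codRestrict T h.2)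
    have h2 := opn_eq_op a (T := j '' T) ((incl T).trans j) (by rw [range_trans, range_incl])
      (u.codRestrict T h.1 : X ↪ S.sub T) (v.codRestrict T h.2)
    exact h2.trans h1.symm
  · rw [opn, opn, dif_neg h, dif_neg]
    simpa using h

theorem opn_equiv_left (T : Set S) (e : X' ≃ X) (u : X ↪ S) (v : Y ↪ S) (x : M.obj X') :
    opn a T (e.toEmbedding.trans u) v x = opn a T u v (M.map (⟨e⟩ : X' ⟶ X) x) := by
  by_cases h : (∀ x, u x ∈ T) ∧ ∀ y, v y ∈ T
  · rw [opn, opn, dif_pos h, dif_pos ⟨fun x => h.1 (e x), h.2⟩]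
    exact op_equiv_left a (S := S.sub T) e (u.codRestrict T h.1) _ x
  · rw [opn, opn, dif_neg h, dif_neg]
    · rfl
    · rwa [← e.forall_congr_right (q := fun x => u x ∈ T)] at h

theorem opn_equiv_right (T : Set S) (e : Y' ≃ Y) (u : X ↪ S) (v : Y ↪ S) (x : M.obj X) :
    M.map (⟨e⟩ : Y' ⟶ Y) (opn a T u (e.toEmbedding.trans v) x) = opn a T u v x := by
  by_cases h : (∀ x, u x ∈ T) ∧ ∀ y, v y ∈ T
  · rw [opn, opn, dif_pos h, dif_pos ⟨h.1, fun y => h.2 (e y)⟩]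
    exact op_equiv_right a (S := S.sub T) e _ (v.codRestrict T h.2) x
  · rw [opn, opn, dif_neg h, dif_neg]
    · exact map_zero _
    · rwa [← e.forall_congr_right (q := fun y => v y ∈ T)] at h

/-- The intermediate injection occurs once as a target and once as a source, so a reparametrisation
cancels and only the image matters. -/
theorem opn_opn_congr (T T' : Set S) (u : X ↪ S) (v : Y ↪ S) (v' : Y' ↪ S) (w : Z ↪ S)
    (h : Set.range v = Set.range v') (x : M.obj X) :
    opn a T' v w (opn a T u v x) = opn a T' v' w (opn a T u v' x) := by
  obtain ⟨e, rfl⟩ := exists_equiv_of_range_eq v v' h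
  rw [opn_equiv_left, opn_equiv_right]

open scoped Classical in
-- The working form of the Weyl relation: Y and Y' are the middle sets of the input and of the
-- output, and may be any subsets containing the images of X and Z respectively. All later uses of
-- the relation are choices of Y and Y'.
theorem weyl_rel_sets (rel : act₁₂ a - act₂₁ a = act' a - act'' a) (u : X ↪ S) (w : Z ↪ S)
    (Y Y' : Set S) (hu : Set.range u ⊆ Y) (hw : Set.range w ⊆ Y') (x : M.obj X) :
    (if Y' ⊆ Y ∪ Set.range w then
      opn a (Set.range w ∪ Y'ᶜ) (incl (Y ∩ (Set.range w ∪ Y'ᶜ))) w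
        (opn a Y u (incl (Y ∩ (Set.range w ∪ Y'ᶜ))) x) else 0) -
    (if Y ⊆ Y' ∪ Set.range u then
      opn a Y' (incl (Y' ∩ (Set.range u ∪ Yᶜ))) w
        (opn a (Set.range u ∪ Yᶜ) u (incl (Y' ∩ (Set.range u ∪ Yᶜ))) x) else 0) =
    ∑ E : Set S with E ⊆ Y ∧ Disjoint E Y', opn a Eᶜ u w x -
      ∑ E : Set S with E ⊆ Y' ∧ Disjoint E Y, opn a Eᶜ u w x := by
  let u₀ : X ↪ S.sub Y := u.codRestrict Y fun x => hu ⟨x, rfl⟩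
  let w₀ : Z ↪ S.sub Y' := w.codRestrict Y' fun x => hw ⟨x, rfl⟩
  have hu₀ : u₀.trans (incl Y) = u := rfl
  have hw₀ : w₀.trans (incl Y') = w := rfl
  have h := (weyl_rel_iff a).1 rel (incl Y) u₀ (incl Y') w₀ x
  rw [cf_act', cf_act'', hu₀, hw₀, range_incl, range_incl] at h
  rw [← h]
  congr 1
  · split_ifs with h1
    · rw [cf_act₁₂ a (incl Y) u₀ (incl Y') w₀ x (by rwa [range_incl, range_incl]), hu₀, hw₀,
        range_incl, range_incl]
    · rw [cf_act₁₂_zero a (incl Y) u₀ (incl Y') w₀ x (by rwa [range_incl, range_incl])]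
  · split_ifs with h1
    · rw [cf_act₂₁ a (incl Y) u₀ (incl Y') w₀ x (by rwa [range_incl, range_incl]), hu₀, hw₀,
        range_incl, range_incl]
    · rw [cf_act₂₁_zero a (incl Y) u₀ (incl Y') w₀ x (by rwa [range_incl, range_incl])]

theorem op_congr_range {u : X ↪ S} {u' : X' ↪ S} {v : Y ↪ S} {v' : Y' ↪ S}
    (hu : Set.range u = Set.range u') (hv : Set.range v = Set.range v') (h : op a u v = 0) :
    op a u' v' = 0 := by
  obtain ⟨e, rfl⟩ := exists_equiv_of_range_eq u' u hu.symm
  obtain ⟨f, rfl⟩ := exists_equiv_of_range_eq v v' hv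
  ext x
  rw [op_equiv_left, ← op_equiv_right a f, h]
  exact map_zero _

/-- The hypothesis on ω concerns disjoint sets A and B, and the complements of the two images are
disjoint precisely when the images cover S. The added point is then the only uncovered one. -/
theorem op_inl_eq_zero (homega : ∀ (S : FB.{u}) (A B : Set S), Disjoint A B →
    omegaOperation a A B = 0) (u : X ↪ S) (v : Y ↪ S)
    (h : Set.range u ∪ Set.range v = Set.univ) :
    op a (S := addFin S 1) (u.trans Function.Embedding.inl) (v.trans Function.Embedding.inl) = 0 := by
  have hr : ∀ U : Set S, ((extendSet 1 Uᶜ)ᶜ : Set (addFin S 1)) = Sum.inl '' U := by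
    intro U
    ext (s | s) <;> simp [extendSet]
  have h0 := homega S (Set.range v)ᶜ (Set.range u)ᶜ (by
    rw [Set.disjoint_compl_left_iff_subset]
    intro s hs
    have := Set.ext_iff.1 h s
    simp only [Set.mem_union, Set.mem_univ, iff_true] at this
    exact this.resolve_left hs)
  rw [omegaOperation, neg_eq_zero, simpleOperation] at h0
  have h1 : op a (incl (extendSet 1 (Set.range u)ᶜ)ᶜ) (incl (extendSet 1 (Set.range v)ᶜ)ᶜ) = 0 := by
    ext x
    rw [← operation_eq_op]
    have h2 := congrArg (fun f => (M.map ⟨extendEquiv 1 (Set.range v)ᶜ⟩)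
      (f (M.map ⟨(extendEquiv 1 (Set.range u)ᶜ).symm⟩ x))) h0
    refine Eq.trans ?_ (h2.trans (map_zero _))
    refine Eq.trans ?_ (map_map_symm (extendEquiv 1 (Set.range v)ᶜ) _).symm
    exact congrArg (operation a _ _) (map_map_symm (extendEquiv 1 (Set.range u)ᶜ) x).symm
  refine op_congr_range a ?_ ?_ h1
  · rw [range_incl, hr, range_trans]; rfl
  · rw [range_incl, hr, range_trans]; rfl

/-- Given two uncovered points f and g, adjoin a point * and let P(E) be the coefficient with
ambient set (S ⊔ {*}) \ E. For Y = U ∪ {*} and Y' = V ∪ {f, g} both composites in the relation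
vanish, leaving P(∅) + P(*) = P(∅) + P(f) + P(g) + P(f, g). By symmetry P(*) = P(f) = P(g) is the
coefficient in question, and P(f, g) has one uncovered point fewer, so it is zero by induction.
Hence P(*) = 2 P(*), and P(*) = 0 in any characteristic. -/
theorem op_eq_zero_of_ncard (rel : act₁₂ a - act₂₁ a = act' a - act'' a)
    (homega : ∀ (S : FB.{u}) (A B : Set S), Disjoint A B → omegaOperation a A B = 0)
    (n : ℕ) : ∀ {X Y S : FB.{u}} (u : X ↪ S) (v : Y ↪ S),
      ((Set.range u ∪ Set.range v)ᶜ).ncard = n + 1 → op a u v = 0 := by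
  classical
  induction n using Nat.strong_induction_on with
  | _ n ih =>
  intro X Y S u v hn
  obtain _ | n := n
  -- With one uncovered point s, the set S is the complement of s with one point added, and the
  -- coefficient is an instance of ω up to sign and transport.
  · obtain ⟨s, hs⟩ := Set.ncard_eq_one.1 hn
    have hs' : ∀ t, (t ∈ Set.range u ∨ t ∈ Set.range v) ↔ t ≠ s := by
      intro t
      have := Set.ext_iff.1 hs t
      simp only [Set.mem_compl_iff, Set.mem_union, Set.mem_singleton_iff] at this
      tauto
    let u₀ : X ↪ S.sub {s}ᶜ := u.codRestrict _ fun x => (hs' _).1 (.inl ⟨x, rfl⟩)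
    let v₀ : Y ↪ S.sub {s}ᶜ := v.codRestrict _ fun x => (hs' _).1 (.inr ⟨x, rfl⟩)
    let g : addFin (S.sub {s}ᶜ) 1 ≃ S := Equiv.ofBijective
      (Sum.elim Subtype.val fun _ => s) (by
        constructor
        · rintro (⟨x, hx⟩ | x) (⟨y, hy⟩ | y) h
          · simpa using h
          · exact absurd h hx
          · exact absurd h.symm hy
          · rw [Subsingleton.elim x y]
        · intro x
          by_cases hx : x = s
          · exact ⟨.inr 0, hx.symm⟩
          · exact ⟨.inl ⟨x, hx⟩, rfl⟩)
    have := op_map a g (u₀.trans Function.Embedding.inl) (v₀.trans Function.Embedding.inl)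
    rw [op_inl_eq_zero a homega u₀ v₀] at this
    · exact this
    · refine Set.eq_univ_of_forall ?_
      rintro ⟨t, ht⟩
      rcases (hs' t).2 ht with ⟨x, rfl⟩ | ⟨x, rfl⟩
      · exact .inl ⟨x, rfl⟩
      · exact .inr ⟨x, rfl⟩
  · obtain ⟨f, hf, g, hg, hfg⟩ := (Set.one_lt_ncard).1
      (show 1 < ((Set.range u ∪ Set.range v)ᶜ).ncard by omega)
    -- The adjoined point is `none`.
    let O : FB.{u} := ⟨Option S⟩
    let j : S ↪ O := Function.Embedding.some
    let U := u.trans j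
    let V := v.trans j
    have hU : ∀ x, U x = some (u x) := fun _ => rfl
    have hV : ∀ x, V x = some (v x) := fun _ => rfl
    have hfU : ∀ x, U x ≠ some f := fun x h => hf (.inl ⟨x, Option.some_injective _ h⟩)
    have hfV : ∀ x, V x ≠ some f := fun x h => hf (.inr ⟨x, Option.some_injective _ h⟩)
    have hgU : ∀ x, U x ≠ some g := fun x h => hg (.inl ⟨x, Option.some_injective _ h⟩)
    have hgV : ∀ x, V x ≠ some g := fun x h => hg (.inr ⟨x, Option.some_injective _ h⟩)
    have hnU : ∀ x, U x ≠ none := fun x => Option.some_ne_none _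
    have hnV : ∀ x, V x ≠ none := fun x => Option.some_ne_none _
    have hnone : opn a ({none}ᶜ : Set O) U V = op a u v := by
      refine opn_eq_op a j ?_ u v
      ext t
      cases t with
      | none => exact ⟨fun ⟨x, hx⟩ => absurd hx (Option.some_ne_none _), fun h => absurd rfl h⟩
      | some t => exact ⟨fun _ => Option.some_ne_none _, fun _ => ⟨t, rfl⟩⟩
    -- The transposition of `none` and `some s` fixes both images pointwise, so leaving out either
    -- point gives the same coefficient.
    have hswap : ∀ s, (∀ x, U x ≠ some s) → (∀ x, V x ≠ some s) →
        opn a ({some s}ᶜ : Set O) U V = op a u v := by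
      intro s h1 h2
      rw [← hnone, ← opn_trans a ({none}ᶜ : Set O) (S' := O) (Equiv.swap none (some s)).toEmbedding U V]
      congr 1
      · rw [Equiv.coe_toEmbedding, Set.image_compl_eq (Equiv.bijective _), Set.image_singleton,
          Equiv.swap_apply_left]
      · ext x : 1
        exact (Equiv.swap_apply_of_ne_of_ne (hnU x) (h1 x)).symm
      · ext x : 1
        exact (Equiv.swap_apply_of_ne_of_ne (hnV x) (h2 x)).symm
    have hpair : opn a ({some f, some g}ᶜ : Set O) U V = 0 := by
      rw [opn, dif_pos ⟨by simp [hfU, hgU], by simp [hfV, hgV]⟩]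
      refine ih n (by omega) _ _ ?_
      -- There are n + 2 uncovered points in S; adding `none` and removing f and g leaves n + 1.
      have hc : Set.ncard (insert none (some '' ((Set.range u ∪ Set.range v)ᶜ \ {f, g}))) = n + 1 := by
        rw [Set.ncard_insert_of_notMem (by simp), Set.ncard_image_of_injective _
          (Option.some_injective _), Set.ncard_sdiff (Set.insert_subset hf (by simpa using hg)),
          Set.ncard_pair hfg, hn]
        omega
      rw [← hc, ← Set.ncard_image_of_injective _ Subtype.val_injective]
      congr 1
      ext t
      constructor
      · rintro ⟨⟨t, ht⟩, ht', rfl⟩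
        cases t with
        | none => exact .inl rfl
        | some t =>
          refine .inr ⟨t, ⟨?_, fun h => ht ?_⟩, rfl⟩
          · rintro (⟨x, rfl⟩ | ⟨x, rfl⟩)
            · exact ht' (.inl ⟨x, rfl⟩)
            · exact ht' (.inr ⟨x, rfl⟩)
          · rcases h with rfl | rfl
            · exact .inl rfl
            · exact .inr rfl
      · rintro (rfl | ⟨t, ⟨ht, ht'⟩, rfl⟩)
        · refine ⟨⟨none, by simp⟩, ?_, rfl⟩
          rintro (⟨x, hx⟩ | ⟨x, hx⟩)
          · exact hnU x (congrArg Subtype.val hx)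
          · exact hnV x (congrArg Subtype.val hx)
        · refine ⟨⟨some t, fun h => ht' ?_⟩, ?_, rfl⟩
          · rcases h with h | h
            · exact .inl (Option.some_injective _ h)
            · exact .inr (Option.some_injective _ h)
          rintro (⟨x, hx⟩ | ⟨x, hx⟩)
          · exact ht (.inl ⟨x, Option.some_injective _ (congrArg Subtype.val hx)⟩)
          · exact ht (.inr ⟨x, Option.some_injective _ (congrArg Subtype.val hx)⟩)
    ext x
    -- Both composites drop out: one would require f to lie in Y ∪ V, the other would require `none`
    -- to lie in Y' ∪ U.
    have key := weyl_rel_sets a rel U V (Set.range U ∪ {none}) (Set.range V ∪ {some f, some g})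
      Set.subset_union_left Set.subset_union_left x
    rw [if_neg, if_neg, sub_zero] at key
    · have e1 : ∑ E : Set O with E ⊆ Set.range U ∪ {none} ∧
          Disjoint E (Set.range V ∪ {some f, some g}), opn a Eᶜ U V x =
          ∑ E ∈ {∅, {none}}, opn a Eᶜ U V x := by
        refine (Finset.sum_subset ?_ ?_).symm
        · intro E hE
          rw [Finset.mem_insert, Finset.mem_singleton] at hE
          rw [Finset.mem_filter]
          refine ⟨Finset.mem_univ _, ?_⟩
          rcases hE with rfl | rfl
          · simp
          · refine ⟨Set.subset_union_right, Set.disjoint_singleton_left.2 ?_⟩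
            rintro (⟨x, hx⟩ | h | h)
            · exact hnV x hx
            · exact Option.some_ne_none _ h.symm
            · exact Option.some_ne_none _ h.symm
        · intro E hE hE'
          rw [Finset.mem_filter] at hE
          rw [opn_eq_zero]
          · rfl
          · intro h
            apply hE'
            have h2 : E ⊆ {none} := fun t ht =>
              (hE.2.1 ht).resolve_left fun h' => h (.inl h') ht
            rcases Set.subset_singleton_iff_eq.1 h2 with rfl | rfl <;> simp
      have e2 : ∑ E : Set O with E ⊆ Set.range V ∪ {some f, some g} ∧
          Disjoint E (Set.range U ∪ {none}), opn a Eᶜ U V x =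
          ∑ E ∈ {∅, {some f}, {some g}, {some f, some g}}, opn a Eᶜ U V x := by
        refine (Finset.sum_subset ?_ ?_).symm
        · intro E hE
          simp only [Finset.mem_insert, Finset.mem_singleton] at hE
          rw [Finset.mem_filter]
          refine ⟨Finset.mem_univ _, ?_⟩
          have d1 : some f ∉ Set.range U ∪ {none} := by
            rintro (⟨x, hx⟩ | h)
            · exact hfU x hx
            · exact Option.some_ne_none _ h
          have d2 : some g ∉ Set.range U ∪ {none} := by
            rintro (⟨x, hx⟩ | h)
            · exact hgU x hx
            · exact Option.some_ne_none _ h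
          rcases hE with rfl | rfl | rfl | rfl
          · simp
          · exact ⟨fun t ht => .inr (.inl ht), Set.disjoint_singleton_left.2 d1⟩
          · exact ⟨fun t ht => .inr (.inr ht), Set.disjoint_singleton_left.2 d2⟩
          · exact ⟨Set.subset_union_right,
              Set.disjoint_insert_left.2 ⟨d1, Set.disjoint_singleton_left.2 d2⟩⟩
        · intro E hE hE'
          rw [Finset.mem_filter] at hE
          rw [opn_eq_zero]
          · rfl
          · intro h
            apply hE'
            have h2 : E ⊆ {some f, some g} := fun t ht =>
              (hE.2.1 ht).resolve_left fun h' => h (.inr h') ht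
            rcases Set.subset_pair_iff_eq.1 h2 with rfl | rfl | rfl | rfl <;> simp
      have hne : (some f : Option S) ≠ some g := fun h => hfg (Option.some_injective _ h)
      have key' : 0 = ∑ E ∈ {∅, {none}}, opn a (Eᶜ : Set O) U V x -
          ∑ E ∈ {∅, {some f}, {some g}, {some f, some g}}, opn a (Eᶜ : Set O) U V x := by
        rw [← e1, ← e2]
        convert key
      clear key e1 e2
      rw [Finset.sum_insert (by simp), Finset.sum_singleton,
        Finset.sum_insert (by
          simp only [Finset.mem_insert, Finset.mem_singleton, not_or]
          exact ⟨(Set.singleton_ne_empty _).symm, (Set.singleton_ne_empty _).symm,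
            (Set.insert_nonempty _ _).ne_empty.symm⟩),
        Finset.sum_insert (by
          simp only [Finset.mem_insert, Finset.mem_singleton, not_or]
          refine ⟨fun h => hne (Set.singleton_injective h), fun h => hne ?_⟩
          exact (Set.ext_iff.1 h (some g)).2 (.inr rfl) |>.symm),
        Finset.sum_insert (by
          simp only [Finset.mem_singleton]
          intro h
          exact hne ((Set.ext_iff.1 h (some f)).2 (.inl rfl))),
        Finset.sum_singleton, hnone, hswap f hfU hfV, hswap g hgU hgV, hpair] at key'
      rw [LinearMap.zero_apply] at key' ⊢
      rw [eq_comm, sub_eq_zero, add_zero] at key'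
      have := add_left_cancel key'
      exact left_eq_add.1 this
    · intro h
      rcases h (.inr rfl : none ∈ Set.range U ∪ {none}) with (⟨x, hx⟩ | h | h) | ⟨x, hx⟩
      · exact hnV x hx
      · exact Option.some_ne_none _ h.symm
      · exact Option.some_ne_none _ h.symm
      · exact hnU x hx
    · intro h
      rcases h (.inr (.inl rfl) : some f ∈ Set.range V ∪ {some f, some g}) with
        (⟨x, hx⟩ | h) | ⟨x, hx⟩
      · exact hfU x hx
      · exact Option.some_ne_none _ h
      · exact hfV x hx

theorem op_eq_zero_of_ne_univ (rel : act₁₂ a - act₂₁ a = act' a - act'' a)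
    (homega : ∀ (S : FB.{u}) (A B : Set S), Disjoint A B → omegaOperation a A B = 0)
    (u : X ↪ S) (v : Y ↪ S) (h : Set.range u ∪ Set.range v ≠ Set.univ) : op a u v = 0 := by
  have : ((Set.range u ∪ Set.range v)ᶜ).ncard ≠ 0 := by
    rw [Ne, Set.ncard_eq_zero, Set.compl_empty_iff]
    exact h
  obtain ⟨n, hn⟩ := Nat.exists_eq_succ_of_ne_zero this
  exact op_eq_zero_of_ncard a rel homega n u v hn

theorem opn_eq_zero_of_ne (rel : act₁₂ a - act₂₁ a = act' a - act'' a)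
    (homega : ∀ (S : FB.{u}) (A B : Set S), Disjoint A B → omegaOperation a A B = 0) (T : Set S)
    (u : X ↪ S) (v : Y ↪ S) (h : T ≠ Set.range u ∪ Set.range v) : opn a T u v = 0 := by
  rw [opn]
  split_ifs with h'
  · refine op_eq_zero_of_ne_univ a rel homega _ _ fun h2 => h ?_
    refine Set.Subset.antisymm (fun t ht => ?_)
      (Set.union_subset (Set.range_subset_iff.2 h'.1) (Set.range_subset_iff.2 h'.2))
    rcases (Set.ext_iff.1 h2 ⟨t, ht⟩).2 trivial with ⟨x, hx⟩ | ⟨x, hx⟩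
    · exact .inl ⟨x, congrArg Subtype.val hx⟩
    · exact .inr ⟨x, congrArg Subtype.val hx⟩
  · rfl

end vanishing

end Species

/-! ### Block actions, and the block action underlying a Weyl representation. -/

namespace Species

variable {k : Type u} [CommRing k] {M : Species k}

/-- A family of operations `M(X) → M(Y)`, one for each pair of injections `u : X ↪ S`, `v : Y ↪ S`,
satisfying the relations of the morphisms of the partition category whose only non-trivial block is
the symmetric difference of `u(X)` and `v(Y)`. -/
structure BlockAction (δ : k) (M : Species k) where
  op : ∀ {X Y S : FB.{u}} (_ : X ↪ S) (_ : Y ↪ S), M.obj X →ₗ[k] M.obj Y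
  op_trans : ∀ {X Y S S' : FB.{u}} (u : X ↪ S) (v : Y ↪ S) (j : S ↪ S'),
    op (u.trans j) (v.trans j) = op u v
  op_equiv_left : ∀ {X X' Y S : FB.{u}} (e : X' ≃ X) (u : X ↪ S) (v : Y ↪ S) (x : M.obj X'),
    op (e.toEmbedding.trans u) v x = op u v (M.map (⟨e⟩ : X' ⟶ X) x)
  op_equiv_right : ∀ {X Y Y' S : FB.{u}} (e : Y' ≃ Y) (u : X ↪ S) (v : Y ↪ S) (x : M.obj X),
    M.map (⟨e⟩ : Y' ⟶ Y) (op u (e.toEmbedding.trans v) x) = op u v x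
  -- Equal images stand for the empty block, a closed part. It acts by δ, although the identity
  -- diagram acts by 1.
  op_self : ∀ {X S : FB.{u}} (u : X ↪ S) (x : M.obj X), op u u x = δ • x
  op_single : ∀ {X Y S : FB.{u}} (u : X ↪ S) (v : Y ↪ S) (e : X ≃ Y) (i : X),
    (∀ x, x ≠ i → v (e x) = u x) → v (e i) ≠ u i → ∀ x : M.obj X,
      op u v x = M.map (⟨e⟩ : X ⟶ Y) x
  -- The first condition forbids a point to leave and come back. A point of the image of v outside
  -- the other two images lies in both blocks, so these merge. If u and w have equal images, the
  -- merged block is empty and `op_self` gives δ.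
  op_comp : ∀ {X Y Z S : FB.{u}} (u : X ↪ S) (v : Y ↪ S) (w : Z ↪ S),
    Set.range u ∩ Set.range w ⊆ Set.range v → ¬ Set.range v ⊆ Set.range u ∪ Set.range w →
    ∀ x : M.obj X, op v w (op u v x) = op u w x
  -- Under these inclusions the blocks u △ v and v △ w are disjoint, and v' is the intermediate set
  -- when they are performed in the other order.
  op_comm : ∀ {X Y Y' Z S : FB.{u}} (u : X ↪ S) (v : Y ↪ S) (v' : Y' ↪ S) (w : Z ↪ S),
    Set.range u ∩ Set.range w ⊆ Set.range v → Set.range v ⊆ Set.range u ∪ Set.range w →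
    Set.range v' = (Set.range u ∩ Set.range w) ∪ ((Set.range u ∪ Set.range w) \ Set.range v) →
    ∀ x : M.obj X, op v w (op u v x) = op v' w (op u v' x)

section ofWeyl

variable (a : Sym k ⊗ₛ M ⟶ Div k ⊗ₛ M) {X Y Y' Z S : FB.{u}}

theorem stdIncl_summand (i : S) (y : M.obj (S.sub {i}ᶜ)) :
    (tensorHom (stdIncl k) (𝟙 M)).app S (summand {i} (stdBasis i) y) = el (incl {i}ᶜ) y := by
  classical
  rw [summand_eq_tmul]
  refine (tensorHom_tmul (stdIncl k) (𝟙 M) (A := S.sub {i}) (B := S.sub {i}ᶜ) _ _ _).trans ?_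
  refine (tmul_eq_el (M := M) (A := S.sub {i}) _ (incl {i}ᶜ) (fun _ => rfl) 1 _).trans ?_
  rw [one_smul]
  rfl

/-- Returning to Sym ⊗ M along `stdIncl` allows statements about 𝐕 ⊗ M to be tested with `cf`. -/
theorem cf_divProj (w : Y ↪ S) (z : (Sym k ⊗ₛ M).obj S) :
    cf w ((tensorHom (stdIncl k) (𝟙 M)).app S ((tensorHom (divProj k) (𝟙 M)).app S z)) =
      if Nat.card (S.sub (Set.range w)ᶜ) = 1 then cf w z else 0 := by
  have h : cf w ∘ₗ ((tensorHom (stdIncl k) (𝟙 M)).app S).hom ∘ₗ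
      ((tensorHom (divProj k) (𝟙 M)).app S).hom =
      if Nat.card (S.sub (Set.range w)ᶜ) = 1 then cf w else 0 := by
    refine linear_ext_el fun {X} t x => ?_
    change cf w ((tensorHom (stdIncl k) (𝟙 M)).app S ((tensorHom (divProj k) (𝟙 M)).app S (el t x))) = _
    rw [el_eq_tmul, tensorHom_tmul, tensorHom_tmul]
    have h1 : (stdIncl k).app (S.sub (Set.range t)ᶜ) ((divProj k).app (S.sub (Set.range t)ᶜ)
        (symBasis k _)) = (if Nat.card (S.sub (Set.range t)ᶜ) = 1 then (1 : k) else 0) := rfl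
    rw [h1]
    refine (congrArg (cf w) (tmul_eq_el (M := M) (A := S.sub (Set.range t)ᶜ) (complEquiv t) t
      (fun _ => rfl) _ _)).trans ?_
    rw [← el_eq_tmul, map_smul]
    change _ • cf w (el t x) = _
    by_cases hr : Set.range w = Set.range t
    · rw [← hr]
      split_ifs <;> simp
    · rw [cf_el_ne w t hr, smul_zero]
      split_ifs
      · exact (cf_el_ne w t hr x).symm
      · rfl
  refine (LinearMap.congr_fun h z).trans ?_
  split_ifs <;> rfl

theorem cf_glRestrict (j : S) (w : Y ↪ S) (x : M.obj (S.sub {j}ᶜ)) :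
    cf w ((tensorHom (stdIncl k) (𝟙 M)).app S ((glRestrict a).app S
      (summand {j} (stdBasis j) x))) =
      if Nat.card (S.sub (Set.range w)ᶜ) = 1 then op a (incl {j}ᶜ) w x else 0 := by
  change cf w ((tensorHom (stdIncl k) (𝟙 M)).app S ((tensorHom (divProj k) (𝟙 M)).app S
    (a.app S ((tensorHom (stdIncl k) (𝟙 M)).app S (summand {j} (stdBasis j) x))))) = _
  rw [cf_divProj, stdIncl_summand]
  rfl

theorem op_iota_of_isStandardGl (h : IsStandardGl 0 (glRestrict a)) (i j : S) (hij : i ≠ j)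
    (x : M.obj (S.sub {j}ᶜ)) : op a (incl {j}ᶜ) (incl {i}ᶜ) x = M.map ⟨iota i j⟩ x := by
  classical
  have h1 := congrArg (fun z => cf (incl {i}ᶜ) ((tensorHom (stdIncl k) (𝟙 M)).app S z)) (h S j x)
  refine Eq.trans ?_ (h1.trans ?_)
  · beta_reduce
    rw [cf_glRestrict, if_pos (by rw [range_incl, compl_compl]; simp)]
  · beta_reduce
    rw [zero_smul, zero_add, map_sum, map_sum, Finset.sum_eq_single i]
    · rw [stdIncl_summand, cf_el_self]
    · intro i' _ hi'
      rw [stdIncl_summand, cf_el_ne]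
      rw [range_incl, range_incl]
      exact fun h => hi' (Set.singleton_injective (compl_injective h)).symm
    · intro h
      exact absurd (Finset.mem_erase.2 ⟨hij, Finset.mem_univ _⟩) h

theorem op_refl_of_hasCentralCharacter {χ : k}
    (h : ∀ S : FB.{u}, symZeroIncl M S ≫ a.app S ≫ divZeroProj M S = χ • 𝟙 (M.obj S))
    (x : M.obj S) : op a (Function.Embedding.refl S) (Function.Embedding.refl S) x = χ • x := by
  have h1 := congrArg (fun f => f x) (h S)
  refine Eq.trans ?_ h1
  let e : S.sub (∅ : Set S)ᶜ ≃ S := Equiv.subtypeUnivEquiv (p := (· ∈ (∅ : Set S)ᶜ)) (fun _ h => h)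
  change _ = M.map (⟨e⟩ : S.sub (∅ : Set S)ᶜ ⟶ S) (coeff ∅ (a.app S (symTmul ∅
    (M.map (⟨e.symm⟩ : S ⟶ S.sub (∅ : Set S)ᶜ) x))))
  rw [symTmul_eq_el, coeff_eq_cf, ← el_trans]
  exact (cf_trans e (Function.Embedding.refl S) _).symm

open scoped Classical in
theorem sum_opn (u : X ↪ S) (w : Z ↪ S)
    (h : ∀ T, T ≠ Set.range u ∪ Set.range w → opn a T u w = 0) (p : Set S → Prop) (x : M.obj X) :
    ∑ E : Set S with p E, opn a Eᶜ u w x =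
      if p (Set.range u ∪ Set.range w)ᶜ then opn a (Set.range u ∪ Set.range w) u w x else 0 := by
  rw [Finset.sum_filter, Finset.sum_eq_single (Set.range u ∪ Set.range w)ᶜ]
  · rw [compl_compl]
  · intro E _ hE
    rw [h]
    · simp
    · exact fun h' => hE (by rw [← h', compl_compl])
  · simp

variable (rel : act₁₂ a - act₂₁ a = act' a - act'' a)
  (homega : ∀ (S : FB.{u}) (A B : Set S), Disjoint A B → omegaOperation a A B = 0)

include rel homega

open scoped Classical in
-- In each sum only E = (U ∪ W)ᶜ can contribute, since the ambient set Eᶜ must be U ∪ W. What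
-- remains on the right is one coefficient, switched on or off by two conditions.
theorem weyl_rel_prime (u : X ↪ S) (w : Z ↪ S)
    (Y Y' : Set S) (hu : Set.range u ⊆ Y) (hw : Set.range w ⊆ Y') (x : M.obj X) :
    (if Y' ⊆ Y ∪ Set.range w then
      opn a (Set.range w ∪ Y'ᶜ) (incl (Y ∩ (Set.range w ∪ Y'ᶜ))) w
        (opn a Y u (incl (Y ∩ (Set.range w ∪ Y'ᶜ))) x) else 0) -
    (if Y ⊆ Y' ∪ Set.range u then
      opn a Y' (incl (Y' ∩ (Set.range u ∪ Yᶜ))) w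
        (opn a (Set.range u ∪ Yᶜ) u (incl (Y' ∩ (Set.range u ∪ Yᶜ))) x) else 0) =
    (if (Set.range u ∪ Set.range w)ᶜ ⊆ Y ∧ Disjoint (Set.range u ∪ Set.range w)ᶜ Y' then
      opn a (Set.range u ∪ Set.range w) u w x else 0) -
    (if (Set.range u ∪ Set.range w)ᶜ ⊆ Y' ∧ Disjoint (Set.range u ∪ Set.range w)ᶜ Y then
      opn a (Set.range u ∪ Set.range w) u w x else 0) := by
  rw [weyl_rel_sets a rel u w Y Y' hu hw]
  congr 1
  · convert sum_opn a u w (fun T h => opn_eq_zero_of_ne a rel homega T u w h) (fun E => E ⊆ Y ∧ Disjoint E Y') x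
  · convert sum_opn a u w (fun T h => opn_eq_zero_of_ne a rel homega T u w h) (fun E => E ⊆ Y' ∧ Disjoint E Y) x

/-- Take Y = (v \ u)ᶜ and Y' = v ∪ w. Then u ∪ Yᶜ = u ∪ v, and the second composite passes through
(v ∪ w) ∩ (u ∪ v) = v. A point of v outside u ∪ w switches off the first term on each side, and the
relation equates the two remaining terms. -/
theorem opn_comp_of_univ (u : X ↪ S) (v : Y ↪ S) (w : Z ↪ S)
    (huniv : Set.range u ∪ Set.range v ∪ Set.range w = Set.univ)
    (h : Set.range u ∩ Set.range w ⊆ Set.range v)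
    (h' : ¬ Set.range v ⊆ Set.range u ∪ Set.range w) (x : M.obj X) :
    opn a (Set.range v ∪ Set.range w) v w (opn a (Set.range u ∪ Set.range v) u v x) =
      opn a (Set.range u ∪ Set.range w) u w x := by
  have hun : ∀ s, (s ∈ Set.range u ∨ s ∈ Set.range v) ∨ s ∈ Set.range w := fun s =>
    (Set.ext_iff.1 huniv s).2 trivial
  have key := weyl_rel_prime a rel homega u w (Set.range v \ Set.range u)ᶜ
    (Set.range v ∪ Set.range w) (fun s hs hs' => hs'.2 hs) Set.subset_union_right x
  have e1 : Set.range u ∪ (Set.range v \ Set.range u)ᶜᶜ = Set.range u ∪ Set.range v := by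
    rw [compl_compl, Set.union_sdiff_self]
  rw [e1, if_neg, if_pos, if_neg, if_pos, zero_sub, zero_sub, neg_inj] at key
  · rw [← key]
    refine opn_opn_congr a _ _ _ _ _ _ ?_ _
    rw [range_incl]
    ext s
    have := @h s
    simp only [Set.mem_union, Set.mem_inter_iff] at this ⊢
    tauto
  · refine ⟨fun s hs => ?_, ?_⟩
    · have := hun s
      simp only [Set.mem_union, Set.mem_compl_iff] at hs ⊢
      tauto
    · rw [Set.disjoint_compl_right_iff_subset]
      intro s hs
      have := hun s
      simp only [Set.mem_union, Set.mem_compl_iff, Set.mem_sdiff] at hs ⊢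
      tauto
  · rintro ⟨h1, -⟩
    obtain ⟨s, hs, hs'⟩ := Set.not_subset.1 h'
    exact h1 hs' ⟨hs, fun h => hs' (.inl h)⟩
  · intro s hs
    have := hun s
    simp only [Set.mem_union, Set.mem_compl_iff, Set.mem_sdiff] at hs ⊢
    tauto
  · intro h1
    obtain ⟨s, hs, hs'⟩ := Set.not_subset.1 h'
    rcases h1 (.inl hs) with h2 | h2
    · exact h2 ⟨hs, fun h => hs' (.inl h)⟩
    · exact hs' (.inr h2)

/-- The same choice of Y and Y' is used. Now u ∪ w is everything, so all four conditions hold, the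
right side cancels, and Y = u ∪ v' makes the first composite pass through v'. -/
theorem opn_comm_of_univ (u : X ↪ S) (v : Y ↪ S) (v' : Y' ↪ S) (w : Z ↪ S)
    (huniv : Set.range u ∪ Set.range w = Set.univ)
    (h : Set.range u ∩ Set.range w ⊆ Set.range v)
    (hv' : Set.range v' = (Set.range u ∩ Set.range w) ∪
      ((Set.range u ∪ Set.range w) \ Set.range v)) (x : M.obj X) :
    opn a (Set.range v ∪ Set.range w) v w (opn a (Set.range u ∪ Set.range v) u v x) =
      opn a (Set.range v' ∪ Set.range w) v' w (opn a (Set.range u ∪ Set.range v') u v' x) := by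
  have hun : ∀ s, s ∈ Set.range u ∨ s ∈ Set.range w := fun s =>
    (Set.ext_iff.1 huniv s).2 trivial
  have key := weyl_rel_prime a rel homega u w (Set.range v \ Set.range u)ᶜ
    (Set.range v ∪ Set.range w) (fun s hs hs' => hs'.2 hs) Set.subset_union_right x
  have e1 : Set.range u ∪ (Set.range v \ Set.range u)ᶜᶜ = Set.range u ∪ Set.range v := by
    rw [compl_compl, Set.union_sdiff_self]
  have e2 : Set.range w ∪ (Set.range v ∪ Set.range w)ᶜ = Set.range v' ∪ Set.range w := by
    rw [hv', huniv]
    ext s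
    simp only [Set.mem_union, Set.mem_compl_iff, Set.mem_inter_iff, Set.mem_sdiff, Set.mem_univ]
    tauto
  have e3 : (Set.range v \ Set.range u)ᶜ = Set.range u ∪ Set.range v' := by
    rw [hv', huniv]
    ext s
    simp only [Set.mem_union, Set.mem_compl_iff, Set.mem_inter_iff, Set.mem_sdiff, Set.mem_univ]
    tauto
  rw [e1, e2, e3, huniv, Set.compl_univ, if_pos, if_pos, if_pos (by simp), if_pos (by simp),
    sub_self, sub_eq_zero] at key
  · refine Eq.trans ?_ (key.symm.trans ?_)
    · refine opn_opn_congr a _ _ _ _ _ _ ?_ _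
      rw [range_incl]
      ext s
      have := @h s
      simp only [Set.mem_union, Set.mem_inter_iff] at this ⊢
      tauto
    · refine opn_opn_congr a _ _ _ _ _ _ ?_ _
      rw [range_incl, hv', huniv]
      ext s
      have := @h s
      have := hun s
      simp only [Set.mem_union, Set.mem_inter_iff, Set.mem_sdiff, Set.mem_univ] at this ⊢
      tauto
  · intro s _
    have := hun s
    simp only [Set.mem_union]
    tauto
  · intro s _
    have := hun s
    simp only [Set.mem_union]
    tauto

omit homega rel in
theorem opn_union_trans {S' : FB.{u}} (j : S ↪ S') (u : X ↪ S) (v : Y ↪ S) :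
    opn a (Set.range (u.trans j) ∪ Set.range (v.trans j)) (u.trans j) (v.trans j) =
      opn a (Set.range u ∪ Set.range v) u v := by
  rw [range_trans, range_trans, ← Set.image_union, opn_trans]

end ofWeyl

theorem range_codRestrict {X S : FB.{u}} (u : X ↪ S) (T : Set S) (h : ∀ x, u x ∈ T) :
    Set.range (u.codRestrict T h) = Subtype.val ⁻¹' Set.range u := by
  ext t
  constructor
  · rintro ⟨x, rfl⟩
    exact ⟨x, rfl⟩
  · rintro ⟨x, hx⟩
    exact ⟨x, Subtype.ext hx⟩

open scoped Classical in
theorem iota_left {S : FB.{u}} (i j : S) (s : S.sub {j}ᶜ) (h : (s : S) = i) :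
    (iota i j s : S) = j := by
  change Equiv.swap i j (s : S) = j
  rw [h, Equiv.swap_apply_left]

open scoped Classical in
theorem iota_of_ne {S : FB.{u}} (i j : S) (s : S.sub {j}ᶜ) (h : (s : S) ≠ i) :
    (iota i j s : S) = s :=
  Equiv.swap_apply_of_ne_of_ne h s.2

/-- The block action underlying a representation of the curried Weyl Lie algebra with central
character `δ` that is `0`-standard and has vanishing `ω` operation. -/
def blockAction {δ : k} (M : WeylRep k) (h1 : M.HasCentralCharacter δ) (h2 : M.IsStandard 0)
    (h3 : M.OmegaVanishes) : BlockAction δ M.species where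
  op u v := opn M.act (Set.range u ∪ Set.range v) u v
  op_trans u v j := opn_union_trans M.act j u v
  op_equiv_left e u v x := by rw [range_equiv_trans, opn_equiv_left]
  op_equiv_right e u v x := by rw [range_equiv_trans, opn_equiv_right]
  op_self {X S} u x := by
    rw [Set.union_self, ← op_refl_of_hasCentralCharacter M.act h1]
    exact LinearMap.congr_fun (opn_eq_op M.act u rfl (Function.Embedding.refl X)
      (Function.Embedding.refl X)) x
  op_single {X Y S} u v e i he hi x := by
    classical
    have hvi : v (e i) ∉ Set.range u := by
      rintro ⟨y, hy⟩
      by_cases hyi : y = i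
      · exact hi (hyi ▸ hy.symm)
      · rw [← he y hyi] at hy
        exact hyi (e.injective (v.injective hy))
    have hui : u i ∉ Set.range v := by
      rintro ⟨y, hy⟩
      obtain ⟨y, rfl⟩ := e.surjective y
      by_cases hyi : y = i
      · exact hi (hyi ▸ hy)
      · rw [he y hyi] at hy
        exact hyi (u.injective hy)
    set T := Set.range u ∪ Set.range v with hT
    have hru : ∀ t ∈ T, t ∈ Set.range u ↔ t ≠ v (e i) := by
      rintro t (ht | ⟨y, rfl⟩)
      · exact ⟨fun _ h => hvi (h ▸ ht), fun _ => ht⟩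
      · obtain ⟨y, rfl⟩ := e.surjective y
        constructor
        · exact fun h h' => hvi (h' ▸ h)
        · intro h
          have hyi : y ≠ i := fun h' => h (by rw [h'])
          exact ⟨y, (he y hyi).symm⟩
    have hrv : ∀ t ∈ T, t ∈ Set.range v ↔ t ≠ u i := by
      rintro t (⟨y, rfl⟩ | ht)
      · constructor
        · exact fun h h' => hui (h' ▸ h)
        · intro h
          have hyi : y ≠ i := fun h' => h (by rw [h'])
          exact ⟨e y, he y hyi⟩
      · exact ⟨fun _ h => hui (h ▸ ht), fun _ => ht⟩
    -- Inside T the image of u misses only q and the image of v misses only p. This is the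
    -- coefficient T \ {q} → T \ {p}, which 0-standardness identifies with ι_{p,q}.
    let p : S.sub T := ⟨u i, .inl ⟨i, rfl⟩⟩
    let q : S.sub T := ⟨v (e i), .inr ⟨e i, rfl⟩⟩
    have hpq : p ≠ q := fun h => hi (congrArg Subtype.val h).symm
    let u₀ : X ↪ S.sub T := u.codRestrict T fun x => .inl ⟨x, rfl⟩
    let v₀ : Y ↪ S.sub T := v.codRestrict T fun x => .inr ⟨x, rfl⟩
    have hu₀ : Set.range u₀ = Subtype.val ⁻¹' Set.range u := range_codRestrict u T _
    have hv₀ : Set.range v₀ = Subtype.val ⁻¹' Set.range v := range_codRestrict v T _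
    obtain ⟨f, hf⟩ := exists_equiv_of_range_eq u₀ (incl {q}ᶜ) (by
      rw [range_incl, hu₀]
      ext ⟨t, ht⟩
      exact (hru t ht).trans (not_congr ⟨fun h => Subtype.ext h, fun h => congrArg Subtype.val h⟩))
    obtain ⟨g, hg⟩ := exists_equiv_of_range_eq v₀ (incl {p}ᶜ) (by
      rw [range_incl, hv₀]
      ext ⟨t, ht⟩
      exact (hrv t ht).trans (not_congr ⟨fun h => Subtype.ext h, fun h => congrArg Subtype.val h⟩))
    have h4 : opn M.act T u v = op M.act u₀ v₀ :=
      opn_eq_op M.act (incl T) (range_incl T) u₀ v₀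
    rw [h4, ← hf, ← hg, op_equiv_left]
    have h5 := op_equiv_right M.act g (incl {q}ᶜ) (incl {p}ᶜ)
      (M.species.map (⟨f⟩ : X ⟶ (S.sub T).sub {q}ᶜ) x)
    rw [op_iota_of_isStandardGl M.act h2 p q hpq] at h5
    have h6 := congrArg (M.species.map (⟨g.symm⟩ : (S.sub T).sub {p}ᶜ ⟶ Y)) h5
    rw [map_symm_map, map_trans, map_trans] at h6
    rw [h6]
    congr 3
    refine FB.hom_ext fun y => g.injective (Subtype.ext (Subtype.ext ?_))
    have hf' : ∀ y, ((f y : S.sub T) : S) = u y := fun y =>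
      congrArg Subtype.val (DFunLike.congr_fun hf y)
    have hg' : ∀ y, ((g y : S.sub T) : S) = v y := fun y =>
      congrArg Subtype.val (DFunLike.congr_fun hg y)
    simp only [Equiv.trans_apply, Equiv.apply_symm_apply]
    rw [hg']
    by_cases hy : y = i
    · have : (f y : S.sub T) = p := Subtype.ext (by rw [hf', hy])
      rw [iota_left p q _ this, hy]
    · have : (f y : S.sub T) ≠ p := fun h =>
        hy (u.injective ((hf' y).symm.trans (congrArg Subtype.val h)))
      rw [iota_of_ne p q _ this, hf', he y hy]
  op_comp {X Y Z S} u v w h h' x := by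
    -- Replacing S by the union of the three images provides the covering hypothesis of
    -- `opn_comp_of_univ`.
    let T := Set.range u ∪ Set.range v ∪ Set.range w
    let u₀ : X ↪ S.sub T := u.codRestrict T fun x => .inl (.inl ⟨x, rfl⟩)
    let v₀ : Y ↪ S.sub T := v.codRestrict T fun x => .inl (.inr ⟨x, rfl⟩)
    let w₀ : Z ↪ S.sub T := w.codRestrict T fun x => .inr ⟨x, rfl⟩
    have hu₀ : Set.range u₀ = Subtype.val ⁻¹' Set.range u := range_codRestrict u T _
    have hv₀ : Set.range v₀ = Subtype.val ⁻¹' Set.range v := range_codRestrict v T _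
    have hw₀ : Set.range w₀ = Subtype.val ⁻¹' Set.range w := range_codRestrict w T _
    have e1 := opn_union_trans M.act (incl T) u₀ v₀
    have e2 := opn_union_trans M.act (incl T) v₀ w₀
    have e3 := opn_union_trans M.act (incl T) u₀ w₀
    change opn M.act (Set.range u ∪ Set.range v) u v = _ at e1
    change opn M.act (Set.range v ∪ Set.range w) v w = _ at e2
    change opn M.act (Set.range u ∪ Set.range w) u w = _ at e3
    rw [e1, e2, e3]
    refine opn_comp_of_univ M.act M.rel h3 u₀ v₀ w₀ ?_ ?_ ?_ x
    · rw [hu₀, hv₀, hw₀, ← Set.preimage_union,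
        ← Set.preimage_union]
      exact Set.eq_univ_of_forall fun t => t.2
    · rw [hu₀, hv₀, hw₀]
      exact fun t ht => h ht
    · rw [hu₀, hv₀, hw₀]
      obtain ⟨s, hs, hs'⟩ := Set.not_subset.1 h'
      exact fun h2 => hs' (@h2 ⟨s, .inl (.inr hs)⟩ hs)
  op_comm {X Y Y' Z S} u v v' w h h' hv' x := by
    let T := Set.range u ∪ Set.range w
    have hv'T : ∀ s ∈ Set.range v', s ∈ T := by
      rw [hv']
      rintro s (hs | hs)
      · exact .inl hs.1
      · exact hs.1
    let u₀ : X ↪ S.sub T := u.codRestrict T fun x => .inl ⟨x, rfl⟩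
    let v₀ : Y ↪ S.sub T := v.codRestrict T fun x => h' ⟨x, rfl⟩
    let v₁ : Y' ↪ S.sub T := v'.codRestrict T fun x => hv'T _ ⟨x, rfl⟩
    let w₀ : Z ↪ S.sub T := w.codRestrict T fun x => .inr ⟨x, rfl⟩
    have hu₀ : Set.range u₀ = Subtype.val ⁻¹' Set.range u := range_codRestrict u T _
    have hv₀ : Set.range v₀ = Subtype.val ⁻¹' Set.range v := range_codRestrict v T _
    have hw₀ : Set.range w₀ = Subtype.val ⁻¹' Set.range w := range_codRestrict w T _
    have e1 := opn_union_trans M.act (incl T) u₀ v₀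
    have e2 := opn_union_trans M.act (incl T) v₀ w₀
    have e3 := opn_union_trans M.act (incl T) u₀ v₁
    have hv₁ : Set.range v₁ = Subtype.val ⁻¹' Set.range v' := range_codRestrict v' T _
    have e4 := opn_union_trans M.act (incl T) v₁ w₀
    change opn M.act (Set.range u ∪ Set.range v) u v = _ at e1
    change opn M.act (Set.range v ∪ Set.range w) v w = _ at e2
    change opn M.act (Set.range u ∪ Set.range v') u v' = _ at e3
    change opn M.act (Set.range v' ∪ Set.range w) v' w = _ at e4
    rw [e1, e2, e3, e4]
    refine opn_comm_of_univ M.act M.rel h3 u₀ v₀ v₁ w₀ ?_ ?_ ?_ x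
    · rw [hu₀, hw₀, ← Set.preimage_union]
      exact Set.eq_univ_of_forall fun t => t.2
    · rw [hu₀, hv₀, hw₀]
      exact fun t ht => h ht
    · rw [hv₁, hu₀, hw₀, hv₀, hv']
      rfl

end Species

/-! ### Products of commuting families without a proof argument. -/

section commProd

variable {ι κ R : Type*} [Monoid R]

open scoped Classical in
/-- The product of a finite family of commuting elements. -/
def commProd (s : Finset ι) (f : ι → R) : R :=
  -- The default value 1 for non-commuting families keeps the proof out of the expression, so index
  -- sets and factors can be rewritten freely.
  if h : (s : Set ι).Pairwise (Function.onFun Commute f) then s.noncommProd f h else 1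

@[simp] theorem commProd_empty (f : ι → R) : commProd ∅ f = 1 := by
  rw [commProd, dif_pos (by simp), Finset.noncommProd_empty]

theorem commProd_insert [DecidableEq ι] {s : Finset ι} {i : ι} {f : ι → R} (hi : i ∉ s)
    (h : ((insert i s : Finset ι) : Set ι).Pairwise (Function.onFun Commute f)) :
    commProd (insert i s) f = f i * commProd s f := by
  rw [commProd, dif_pos h, commProd, dif_pos (h.mono (by simp)),
    Finset.noncommProd_insert_of_notMem _ _ _ _ hi]

theorem commProd_insert' [DecidableEq ι] {s : Finset ι} {i : ι} {f : ι → R} (hi : i ∉ s)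
    (h : ((insert i s : Finset ι) : Set ι).Pairwise (Function.onFun Commute f)) :
    commProd (insert i s) f = commProd s f * f i := by
  rw [commProd, dif_pos h, commProd, dif_pos (h.mono (by simp)),
    Finset.noncommProd_insert_of_notMem' _ _ _ _ hi]

theorem commProd_congr {s : Finset ι} {f g : ι → R} (h : ∀ i ∈ s, f i = g i) :
    commProd s f = commProd s g := by
  classical
  by_cases hf : (s : Set ι).Pairwise (Function.onFun Commute f)
  · have hg : (s : Set ι).Pairwise (Function.onFun Commute g) := by
      intro i hi j hj hij
      have := hf hi hj hij
      rwa [Function.onFun, h i hi, h j hj] at this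
    rw [commProd, dif_pos hf, commProd, dif_pos hg]
    exact Finset.noncommProd_congr rfl h _
  · have hg : ¬ (s : Set ι).Pairwise (Function.onFun Commute g) := by
      intro hg
      apply hf
      intro i hi j hj hij
      have := hg hi hj hij
      rwa [Function.onFun, ← h i hi, ← h j hj] at this
    rw [commProd, dif_neg hf, commProd, dif_neg hg]

theorem commProd_union [DecidableEq ι] {s t : Finset ι} {f : ι → R} (hst : Disjoint s t)
    (h : ((s ∪ t : Finset ι) : Set ι).Pairwise (Function.onFun Commute f)) :
    commProd (s ∪ t) f = commProd s f * commProd t f := by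
  induction s using Finset.induction_on with
  | empty => simp
  | insert i s hi ih =>
    rw [Finset.disjoint_insert_left] at hst
    rw [Finset.insert_union] at h ⊢
    rw [commProd_insert (by simp [hi, hst.1]) h, ih hst.2 (h.mono (by simp)),
      commProd_insert hi (h.mono (by
        intro j hj
        simp only [Finset.coe_insert, Set.mem_insert_iff, Finset.coe_union, Set.mem_union] at hj ⊢
        tauto)), mul_assoc]

theorem commProd_image [DecidableEq κ] {s : Finset ι} {g : ι → κ} {f : κ → R}
    (hg : Set.InjOn g s)
    (h : ((s.image g : Finset κ) : Set κ).Pairwise (Function.onFun Commute f)) :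
    commProd (s.image g) f = commProd s (f ∘ g) := by
  classical
  have h' : (s : Set ι).Pairwise (Function.onFun Commute (f ∘ g)) := by
    intro i hi j hj hij
    exact h (by simpa using ⟨i, hi, rfl⟩) (by simpa using ⟨j, hj, rfl⟩)
      fun h => hij (hg hi hj h)
  induction s using Finset.induction_on with
  | empty => simp
  | insert i s hi ih =>
    have hgi : g i ∉ s.image g := by
      intro hgi
      obtain ⟨j, hj, hij⟩ := Finset.mem_image.1 hgi
      have := hg (by simp [hj]) (by simp) hij
      exact hi (this ▸ hj)
    rw [Finset.image_insert] at h ⊢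
    rw [commProd_insert hgi h, commProd_insert hi h',
      ih (hg.mono (by simp)) (h.mono (by simp)) (h'.mono (by simp))]
    rfl

theorem commProd_const (s : Finset ι) (r : R) : commProd s (fun _ => r) = r ^ s.card := by
  classical
  induction s using Finset.induction_on with
  | empty => simp
  | insert i s hi ih =>
    rw [commProd_insert hi fun _ _ _ _ _ => Commute.refl r, ih, Finset.card_insert_of_notMem hi,
      pow_succ']

end commProd

/-! ### Blocks as endomorphisms of ⨁_U M(U): commutation and merging. -/

namespace Species

variable {k : Type u} [CommRing k] {M : Species k} {δ : k}

namespace BlockAction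

variable (b : BlockAction δ M) {X Y Z S S' : FB.{u}}

open scoped Classical in
/-- The operation attached to a block with source part `A` and target part `B`, as an endomorphism
of `⨁_U M(U)`, where `U` runs over the subsets of `S`. -/
def blockOp {S : FB.{u}} (A B : Set S) : Module.End k ((Sym k ⊗ₛ M).obj S) :=
  ∑ U : Set S, if A ⊆ U ∧ Disjoint B U then
    el (incl ((U \ A) ∪ B)) ∘ₗ b.op (incl U) (incl ((U \ A) ∪ B)) ∘ₗ cf (incl U) else 0

theorem el_op_congr {Y' : FB.{u}} (u : X ↪ S) (v : Y ↪ S) (v' : Y' ↪ S)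
    (h : Set.range v = Set.range v') (x : M.obj X) :
    el v (b.op u v x) = el v' (b.op u v' x) := by
  obtain ⟨e, rfl⟩ := exists_equiv_of_range_eq v v' h
  rw [el_trans, b.op_equiv_right]

theorem blockOp_el {A B : Set S} (u : X ↪ S) (v : Y ↪ S) (hA : A ⊆ Set.range u)
    (hB : Disjoint B (Set.range u)) (hv : Set.range v = (Set.range u \ A) ∪ B) (x : M.obj X) :
    b.blockOp A B (el u x) = el v (b.op u v x) := by
  classical
  rw [blockOp, LinearMap.sum_apply, Finset.sum_eq_single (Set.range u)]
  · rw [if_pos ⟨hA, hB⟩, LinearMap.comp_apply, LinearMap.comp_apply]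
    obtain ⟨e, he⟩ := exists_equiv_of_range_eq u (incl (Set.range u)) (range_incl _).symm
    have h1 : cf (incl (Set.range u)) (el u x) =
        M.map (⟨e⟩ : X ⟶ S.sub (Set.range u)) x := cf_el_equiv e he x
    rw [h1, ← b.op_equiv_left, he]
    exact b.el_op_congr u _ v ((range_incl _).trans hv.symm) x
  · intro U _ hU
    split_ifs
    · rw [LinearMap.comp_apply, LinearMap.comp_apply, cf_el_ne _ _ (by rwa [range_incl]),
        map_zero, map_zero]
    · rfl
  · simp

theorem blockOp_el_zero {A B : Set S} (u : X ↪ S)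
    (h : ¬ (A ⊆ Set.range u ∧ Disjoint B (Set.range u))) (x : M.obj X) :
    b.blockOp A B (el u x) = 0 := by
  classical
  rw [blockOp, LinearMap.sum_apply]
  refine Finset.sum_eq_zero fun U _ => ?_
  split_ifs with hU
  · rw [LinearMap.comp_apply, LinearMap.comp_apply, cf_el_ne, map_zero, map_zero]
    rw [range_incl]
    rintro rfl
    exact h hU
  · rfl

theorem exists_blockOp_el (A B : Set S) (u : X ↪ S) (x : M.obj X) :
    ∃ y, b.blockOp A B (el u x) = el (incl ((Set.range u \ A) ∪ B)) y := by
  by_cases h : A ⊆ Set.range u ∧ Disjoint B (Set.range u)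
  · exact ⟨_, b.blockOp_el u (incl ((Set.range u \ A) ∪ B)) h.1 h.2 (range_incl _) x⟩
  · exact ⟨0, by rw [b.blockOp_el_zero u h, map_zero]⟩

theorem blockOp_empty : b.blockOp (∅ : Set S) ∅ = δ • (1 : Module.End k _) := by
  refine linear_ext_el fun {X} u x => ?_
  rw [b.blockOp_el u u (Set.empty_subset _) (Set.empty_disjoint _) (by simp), b.op_self, map_smul]
  rfl

/-- By disjointness neither block affects whether the other applies. If both apply, the two orders
pass through the two intermediate sets of `op_comm`; otherwise both orders give zero. -/
theorem blockOp_commute {A B C D : Set S} (hAB : Disjoint A B) (hAC : Disjoint A C)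
    (hAD : Disjoint A D) (hBC : Disjoint B C) (hBD : Disjoint B D) (hCD : Disjoint C D) :
    Commute (b.blockOp A B) (b.blockOp C D) := by
  refine linear_ext_el fun {X} u x => ?_
  change b.blockOp A B (b.blockOp C D (el u x)) = b.blockOp C D (b.blockOp A B (el u x))
  have r1 : ∀ T : Set S, Set.range (incl T) = T := range_incl
  by_cases h1 : A ⊆ Set.range u ∧ Disjoint B (Set.range u)
  · obtain ⟨hA, hB⟩ := h1
    rw [b.blockOp_el u (incl ((Set.range u \ A) ∪ B)) hA hB (r1 _)]
    by_cases h2 : C ⊆ Set.range u ∧ Disjoint D (Set.range u)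
    · obtain ⟨hC, hD⟩ := h2
      rw [b.blockOp_el u (incl ((Set.range u \ C) ∪ D)) hC hD (r1 _),
        b.blockOp_el _ (incl (((Set.range u \ C) ∪ D) \ A ∪ B)),
        b.blockOp_el _ (incl (((Set.range u \ C) ∪ D) \ A ∪ B))]
      · congr 1
        apply b.op_comm <;> rw [r1, r1]
        · simp only [Set.disjoint_left] at *; grind
        · simp only [Set.disjoint_left] at *; grind
        · rw [r1]
          (simp only [Set.disjoint_left] at *; grind)
      · rw [r1]; simp only [Set.disjoint_left] at *; grind
      · rw [r1]; simp only [Set.disjoint_left] at *; grind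
      · rw [r1, r1]; simp only [Set.disjoint_left] at *; grind
      · rw [r1]; simp only [Set.disjoint_left] at *; grind
      · rw [r1]; simp only [Set.disjoint_left] at *; grind
      · rw [r1, r1]
    · rw [b.blockOp_el_zero u h2, map_zero, b.blockOp_el_zero]
      rw [r1]
      intro h3
      apply h2
      obtain ⟨h3, h4⟩ := h3
      simp only [Set.disjoint_left] at *; grind
  · rw [b.blockOp_el_zero u h1, map_zero]
    obtain ⟨y, h⟩ := b.exists_blockOp_el C D u x
    rw [h, b.blockOp_el_zero]
    rw [r1]
    intro h3
    apply h1
    obtain ⟨h3, h4⟩ := h3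
    simp only [Set.disjoint_left] at *; grind

/-- The points of B ∩ C are created by the first block and consumed by the second, and cause
`op_comp` to apply. The summand must avoid B ∩ C, because the merged block no longer sees these
points, whereas the composite vanishes if one is already occupied. -/
theorem blockOp_merge {A B C D : Set S} (hAC : Disjoint A C)
    (hAD : Disjoint A D) (hBC : (B ∩ C).Nonempty) (hBD : Disjoint B D)
    (u : X ↪ S) (hu : Disjoint (Set.range u) (B ∩ C)) (x : M.obj X) :
    b.blockOp C D (b.blockOp A B (el u x)) = b.blockOp (A ∪ (C \ B)) (D ∪ (B \ C)) (el u x) := by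
  have r1 : ∀ T : Set S, Set.range (incl T) = T := range_incl
  by_cases h1 : A ⊆ Set.range u ∧ Disjoint B (Set.range u)
  · obtain ⟨hA, hB⟩ := h1
    rw [b.blockOp_el u (incl ((Set.range u \ A) ∪ B)) hA hB (r1 _)]
    by_cases h2 : C \ B ⊆ Set.range u ∧ Disjoint D (Set.range u)
    · obtain ⟨hC, hD⟩ := h2
      rw [b.blockOp_el u (incl (((Set.range u \ A) ∪ B) \ C ∪ D)),
        b.blockOp_el _ (incl (((Set.range u \ A) ∪ B) \ C ∪ D))]
      · congr 1
        apply b.op_comp <;> rw [r1, r1]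
        · simp only [Set.disjoint_left] at *; grind
        · obtain ⟨s, hsB, hsC⟩ := hBC
          intro h
          rcases h (.inr hsB) with h | ⟨-, h⟩ | h
          · exact Set.disjoint_left.1 hB hsB h
          · exact h hsC
          · exact Set.disjoint_left.1 hBD hsB h
      · rw [r1]; simp only [Set.disjoint_left] at *; grind
      · rw [r1]; simp only [Set.disjoint_left] at *; grind
      · rw [r1, r1]
      · simp only [Set.disjoint_left] at *; grind
      · simp only [Set.disjoint_left] at *; grind
      · rw [r1]; simp only [Set.disjoint_left] at *; grind
    · rw [b.blockOp_el_zero, b.blockOp_el_zero]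
      · intro h3
        apply h2
        obtain ⟨h3, h4⟩ := h3
        simp only [Set.disjoint_left] at *; grind
      · rw [r1]
        intro h3
        apply h2
        obtain ⟨h3, h4⟩ := h3
        simp only [Set.disjoint_left] at *; grind
  · rw [b.blockOp_el_zero u h1, map_zero, b.blockOp_el_zero]
    intro h3
    apply h1
    obtain ⟨h3, h4⟩ := h3
    simp only [Set.disjoint_left] at *; grind

end BlockAction

end Species

/-! ### Enlarging the ambient set, and products of disjoint blocks. -/

namespace Species

variable {k : Type u} [CommRing k] {M : Species k} {δ : k}

theorem el_congr_range {X Y S : FB.{u}} (u : X ↪ S) (v : Y ↪ S) (h : Set.range u = Set.range v)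
    (x : M.obj X) : ∃ y : M.obj Y, (el u x : (Sym k ⊗ₛ M).obj S) = el v y := by
  obtain ⟨e, rfl⟩ := exists_equiv_of_range_eq u v h
  exact ⟨_, el_trans e v x⟩

/-- The map `⨁_{U ⊆ S} M(U) → ⨁_{U ⊆ S'} M(U)` induced by an injection `S ↪ S'`. -/
def extend {S S' : FB.{u}} (j : S ↪ S') : (Sym k ⊗ₛ M).obj S →ₗ[k] (Sym k ⊗ₛ M).obj S' :=
  ∑ U : Set S, el ((incl U).trans j) ∘ₗ cf (incl U)

theorem extend_el {X S S' : FB.{u}} (j : S ↪ S') (u : X ↪ S) (x : M.obj X) :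
    extend j (el u x) = el (u.trans j) x := by
  rw [extend, LinearMap.sum_apply, Finset.sum_eq_single (Set.range u)]
  · obtain ⟨e, he⟩ := exists_equiv_of_range_eq u (incl (Set.range u)) (range_incl _).symm
    have h1 : cf (incl (Set.range u)) (el u x) =
        M.map (⟨e⟩ : X ⟶ S.sub (Set.range u)) x := cf_el_equiv e he x
    have he' : e.toEmbedding.trans ((incl (Set.range u)).trans j) = u.trans j :=
      congrArg (fun w => w.trans j) he
    rw [LinearMap.comp_apply, h1, ← el_trans, he']
  · intro U _ hU
    rw [LinearMap.comp_apply, cf_el_ne _ _ (by rwa [range_incl]), map_zero]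
  · simp

namespace BlockAction

variable (b : BlockAction δ M) {X Y Z S S' : FB.{u}}

theorem blockOp_extend (j : S ↪ S') (A B : Set S) (z : (Sym k ⊗ₛ M).obj S) :
    b.blockOp (j '' A) (j '' B) (extend j z) = extend j (b.blockOp A B z) := by
  refine LinearMap.congr_fun (f := b.blockOp (j '' A) (j '' B) ∘ₗ extend j)
    (g := extend j ∘ₗ b.blockOp A B) (linear_ext_el fun {X} u x => ?_) z
  rw [LinearMap.comp_apply, LinearMap.comp_apply, extend_el]
  by_cases h : A ⊆ Set.range u ∧ Disjoint B (Set.range u)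
  · rw [b.blockOp_el u (incl ((Set.range u \ A) ∪ B)) h.1 h.2 (range_incl _), extend_el,
      b.blockOp_el _ ((incl ((Set.range u \ A) ∪ B)).trans j), b.op_trans]
    · rw [range_trans]
      exact Set.image_mono h.1
    · rw [range_trans, Set.disjoint_image_iff j.injective]
      exact h.2
    · rw [range_trans, range_trans, range_incl, Set.image_union, Set.image_sdiff j.injective]
  · rw [b.blockOp_el_zero u h, map_zero, b.blockOp_el_zero]
    rwa [range_trans, Set.disjoint_image_iff j.injective, Set.image_subset_image_iff j.injective]

/-- The product of the operations attached to the blocks `Q ∈ P`, with source part `Q ∩ X` and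
target part `Q ∩ V`. -/
def blockProd {S : FB.{u}} (X V : Set S) (P : Finset (Set S)) :
    Module.End k ((Sym k ⊗ₛ M).obj S) :=
  commProd P fun Q => b.blockOp (Q ∩ X) (Q ∩ V)

variable {A V : Set S} {P : Finset (Set S)}

theorem blockOp_pairwise (hAV : Disjoint A V) (hP : (P : Set (Set S)).PairwiseDisjoint id) :
    (P : Set (Set S)).Pairwise
      (Function.onFun Commute fun Q => b.blockOp (Q ∩ A) (Q ∩ V)) := by
  intro Q hQ Q' hQ' hne
  have h : Disjoint Q Q' := hP hQ hQ' hne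
  have h' : Disjoint (Q ∩ A) (Q ∩ V) := hAV.mono Set.inter_subset_right Set.inter_subset_right
  have h'' : Disjoint (Q' ∩ A) (Q' ∩ V) := hAV.mono Set.inter_subset_right Set.inter_subset_right
  exact b.blockOp_commute h' (h.mono Set.inter_subset_left Set.inter_subset_left)
    (h.mono Set.inter_subset_left Set.inter_subset_left)
    (h.mono Set.inter_subset_left Set.inter_subset_left)
    (h.mono Set.inter_subset_left Set.inter_subset_left) h''

/-- Only the summand that contains the result is recorded: it decides whether a further block may be
applied. -/
theorem exists_blockProd_el (hAV : Disjoint A V) (hP : (P : Set (Set S)).PairwiseDisjoint id)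
    (u : X ↪ S) (x : M.obj X) :
    ∃ y, b.blockProd A V P (el u x) =
      el (incl ((Set.range u \ (⋃₀ P ∩ A)) ∪ (⋃₀ P ∩ V))) y := by
  classical
  induction P using Finset.induction_on with
  | empty =>
    rw [blockProd, commProd_empty]
    exact el_congr_range u _ (by rw [range_incl]; simp) x
  | insert Q P hQ ih =>
    obtain ⟨y, hy⟩ := ih (hP.subset (by simp))
    rw [blockProd, commProd_insert hQ (b.blockOp_pairwise hAV hP), ← blockProd, Module.End.mul_apply,
      hy]
    obtain ⟨y', hy'⟩ := b.exists_blockOp_el (Q ∩ A) (Q ∩ V)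
      (incl ((Set.range u \ (⋃₀ P ∩ A)) ∪ (⋃₀ P ∩ V))) y
    rw [hy']
    refine el_congr_range _ _ ?_ y'
    rw [range_incl, range_incl, range_incl, Finset.coe_insert, Set.sUnion_insert]
    rw [Set.disjoint_left] at hAV
    generalize ⋃₀ (P : Set (Set S)) = R
    grind

/-- Induction on P: each block meets C, so it merges with the block already obtained from C → D and
the other members of P. -/
theorem blockOp_merge_prod {C D : Set S} (hAV : Disjoint A V)
    (hP : (P : Set (Set S)).PairwiseDisjoint id) (hC : C ⊆ V) (hDA : Disjoint D A)
    (hDV : Disjoint D V) (hDP : Disjoint D (⋃₀ P)) (hPC : ∀ Q ∈ P, (Q ∩ C).Nonempty)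
    (u : X ↪ S) (hu : Disjoint (Set.range u) (V ∩ ⋃₀ P)) (x : M.obj X) :
    b.blockOp C D (b.blockProd A V P (el u x)) =
      b.blockOp ((⋃₀ P ∩ A) ∪ (C \ ⋃₀ P)) (D ∪ ((⋃₀ P ∩ V) \ C)) (el u x) := by
  classical
  induction P using Finset.induction_on generalizing X u x with
  | empty => simp [blockProd]
  | insert Q P hQ ih =>
    have hQP : Disjoint Q (⋃₀ P) := by
      rw [Set.disjoint_sUnion_right]
      intro Q' hQ'
      exact hP (by simp) (by simp [hQ']) (by rintro rfl; exact hQ hQ')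
    rw [Finset.coe_insert, Set.sUnion_insert] at hu hDP ⊢
    -- Q is placed on the right so that it acts before P. The merged block of P and C → D still has
    -- Q ∩ C among its sources, because Q is disjoint from the members of P.
    rw [blockProd, commProd_insert' hQ (b.blockOp_pairwise hAV hP), ← blockProd,
      Module.End.mul_apply]
    obtain ⟨y, hy⟩ := b.exists_blockOp_el (Q ∩ A) (Q ∩ V) u x
    have hQC := hPC Q (by simp)
    rw [hy, ih (hP.subset (by simp)) (hDP.mono_right Set.subset_union_right)
      (fun Q' hQ' => hPC Q' (by simp [hQ'])), ← hy, b.blockOp_merge]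
    · congr 1
      congr 1
      · generalize ⋃₀ (P : Set (Set S)) = R at *
        simp only [Set.disjoint_left] at *
        grind
      · generalize ⋃₀ (P : Set (Set S)) = R at *
        simp only [Set.disjoint_left] at *
        grind
    · generalize ⋃₀ (P : Set (Set S)) = R at *
      simp only [Set.disjoint_left] at *
      grind
    · generalize ⋃₀ (P : Set (Set S)) = R at *
      simp only [Set.disjoint_left] at *
      grind
    · obtain ⟨s, hsQ, hsC⟩ := hQC
      exact ⟨s, ⟨hsQ, hC hsC⟩, .inr ⟨hsC, Set.disjoint_left.1 hQP hsQ⟩⟩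
    · generalize ⋃₀ (P : Set (Set S)) = R at *
      simp only [Set.disjoint_left] at *
      grind
    · generalize ⋃₀ (P : Set (Set S)) = R at *
      simp only [Set.disjoint_left] at *
      grind
    · rw [range_incl]
      generalize ⋃₀ (P : Set (Set S)) = R at *
      simp only [Set.disjoint_left] at *
      grind

open scoped Classical in
/-- Composition of a product of blocks with one more block `C → D`: the blocks meeting `C` are
merged. -/
theorem blockOp_blockProd {C D : Set S} (hAV : Disjoint A V)
    (hP : (P : Set (Set S)).PairwiseDisjoint id) (hC : C ⊆ V) (hCP : C ⊆ ⋃₀ P)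
    (hDA : Disjoint D A) (hDV : Disjoint D V) (hDP : Disjoint D (⋃₀ P))
    (hCD : (C ∪ D).Nonempty) (u : X ↪ S) (hu : Disjoint (Set.range u) V) (x : M.obj X) :
    b.blockOp C D (b.blockProd A V P (el u x)) =
      b.blockProd A ((V \ C) ∪ D)
        (insert (D ∪ ⋃₀ (P.filter (¬ Disjoint · C) : Finset (Set S)))
          (P.filter (Disjoint · C))) (el u x) := by
  -- The blocks in P₁ miss C and can act first, unchanged; those in P₂ meet C and are merged with
  -- it.
  set P₁ := P.filter (Disjoint · C) with hP₁
  set P₂ := P.filter (¬ Disjoint · C) with hP₂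
  have hsub₁ : (P₁ : Set (Set S)) ⊆ P := fun Q hQ => (Finset.mem_filter.1 hQ).1
  have hsub₂ : (P₂ : Set (Set S)) ⊆ P := fun Q hQ => (Finset.mem_filter.1 hQ).1
  have h12 : P = P₂ ∪ P₁ := by
    rw [hP₁, hP₂, Finset.union_comm, Finset.filter_union_filter_not_eq]
  have hd : Disjoint P₂ P₁ := (Finset.disjoint_filter_filter_not _ _ _).symm
  have hR : ⋃₀ (P : Set (Set S)) = ⋃₀ P₂ ∪ ⋃₀ P₁ := by
    rw [← Set.sUnion_union, ← Finset.coe_union, ← h12]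
  have hR12 : Disjoint (⋃₀ (P₂ : Set (Set S))) (⋃₀ P₁) := by
    rw [Set.disjoint_sUnion_left]
    intro Q hQ
    rw [Set.disjoint_sUnion_right]
    intro Q' hQ'
    refine hP (hsub₂ hQ) (hsub₁ hQ') ?_
    rintro rfl
    exact Finset.disjoint_left.1 hd hQ hQ'
  have hC₁ : Disjoint (⋃₀ (P₁ : Set (Set S))) C := by
    rw [Set.disjoint_sUnion_left]
    intro Q hQ
    exact (Finset.mem_filter.1 hQ).2
  have hQ₀ : Disjoint (D ∪ ⋃₀ (P₂ : Set (Set S))) (⋃₀ P₁) := by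
    rw [Set.disjoint_union_left]
    exact ⟨hDP.mono_right (hR ▸ Set.subset_union_right), hR12⟩
  -- The new block is disjoint from the members of P₁; being nonempty, it is not one of them, so the
  -- insertion adds a genuine factor.
  have hne : (D ∪ ⋃₀ (P₂ : Set (Set S))).Nonempty := by
    obtain ⟨s, hs | hs⟩ := hCD
    · have := hCP hs
      rw [hR] at this
      exact ⟨s, .inr (this.resolve_right fun h => Set.disjoint_left.1 hC₁ h hs)⟩
    · exact ⟨s, .inl hs⟩
  have hQ₀P : D ∪ ⋃₀ (P₂ : Set (Set S)) ∉ P₁ := by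
    intro h
    obtain ⟨s, hs⟩ := hne
    exact Set.disjoint_left.1 hQ₀ hs ⟨_, h, hs⟩
  have hA' : Disjoint A ((V \ C) ∪ D) := by
    rw [Set.disjoint_union_right]
    exact ⟨hAV.mono_right Set.sdiff_subset, hDA.symm⟩
  have hP' : ((insert (D ∪ ⋃₀ (P₂ : Set (Set S))) P₁ : Finset (Set S)) :
      Set (Set S)).PairwiseDisjoint id := by
    rw [Finset.coe_insert]
    refine (hP.subset hsub₁).insert fun Q hQ _ => hQ₀.mono_right ?_
    exact Set.subset_sUnion_of_mem hQ
  rw [blockProd, blockProd, commProd_insert hQ₀P (b.blockOp_pairwise hA' hP')]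
  nth_rewrite 1 [h12]
  rw [commProd_union hd (h12 ▸ b.blockOp_pairwise hAV hP), Module.End.mul_apply,
    Module.End.mul_apply]
  have hcongr : commProd P₁ (fun Q => b.blockOp (Q ∩ A) (Q ∩ V)) =
      commProd P₁ (fun Q => b.blockOp (Q ∩ A) (Q ∩ ((V \ C) ∪ D))) := by
    refine commProd_congr fun Q hQ => ?_
    have h1 : Disjoint Q C := hC₁.mono_left (Set.subset_sUnion_of_mem hQ)
    have h2 : Disjoint D Q := hDP.mono_right (Set.subset_sUnion_of_mem (hsub₁ hQ))
    congr 1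
    rw [Set.disjoint_left] at h1 h2
    grind
  rw [← hcongr]
  obtain ⟨y, hy⟩ := b.exists_blockProd_el hAV (hP.subset hsub₁) u x
  rw [blockProd] at hy
  rw [hy]
  refine (b.blockOp_merge_prod hAV (hP.subset hsub₂) hC hDA hDV
    (hDP.mono_right (hR ▸ Set.subset_union_left)) ?_ _ ?_ y).trans ?_
  · intro Q hQ
    exact Set.not_disjoint_iff_nonempty_inter.1 (Finset.mem_filter.1 hQ).2
  · rw [range_incl]
    clear hP₁ hP₂ hcongr hy hP' hne
    generalize ⋃₀ (P : Set (Set S)) = R at *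
    generalize ⋃₀ (P₁ : Set (Set S)) = R₁ at *
    generalize ⋃₀ (P₂ : Set (Set S)) = R₂ at *
    simp only [Set.disjoint_left] at *
    grind
  · have hC₂ : C ⊆ ⋃₀ (P₂ : Set (Set S)) := by
      intro s hs
      have := hCP hs
      rw [hR] at this
      exact this.resolve_right fun h => Set.disjoint_left.1 hC₁ h hs
    congr 2
    · clear hP₁ hP₂ hcongr hy hP' hne
      generalize ⋃₀ (P₂ : Set (Set S)) = R₂ at *
      simp only [Set.disjoint_left] at *
      grind
    · clear hP₁ hP₂ hcongr hy hP' hne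
      generalize ⋃₀ (P₂ : Set (Set S)) = R₂ at *
      simp only [Set.disjoint_left] at *
      grind

theorem commProd_extend {ι : Type*} (j : S ↪ S') (s : Finset ι) (A B : ι → Set S)
    (h : (s : Set ι).Pairwise (Function.onFun Commute fun i => b.blockOp (A i) (B i)))
    (h' : (s : Set ι).Pairwise (Function.onFun Commute fun i => b.blockOp (j '' A i) (j '' B i)))
    (z : (Sym k ⊗ₛ M).obj S) :
    commProd s (fun i => b.blockOp (j '' A i) (j '' B i)) (extend j z) =
      extend j (commProd s (fun i => b.blockOp (A i) (B i)) z) := by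
  classical
  induction s using Finset.induction_on with
  | empty => simp
  | insert i s hi ih =>
    rw [commProd_insert hi h, commProd_insert hi h', Module.End.mul_apply, Module.End.mul_apply,
      ih (h.mono (by simp)) (h'.mono (by simp)), blockOp_extend]

end BlockAction

end Species

/-! ### The classes of a partition as a finite set of subsets. -/

namespace PartitionDiagram

open PartitionCat (blockSetoid)

section parts

variable {T T' : Type u}

theorem setOf_eq_iff {g : Setoid T} {x y : T} : {z | g x z} = {z | g y z} ↔ g x y := by
  constructor
  · intro h
    have : y ∈ {z | g y z} := g.refl' y
    rwa [← h] at this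
  · intro h
    ext z
    exact ⟨fun h' => g.trans' (g.symm' h) h', fun h' => g.trans' h h'⟩

theorem le_blockSetoid_univ (g : Setoid T) : g ≤ blockSetoid Set.univ :=
  fun _ _ _ => .inr ⟨trivial, trivial⟩

theorem blockSetoid_mono {A B : Set T} (h : A ⊆ B) : blockSetoid A ≤ blockSetoid B := by
  rintro x y (rfl | ⟨hx, hy⟩)
  · exact .inl rfl
  · exact .inr ⟨h hx, h hy⟩

theorem sup_blockSetoid {g : Setoid T} {K : Set T} {x y : T} :
    (g ⊔ blockSetoid K) x y ↔ g x y ∨ (∃ a ∈ K, g x a) ∧ ∃ a ∈ K, g y a := by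
  constructor
  · intro h
    by_cases hx : ∃ a ∈ K, g x a
    · by_cases hy : ∃ a ∈ K, g y a
      · exact .inr ⟨hx, hy⟩
      · push Not at hy
        exact .inl (g.symm' (sup_avoid (fun _ _ h => h) hy ((g ⊔ blockSetoid K).symm' h)))
    · push Not at hx
      exact .inl (sup_avoid (fun _ _ h => h) hx h)
  · rintro (h | ⟨⟨a, ha, h⟩, c, hc, h'⟩)
    · exact (le_sup_left : g ≤ g ⊔ blockSetoid K) h
    · refine (g ⊔ blockSetoid K).trans' ((le_sup_left : g ≤ g ⊔ blockSetoid K) h)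
        ((g ⊔ blockSetoid K).trans' ((le_sup_right : blockSetoid K ≤ g ⊔ blockSetoid K)
          (.inr ⟨ha, hc⟩)) ((le_sup_left : g ≤ g ⊔ blockSetoid K) (g.symm' h')))

variable [Finite T]

open scoped Classical in
/-- The finite set of the classes of `g` that meet `W`. -/
def parts (g : Setoid T) (W : Set T) : Finset (Set T) :=
  (Set.toFinite {Q : Set T | ∃ x ∈ W, Q = {y | g x y}}).toFinset

theorem mem_parts {g : Setoid T} {W Q : Set T} : Q ∈ parts g W ↔ ∃ x ∈ W, Q = {y | g x y} := by
  simp [parts]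

theorem eq_of_mem_parts {g : Setoid T} {W Q : Set T} (hQ : Q ∈ parts g W) {x : T} (hx : x ∈ Q) :
    Q = {y | g x y} := by
  obtain ⟨y, -, rfl⟩ := mem_parts.1 hQ
  exact setOf_eq_iff.2 hx

theorem parts_nonempty {g : Setoid T} {W Q : Set T} (hQ : Q ∈ parts g W) : Q.Nonempty := by
  obtain ⟨y, -, rfl⟩ := mem_parts.1 hQ
  exact ⟨y, g.refl' y⟩

theorem parts_pairwiseDisjoint (g : Setoid T) (W : Set T) :
    (parts g W : Set (Set T)).PairwiseDisjoint id := by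
  intro Q hQ Q' hQ' hne
  refine Set.disjoint_left.2 fun x hx hx' => hne ?_
  rw [eq_of_mem_parts hQ hx, eq_of_mem_parts hQ' hx']

theorem sUnion_parts {g : Setoid T} {W : Set T} (h : g ≤ blockSetoid W) :
    ⋃₀ (parts g W : Set (Set T)) = W := by
  ext x
  simp only [Set.mem_sUnion, Finset.mem_coe]
  constructor
  · rintro ⟨Q, hQ, hx⟩
    obtain ⟨y, hy, rfl⟩ := mem_parts.1 hQ
    rcases h hx with rfl | ⟨-, h⟩
    · exact hy
    · exact h
  · exact fun hx => ⟨_, mem_parts.2 ⟨x, hx, rfl⟩, g.refl' x⟩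

open scoped Classical in
/-- The classes of the join with a block `C ∪ D`, where `D` consists of new points. -/
theorem parts_sup_blockSetoid {g : Setoid T} {W C D : Set T} (hg : g ≤ blockSetoid W)
    (hC : C ⊆ W) (hD : Disjoint D W) (hCD : (C ∪ D).Nonempty) :
    parts (g ⊔ blockSetoid (C ∪ D)) (W ∪ D) =
      insert (D ∪ ⋃₀ ((parts g W).filter (¬ Disjoint · C) : Finset (Set T)))
        ((parts g W).filter (Disjoint · C)) := by
  -- Points of D lie outside the support W of g, hence are singletons for g.
  have hD' : ∀ {x d}, d ∈ D → g x d → x = d := by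
    intro x d hd h
    rcases hg h with h | ⟨-, h⟩
    · exact h
    · exact absurd h (Set.disjoint_left.1 hD hd)
  have hmeet : ∀ x, (∃ a ∈ C ∪ D, g x a) ↔ x ∈ D ∨ ∃ a ∈ C, g x a := by
    intro x
    constructor
    · rintro ⟨a, ha | ha, h⟩
      · exact .inr ⟨a, ha, h⟩
      · exact .inl (hD' ha h ▸ ha)
    · rintro (h | ⟨a, ha, h⟩)
      · exact ⟨x, .inr h, g.refl' x⟩
      · exact ⟨a, .inl ha, h⟩
  have hbig : D ∪ ⋃₀ ((parts g W).filter (¬ Disjoint · C) : Finset (Set T)) =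
      {x | ∃ a ∈ C ∪ D, g x a} := by
    ext x
    rw [Set.mem_ofPred_eq, hmeet]
    simp only [Set.mem_union, Set.mem_sUnion, Finset.mem_coe, Finset.mem_filter]
    refine or_congr_right ⟨?_, ?_⟩
    · rintro ⟨Q, ⟨hQ, hQC⟩, hx⟩
      obtain ⟨a, haQ, haC⟩ := Set.not_disjoint_iff.1 hQC
      rw [eq_of_mem_parts hQ hx] at haQ
      exact ⟨a, haC, haQ⟩
    · rintro ⟨a, ha, h⟩
      exact ⟨{y | g a y}, ⟨mem_parts.2 ⟨a, hC ha, rfl⟩,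
        Set.not_disjoint_iff.2 ⟨a, g.refl' a, ha⟩⟩, g.symm' h⟩
  rw [hbig]
  ext Q
  rw [Finset.mem_insert, Finset.mem_filter, mem_parts]
  constructor
  · rintro ⟨x, hx, rfl⟩
    by_cases h : ∃ a ∈ C ∪ D, g x a
    · refine .inl ?_
      ext y
      rw [Set.mem_ofPred_eq, sup_blockSetoid, Set.mem_ofPred_eq]
      constructor
      · rintro (h' | h')
        · obtain ⟨a, ha, h⟩ := h
          exact ⟨a, ha, g.trans' (g.symm' h') h⟩
        · exact h'.2
      · exact fun h' => .inr ⟨h, h'⟩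
    · have h1 : {y | (g ⊔ blockSetoid (C ∪ D)) x y} = {y | g x y} := by
        ext y
        rw [Set.mem_ofPred_eq, sup_blockSetoid, Set.mem_ofPred_eq]
        exact ⟨fun h' => h'.resolve_right fun h'' => h h''.1, .inl⟩
      rw [h1]
      refine .inr ⟨mem_parts.2 ⟨x, hx.resolve_right fun h' => h ⟨x, .inr h', g.refl' x⟩, rfl⟩, ?_⟩
      exact Set.disjoint_left.2 fun a ha haC => h ⟨a, .inl haC, ha⟩
  · rintro (rfl | ⟨hQ, hQC⟩)
    · obtain ⟨a, ha⟩ := hCD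
      refine ⟨a, ha.imp_left fun h => hC h, ?_⟩
      ext y
      rw [Set.mem_ofPred_eq, Set.mem_ofPred_eq, sup_blockSetoid]
      constructor
      · exact fun h => .inr ⟨⟨a, ha, g.refl' a⟩, h⟩
      · rintro (h | h)
        · exact ⟨a, ha, g.symm' h⟩
        · exact h.2
    · obtain ⟨x, hx, rfl⟩ := mem_parts.1 hQ
      refine ⟨x, .inl hx, ?_⟩
      ext y
      rw [Set.mem_ofPred_eq, Set.mem_ofPred_eq, sup_blockSetoid]
      refine ⟨.inl, fun h => h.resolve_right fun h' => ?_⟩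
      rcases (hmeet x).1 h'.1 with h | ⟨a, ha, h⟩
      · exact Set.disjoint_left.1 hD h hx
      · exact Set.disjoint_left.1 hQC h ha

open scoped Classical in
theorem parts_map [Finite T'] {i : T' → T} (hi : i.Injective) (g : Setoid T') :
    parts (g.map i) (Set.range i) = (parts g Set.univ).image (i '' ·) := by
  have key : ∀ x, {y | (g.map i) (i x) y} = i '' {y | g x y} := by
    intro x
    ext y
    rw [Set.mem_ofPred_eq, map_rel hi]
    constructor
    · rintro (rfl | ⟨a, c, h, h1, rfl⟩)
      · exact ⟨x, g.refl' x, rfl⟩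
      · exact ⟨c, hi h1 ▸ h, rfl⟩
    · rintro ⟨c, h, rfl⟩
      exact .inr ⟨x, c, h, rfl, rfl⟩
  ext Q
  rw [mem_parts, Finset.mem_image]
  constructor
  · rintro ⟨_, ⟨x, rfl⟩, rfl⟩
    exact ⟨_, mem_parts.2 ⟨x, trivial, rfl⟩, (key x).symm⟩
  · rintro ⟨_, hQ, rfl⟩
    obtain ⟨x, -, rfl⟩ := mem_parts.1 hQ
    exact ⟨_, ⟨x, rfl⟩, (key x).symm⟩

open scoped Classical in
theorem parts_comap [Finite T'] {j : T' → T} (g : Setoid T) :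
    parts (g.comap j) Set.univ = (parts g (Set.range j)).image (j ⁻¹' ·) := by
  ext Q
  rw [mem_parts, Finset.mem_image]
  constructor
  · rintro ⟨x, -, rfl⟩
    exact ⟨_, mem_parts.2 ⟨j x, ⟨x, rfl⟩, rfl⟩, rfl⟩
  · rintro ⟨_, hQ, rfl⟩
    obtain ⟨_, ⟨x, rfl⟩, rfl⟩ := mem_parts.1 hQ
    exact ⟨x, trivial, rfl⟩

theorem preimage_injOn_parts (j : T' → T) (g : Setoid T) :
    Set.InjOn (j ⁻¹' ·) (parts g (Set.range j) : Set (Set T)) := by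
  rintro Q hQ Q' hQ' h
  obtain ⟨_, ⟨x, rfl⟩, rfl⟩ := mem_parts.1 hQ
  have h1 : x ∈ j ⁻¹' {y | g (j x) y} := g.refl' (j x)
  have : x ∈ j ⁻¹' Q' := (congrArg (x ∈ ·) h).mp h1
  exact (eq_of_mem_parts hQ' this).symm

open scoped Classical in
theorem parts_univ_eq (g : Setoid T) (K : Set T) :
    parts g Set.univ = parts g K ∪ (parts g Set.univ).filter (Disjoint · K) := by
  ext Q
  rw [Finset.mem_union, Finset.mem_filter]
  constructor
  · intro hQ
    by_cases h : Disjoint Q K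
    · exact .inr ⟨hQ, h⟩
    · obtain ⟨x, hx, hxK⟩ := Set.not_disjoint_iff.1 h
      exact .inl (mem_parts.2 ⟨x, hxK, eq_of_mem_parts hQ hx⟩)
  · rintro (h | h)
    · obtain ⟨x, -, rfl⟩ := mem_parts.1 h
      exact mem_parts.2 ⟨x, trivial, rfl⟩
    · exact h.1

open scoped Classical in
-- Sending a point to its class, as a subset, is a map with kernel g, so `countAvoiding_eq` applies.
-- This converts a number of factors δ into a number of loops.
theorem card_filter_parts (g : Setoid T) (K : Set T) :
    ((parts g Set.univ).filter (Disjoint · K)).card = g.countAvoiding K := by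
  rw [countAvoiding_eq g K (fun x => {y | g x y}) fun x y => setOf_eq_iff, ← Set.ncard_coe_finset]
  congr 1
  ext Q
  rw [Finset.mem_coe, Finset.mem_filter]
  constructor
  · rintro ⟨hQ, hQK⟩
    obtain ⟨x, -, rfl⟩ := mem_parts.1 hQ
    refine ⟨⟨x, rfl⟩, ?_⟩
    rintro ⟨y, hy, h⟩
    have : y ∈ {y | g x y} := h ▸ g.refl' y
    exact Set.disjoint_left.1 hQK this hy
  · rintro ⟨⟨x, rfl⟩, h⟩
    refine ⟨mem_parts.2 ⟨x, trivial, rfl⟩, Set.disjoint_left.2 fun y hy hyK => ?_⟩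
    exact h ⟨y, hyK, setOf_eq_iff.2 (g.symm' hy)⟩

/-- A partition is the join of its blocks, which is what allows a diagram to be glued on block by
block. -/
theorem sup_parts (s : Setoid T) {i : T → T'} :
    (parts s Set.univ).sup (fun Q => blockSetoid (i '' Q)) = s.map i := by
  apply le_antisymm
  · refine Finset.sup_le fun Q hQ => ?_
    rintro _ _ (rfl | ⟨⟨x, hx, rfl⟩, y, hy, rfl⟩)
    · exact Setoid.refl' _ _
    · refine map_le_iff.1 le_rfl ?_
      rw [eq_of_mem_parts hQ hx] at hy
      exact hy
  · rw [map_le_iff]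
    intro x y h
    have hQ : {z | s x z} ∈ parts s Set.univ := mem_parts.2 ⟨x, trivial, rfl⟩
    exact Finset.le_sup (f := fun Q => blockSetoid (i '' Q)) hQ
      (.inr ⟨⟨x, s.refl' x, rfl⟩, y, h, rfl⟩)

end parts

end PartitionDiagram

/-! ### The action of a partition diagram and its compatibility with composition. -/

namespace Species

open PartitionDiagram
open PartitionCat (blockSetoid)

variable {k : Type u} [CommRing k] {M : Species k} {δ : k}

/-- The inclusion `X → X ⊔ Y`. -/
abbrev inlE (X Y : FB.{u}) : X ↪ X.sum Y := Function.Embedding.inl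

/-- The inclusion `Y → X ⊔ Y`. -/
abbrev inrE (X Y : FB.{u}) : Y ↪ X.sum Y := Function.Embedding.inr

namespace BlockAction

variable (b : BlockAction δ M) {X Y Z S S' : FB.{u}}

theorem disjoint_range (X Y : FB.{u}) :
    Disjoint (Set.range (inlE X Y)) (Set.range (inrE X Y)) := by
  rw [Set.disjoint_left]
  rintro _ ⟨x, rfl⟩ ⟨y, hy⟩
  exact Sum.inr_ne_inl hy

theorem range_union (X Y : FB.{u}) : Set.range (inlE X Y) ∪ Set.range (inrE X Y) = Set.univ :=
  Set.range_inl_union_range_inr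

/-- The action of a partition diagram. -/
def diagram (r : Setoid (X ⊕ Y)) : M.obj X →ₗ[k] M.obj Y :=
  cf (inrE X Y) ∘ₗ b.blockProd (S := X.sum Y) (Set.range (inlE X Y)) (Set.range (inrE X Y))
    (parts r Set.univ) ∘ₗ el (inlE X Y)

/-- The parts cover X ⊔ Y, so the product consumes all of X and creates all of Y. The result lies in
the one summand M(Y), and taking its coefficient loses nothing. -/
theorem el_diagram (r : Setoid (X ⊕ Y)) (x : M.obj X) :
    b.blockProd (S := X.sum Y) (Set.range (inlE X Y)) (Set.range (inrE X Y))
      (parts r Set.univ) (el (inlE X Y) x) = el (inrE X Y) (b.diagram r x) := by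
  obtain ⟨y, hy⟩ := b.exists_blockProd_el (disjoint_range X Y)
    (parts_pairwiseDisjoint r Set.univ) (inlE X Y) x
  obtain ⟨y', hy'⟩ := el_congr_range (S := X.sum Y) (incl ((Set.range (inlE X Y) \
    (⋃₀ (parts r Set.univ : Set (Set (X ⊕ Y))) ∩ Set.range (inlE X Y))) ∪
    (⋃₀ (parts r Set.univ : Set (Set (X ⊕ Y))) ∩ Set.range (inrE X Y)))) (inrE X Y)
    (by rw [sUnion_parts (le_blockSetoid_univ r), range_incl]; simp) y
  rw [diagram, LinearMap.comp_apply, LinearMap.comp_apply, hy, hy', cf_el_self]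

theorem blockOp_pairwise_image (j : S ↪ S') {A V : Set S} {P : Finset (Set S)}
    (hAV : Disjoint A V) (hP : (P : Set (Set S)).PairwiseDisjoint id) :
    (P : Set (Set S)).Pairwise
      (Function.onFun Commute fun Q => b.blockOp (j '' (Q ∩ A)) (j '' (Q ∩ V))) := by
  intro Q hQ Q' hQ' hne
  have h : Disjoint Q Q' := hP hQ hQ' hne
  apply b.blockOp_commute <;> rw [Set.disjoint_image_iff j.injective]
  · exact hAV.mono Set.inter_subset_right Set.inter_subset_right
  · exact h.mono Set.inter_subset_left Set.inter_subset_left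
  · exact h.mono Set.inter_subset_left Set.inter_subset_left
  · exact h.mono Set.inter_subset_left Set.inter_subset_left
  · exact h.mono Set.inter_subset_left Set.inter_subset_left
  · exact hAV.mono Set.inter_subset_right Set.inter_subset_right

/-- The same product inside a larger set. It is needed for the inclusions of X ⊔ Y, Y ⊔ Z and X ⊔ Z
in X ⊔ Y ⊔ Z. -/
theorem el_diagram_extend (r : Setoid (X ⊕ Y)) (j : X.sum Y ↪ S) (x : M.obj X) :
    commProd (parts r Set.univ) (fun Q => b.blockOp (j '' (Q ∩ Set.range (inlE X Y)))
      (j '' (Q ∩ Set.range (inrE X Y)))) (el ((inlE X Y).trans j) x) =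
      el ((inrE X Y).trans j) (b.diagram r x) := by
  have h := b.blockOp_pairwise (disjoint_range X Y) (parts_pairwiseDisjoint r Set.univ)
  rw [← extend_el, b.commProd_extend j _ _ _ h, ← extend_el, ← el_diagram]
  · rfl
  · exact b.blockOp_pairwise_image j (disjoint_range X Y) (parts_pairwiseDisjoint r Set.univ)

section comp

variable (X Y Z)

/-- The inclusion of `X ⊔ Y` in `X ⊔ Y ⊔ Z`. -/
def leftE : X.sum Y ↪ X.sum (Y.sum Z) :=
  ⟨Sum.map id Sum.inl, Sum.map_injective.2 ⟨Function.injective_id, Sum.inl_injective⟩⟩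

/-- The inclusion of `X ⊔ Z` in `X ⊔ Y ⊔ Z`. -/
def outerE : X.sum Z ↪ X.sum (Y.sum Z) := ⟨outer, outer_injective⟩

variable {X Y Z} (r : Setoid (X ⊕ Y)) (s : Setoid (Y ⊕ Z))

/-- The equivalence relation generated by `r` and some of the parts of `s`. -/
def partialGlue (P : Finset (Set (Y ⊕ Z))) : Setoid (X ⊕ (Y ⊕ Z)) :=
  P.sup (fun Q => blockSetoid (Sum.inr '' Q)) ⊔ r.map (leftE X Y Z)

theorem partialGlue_parts : partialGlue r (parts s Set.univ) = glue r s := by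
  rw [partialGlue, sup_parts, sup_comm]
  rfl

theorem partialGlue_le (P : Finset (Set (Y ⊕ Z))) :
    partialGlue r P ≤ blockSetoid (Set.range (leftE X Y Z) ∪ Sum.inr '' ⋃₀ (P : Set (Set (Y ⊕ Z)))) := by
  refine sup_le (Finset.sup_le fun Q hQ => blockSetoid_mono ?_) ?_
  · exact (Set.image_mono (Set.subset_sUnion_of_mem hQ)).trans Set.subset_union_right
  · rw [map_le_iff]
    exact fun x y _ => .inr ⟨.inl ⟨x, rfl⟩, .inl ⟨y, rfl⟩⟩

/-- After r and the parts in P have acted, the occupied points are those of Y outside ⋃ P and those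
of Z inside ⋃ P. A further part Q acts as the block Q ∩ Y → Q ∩ Z. By `blockOp_blockProd` it merges
the blocks that it meets, and by `parts_sup_blockSetoid` the classes of the glued relation change in
the same way. -/
theorem blockProd_partialGlue (P : Finset (Set (Y ⊕ Z))) (hP : P ⊆ parts s Set.univ)
    (x : M.obj X) :
    b.blockProd (S := X.sum (Y.sum Z)) (Set.range (inlE X (Y.sum Z)))
      ((Set.range ((inlE Y Z).trans (inrE X (Y.sum Z))) \ Sum.inr '' ⋃₀ (P : Set (Set (Y ⊕ Z)))) ∪
        (Set.range ((inrE Y Z).trans (inrE X (Y.sum Z))) ∩ Sum.inr '' ⋃₀ (P : Set (Set (Y ⊕ Z)))))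
      (parts (partialGlue r P)
        (Set.range (leftE X Y Z) ∪ Sum.inr '' ⋃₀ (P : Set (Set (Y ⊕ Z)))))
      (el (inlE X (Y.sum Z)) x) =
    commProd P (fun Q => b.blockOp (S := X.sum (Y.sum Z))
      (inrE X (Y.sum Z) '' (Q ∩ Set.range (inlE Y Z)))
      (inrE X (Y.sum Z) '' (Q ∩ Set.range (inrE Y Z))))
      (el ((inlE Y Z).trans (inrE X (Y.sum Z))) (b.diagram r x)) := by
  classical
  induction P using Finset.induction_on with
  | empty =>
    have h1 : partialGlue r (∅ : Finset (Set (Y ⊕ Z))) = r.map (leftE X Y Z) := by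
      rw [partialGlue, Finset.sup_empty, bot_sup_eq]
    rw [h1, Finset.coe_empty, Set.sUnion_empty, Set.image_empty, Set.sdiff_empty, Set.inter_empty,
      Set.union_empty, Set.union_empty, commProd_empty, parts_map (leftE X Y Z).injective]
    refine Eq.trans ?_ (b.el_diagram_extend r (leftE X Y Z) x)
    rw [blockProd, commProd_image]
    · refine congrArg (fun f : Module.End k _ => f (el (inlE X (Y.sum Z)) x)) (commProd_congr fun Q hQ => ?_)
      have e1 : Set.range (inlE X (Y.sum Z)) = leftE X Y Z '' Set.range (inlE X Y) := by
        rw [← range_trans]; rfl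
      have e2 : Set.range ((inlE Y Z).trans (inrE X (Y.sum Z))) =
          leftE X Y Z '' Set.range (inrE X Y) := by
        rw [← range_trans]; rfl
      rw [Function.comp_apply, e1, e2, ← Set.image_inter (leftE X Y Z).injective,
        ← Set.image_inter (leftE X Y Z).injective]
    · exact (leftE X Y Z).injective.image_injective.injOn
    · refine b.blockOp_pairwise ?_ ?_
      · rw [Set.disjoint_left]
        rintro _ ⟨x, rfl⟩ ⟨y, hy⟩
        exact Sum.inr_ne_inl hy
      · rw [← parts_map (leftE X Y Z).injective]
        exact parts_pairwiseDisjoint _ _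
  | insert Q P hQ ih =>
    have hd := parts_pairwiseDisjoint s Set.univ
    have hQP : Disjoint Q (⋃₀ (P : Set (Set (Y ⊕ Z)))) := by
      rw [Set.disjoint_sUnion_right]
      intro Q' hQ'
      exact hd (hP (Finset.mem_insert_self _ _)) (hP (Finset.mem_insert_of_mem hQ'))
        (by rintro rfl; exact hQ hQ')
    have hpair : ((insert Q P : Finset (Set (Y ⊕ Z))) : Set (Set (Y ⊕ Z))).Pairwise
        (Function.onFun Commute fun Q => b.blockOp (S := X.sum (Y.sum Z))
          (inrE X (Y.sum Z) '' (Q ∩ Set.range (inlE Y Z)))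
          (inrE X (Y.sum Z) '' (Q ∩ Set.range (inrE Y Z)))) :=
      b.blockOp_pairwise_image _ (disjoint_range Y Z) (hd.subset (Finset.coe_subset.2 hP))
    rw [commProd_insert hQ hpair, Module.End.mul_apply, ← ih ((Finset.subset_insert _ _).trans hP)]
    set C : Set (X.sum (Y.sum Z)) := inrE X (Y.sum Z) '' (Q ∩ Set.range (inlE Y Z)) with hC
    set D : Set (X.sum (Y.sum Z)) := inrE X (Y.sum Z) '' (Q ∩ Set.range (inrE Y Z)) with hD
    have hCD : C ∪ D = Sum.inr '' Q := by
      rw [hC, hD, ← Set.image_union, ← Set.inter_union_distrib_left, range_union, Set.inter_univ]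
      rfl
    have hg : partialGlue r (insert Q P) = partialGlue r P ⊔ blockSetoid (C ∪ D) := by
      rw [partialGlue, Finset.sup_insert, hCD, partialGlue, sup_assoc, sup_comm]
    have hCne : (C ∪ D).Nonempty := by
      rw [hCD]
      exact (parts_nonempty (hP (Finset.mem_insert_self _ _))).image _
    have hDP : Disjoint D (Set.range (leftE X Y Z) ∪ Sum.inr '' ⋃₀ (P : Set (Set (Y ⊕ Z)))) := by
      rw [Set.disjoint_left]
      rintro _ ⟨_, ⟨hq, z, rfl⟩, rfl⟩ (⟨a, ha⟩ | ⟨a, ha, ha'⟩)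
      · rcases a with a | a
        · exact Sum.inl_ne_inr ha
        · exact Sum.inl_ne_inr (Sum.inr_injective ha)
      · obtain rfl := Sum.inr_injective ha'
        exact Set.disjoint_left.1 hQP hq ha
    have hCW : C ⊆ Set.range (leftE X Y Z) := by
      rintro _ ⟨_, ⟨-, z, rfl⟩, rfl⟩
      exact ⟨.inr z, rfl⟩
    have hW : Set.range (leftE X Y Z) ∪
        Sum.inr '' ⋃₀ ((insert Q P : Finset (Set (Y ⊕ Z))) : Set (Set (Y ⊕ Z))) =
        (Set.range (leftE X Y Z) ∪ Sum.inr '' ⋃₀ (P : Set (Set (Y ⊕ Z)))) ∪ D := by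
      rw [Finset.coe_insert, Set.sUnion_insert, Set.image_union, ← hCD]
      generalize Sum.inr '' ⋃₀ (P : Set (Set (Y ⊕ Z))) = R
      ext a
      have := @hCW a
      simp only [Set.mem_union]
      tauto
    have hV : Set.range ((inlE Y Z).trans (inrE X (Y.sum Z))) \ Sum.inr '' ⋃₀ (P : Set (Set (Y ⊕ Z)))
        ∪ Set.range ((inrE Y Z).trans (inrE X (Y.sum Z))) ∩ Sum.inr '' ⋃₀ (P : Set (Set (Y ⊕ Z))) ⊆
        Set.range (inrE X (Y.sum Z)) := by
      rintro _ (⟨⟨y, rfl⟩, -⟩ | ⟨⟨z, rfl⟩, -⟩) <;> exact ⟨_, rfl⟩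
    have hsU := sUnion_parts (partialGlue_le (X := X) (Y := Y) (Z := Z) r P)
    rw [b.blockOp_blockProd _ (parts_pairwiseDisjoint _ _) _ (by rw [hsU]; exact hCW.trans Set.subset_union_left)
      _ _ (by rw [hsU]; exact hDP) hCne, hg, hW, parts_sup_blockSetoid (partialGlue_le r P)
        (hCW.trans Set.subset_union_left) hDP hCne]
    · congr 2
      rw [Finset.coe_insert, Set.sUnion_insert, Set.image_union, ← hCD]
      have h1 : Disjoint (C ∪ D) (Sum.inr '' ⋃₀ (P : Set (Set (Y ⊕ Z)))) := by
        rw [hCD, Set.disjoint_image_iff Sum.inr_injective]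
        exact hQP
      have h2 : Disjoint (Set.range ((inlE Y Z).trans (inrE X (Y.sum Z)))) D := by
        rw [Set.disjoint_left]
        rintro _ ⟨y, rfl⟩ ⟨_, ⟨-, z, rfl⟩, h⟩
        exact Sum.inr_ne_inl (Sum.inr_injective h)
      have h3 : Disjoint (Set.range ((inrE Y Z).trans (inrE X (Y.sum Z)))) C := by
        rw [Set.disjoint_left]
        rintro _ ⟨y, rfl⟩ ⟨_, ⟨-, z, rfl⟩, h⟩
        exact Sum.inl_ne_inr (Sum.inr_injective h)
      have h4 : D ⊆ Set.range ((inrE Y Z).trans (inrE X (Y.sum Z))) := by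
        rintro _ ⟨_, ⟨-, z, rfl⟩, rfl⟩
        exact ⟨z, rfl⟩
      clear hV hpair hg hCne hW hsU hCD hDP hCW
      clear_value C D
      generalize Sum.inr '' ⋃₀ (P : Set (Set (Y ⊕ Z))) = R at *
      generalize Set.range ((inlE Y Z).trans (inrE X (Y.sum Z))) = Y' at *
      generalize Set.range ((inrE Y Z).trans (inrE X (Y.sum Z))) = Z' at *
      clear ih hP hQ hd hQP
      simp only [Set.disjoint_left] at *
      grind
    · exact (disjoint_range X (Y.sum Z)).mono_right hV
    · exact (disjoint_range X (Y.sum Z)).mono_right hV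
    · rintro _ ⟨q, ⟨hq, y, rfl⟩, rfl⟩
      refine .inl ⟨⟨y, rfl⟩, ?_⟩
      rintro ⟨a, ha, ha'⟩
      obtain rfl := Sum.inr_injective ha'
      exact Set.disjoint_left.1 hQP hq ha
    · refine ((disjoint_range X (Y.sum Z)).mono_right ?_).symm
      rintro _ ⟨q, -, rfl⟩
      exact ⟨q, rfl⟩
    · rw [Set.disjoint_left]
      rintro a ha (⟨⟨y, rfl⟩, -⟩ | ⟨-, h⟩)
      · obtain ⟨_, ⟨-, z, rfl⟩, h⟩ := ha
        exact Sum.inr_ne_inl (Sum.inr_injective h)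
      · exact Set.disjoint_left.1 hDP ha (.inr h)

/-- Once every part of s is glued on, the composite is the product over the classes of the joined
partition, with source part in X and target part in Z. Classes meeting X ⊔ Z give the composed
diagram; each of the others gives a factor δ. -/
theorem diagram_comp (x : M.obj X) :
    b.diagram s (b.diagram r x) = δ ^ loops r s • b.diagram (comp r s) x := by
  classical
  have h := b.blockProd_partialGlue r s (parts s Set.univ) subset_rfl x
  have h2 := b.el_diagram_extend s (inrE X (Y.sum Z)) (b.diagram r x)
  have h3 := b.el_diagram_extend (comp r s) (outerE X Y Z) x
  rw [h2, partialGlue_parts, sUnion_parts (le_blockSetoid_univ s)] at h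
  have e1 : Set.range (leftE X Y Z) ∪ Sum.inr '' (Set.univ : Set (Y ⊕ Z)) = Set.univ := by
    rw [Set.eq_univ_iff_forall]
    rintro (x | x)
    · exact .inl ⟨.inl x, rfl⟩
    · exact .inr ⟨x, trivial, rfl⟩
  have hXV : Disjoint (Set.range (inlE X (Y.sum Z)))
      (Set.range ((inrE Y Z).trans (inrE X (Y.sum Z)))) := by
    rw [Set.disjoint_left]
    rintro _ ⟨x, rfl⟩ ⟨y, hy⟩
    exact Sum.inr_ne_inl hy
  have e2 : Set.range ((inlE Y Z).trans (inrE X (Y.sum Z))) \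
      Sum.inr '' (Set.univ : Set (Y ⊕ Z)) ∪
      Set.range ((inrE Y Z).trans (inrE X (Y.sum Z))) ∩ Sum.inr '' (Set.univ : Set (Y ⊕ Z)) =
      Set.range ((inrE Y Z).trans (inrE X (Y.sum Z))) := by
    ext a
    constructor
    · rintro (⟨⟨y, rfl⟩, h⟩ | h)
      · exact absurd ⟨_, trivial, rfl⟩ h
      · exact h.1
    · rintro ⟨z, rfl⟩
      exact .inr ⟨⟨z, rfl⟩, _, trivial, rfl⟩
  -- The classes are separated according to whether they meet X ⊔ Z.
  rw [e1, e2, parts_univ_eq _ (Set.range (outerE X Y Z)), blockProd, commProd_union,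
    Module.End.mul_apply] at h
  -- A class contained in Y has empty source and target parts, so it acts as the empty block. The
  -- number of such classes is `loops r s`.
  · have h4 : commProd ((parts (glue r s) Set.univ).filter (Disjoint · (Set.range (outerE X Y Z))))
        (fun Q => b.blockOp (Q ∩ Set.range (inlE X (Y.sum Z)))
          (Q ∩ Set.range ((inrE Y Z).trans (inrE X (Y.sum Z))))) =
        δ ^ loops r s • (1 : Module.End k ((Sym k ⊗ₛ M).obj (X.sum (Y.sum Z)))) := by
      rw [commProd_congr (g := fun _ => δ • 1), commProd_const, card_filter_parts, smul_pow,
        one_pow]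
      · rfl
      · intro Q hQ
        have hQ' := (Finset.mem_filter.1 hQ).2
        have e3 : Q ∩ Set.range (inlE X (Y.sum Z)) = ∅ := by
          refine Set.disjoint_iff_inter_eq_empty.1 (hQ'.mono_right ?_)
          rintro _ ⟨x, rfl⟩
          exact ⟨.inl x, rfl⟩
        have e4 : Q ∩ Set.range ((inrE Y Z).trans (inrE X (Y.sum Z))) = ∅ := by
          refine Set.disjoint_iff_inter_eq_empty.1 (hQ'.mono_right ?_)
          rintro _ ⟨x, rfl⟩
          exact ⟨.inr x, rfl⟩
        rw [e3, e4, blockOp_empty]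
    have h5 : commProd (parts (glue r s) (Set.range (outerE X Y Z)))
        (fun Q => b.blockOp (Q ∩ Set.range (inlE X (Y.sum Z)))
          (Q ∩ Set.range ((inrE Y Z).trans (inrE X (Y.sum Z))))) (el (inlE X (Y.sum Z)) x) =
        el ((inrE Y Z).trans (inrE X (Y.sum Z))) (b.diagram (comp r s) x) := by
      refine Eq.trans ?_ h3
      -- The parts of the composed diagram are the traces on X ⊔ Z of the classes meeting it, and
      -- distinct classes have distinct traces.
      have e5 : parts (comp r s) Set.univ = (parts (glue r s) (Set.range (outerE X Y Z))).image
          (outerE X Y Z ⁻¹' ·) := parts_comap (T := X ⊕ (Y ⊕ Z)) (j := outerE X Y Z) (glue r s)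
      have hp := b.blockOp_pairwise_image (outerE X Y Z) (disjoint_range X Z)
        (parts_pairwiseDisjoint (comp r s) Set.univ)
      rw [e5] at hp ⊢
      rw [commProd_image (preimage_injOn_parts _ _) hp]
      refine congrArg (fun f : Module.End k _ => f (el (inlE X (Y.sum Z)) x))
        (commProd_congr fun Q hQ => ?_)
      have e6 : Set.range (inlE X (Y.sum Z)) = outerE X Y Z '' Set.range (inlE X Z) := by
        rw [← range_trans]; rfl
      have e7 : Set.range ((inrE Y Z).trans (inrE X (Y.sum Z))) =
          outerE X Y Z '' Set.range (inrE X Z) := by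
        rw [← range_trans]; rfl
      rw [Function.comp_apply, e6, e7, Set.image_preimage_inter, Set.image_preimage_inter]
    rw [h4, LinearMap.smul_apply, Module.End.one_apply] at h
    rw [map_smul, h5, ← map_smul] at h
    have h6 := congrArg (cf ((inrE Y Z).trans (inrE X (Y.sum Z)))) h
    rw [cf_el_self, cf_el_self] at h6
    exact h6.symm
  · refine Finset.disjoint_left.2 fun Q hQ hQ' => ?_
    obtain ⟨a, ha, rfl⟩ := mem_parts.1 hQ
    exact Set.disjoint_left.1 (Finset.mem_filter.1 hQ').2 ((glue r s).refl' a) ha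
  · rw [← parts_univ_eq]
    exact b.blockOp_pairwise hXV (parts_pairwiseDisjoint _ _)

end comp

end BlockAction

end Species

/-! ### Bijections and one-block diagrams act as expected. -/

namespace Species

open PartitionDiagram
open PartitionCat (blockSetoid)

variable {k : Type u} [CommRing k] {M : Species k} {δ : k}

namespace BlockAction

variable (b : BlockAction δ M) {X Y Z S S' : FB.{u}}

/-- The points of F are moved one at a time, each by `op_single`. Since every target lies outside
the image of w, a moved point never meets one that has still to move. -/
theorem commProd_move (w w' : X ↪ S) (F : Finset X) (h : ∀ x ∉ F, w' x = w x)
    (hF : ∀ x ∈ F, w' x ∉ Set.range w) (m : M.obj X) :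
    commProd F (fun x => b.blockOp {w x} {w' x}) (el w m) = el w' m := by
  classical
  induction F using Finset.induction_on generalizing w' with
  | empty =>
    rw [commProd_empty]
    obtain rfl : w' = w := Function.Embedding.ext fun x => h x (by simp)
    rfl
  | insert i F hi ih =>
    -- The intermediate position, where only the points of F have moved and i has not, is again an
    -- injection.
    have hinj : Function.Injective fun x => if x ∈ F then w' x else w x := by
      intro x y hxy
      by_cases hx : x ∈ F <;> by_cases hy : y ∈ F <;> simp only [hx, hy, if_true, if_false] at hxy
      · exact w'.injective hxy
      · exact absurd ⟨y, hxy.symm⟩ (hF x (by simp [hx]))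
      · exact absurd ⟨x, hxy⟩ (hF y (by simp [hy]))
      · exact w.injective hxy
    let w'' : X ↪ S := ⟨_, hinj⟩
    have h1 : ∀ x ∈ F, w'' x = w' x := fun x hx => if_pos hx
    have h2 : ∀ x ∉ F, w'' x = w x := fun x hx => if_neg hx
    have h3 : commProd F (fun x => b.blockOp {w x} {w' x}) =
        commProd F (fun x => b.blockOp {w x} {w'' x}) :=
      commProd_congr fun x hx => by rw [h1 x hx]
    rw [commProd_insert hi, Module.End.mul_apply, h3, ih w'' h2 (fun x hx => by
      rw [h1 x hx]; exact hF x (by simp [hx]))]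
    · have h4 : ∀ x, x ≠ i → w'' x = w' x := by
        intro x hx
        by_cases hxF : x ∈ F
        · exact h1 x hxF
        · rw [h2 x hxF, h x (by simp [hx, hxF])]
      have h5 : w'' i = w i := h2 i hi
      have h6 : w' i ∉ Set.range w'' := by
        rintro ⟨x, hx⟩
        by_cases hxi : x = i
        · subst hxi
          exact hF x (by simp) ⟨x, h5.symm.trans hx⟩
        · rw [h4 x hxi] at hx
          exact hxi (w'.injective hx)
      rw [b.blockOp_el w'' w', b.op_single w'' w' (Equiv.refl X) i (fun x hx => (h4 x hx).symm)
        (fun h => h6 ⟨i, h.symm⟩), map_refl]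
      · rw [← h5]
        exact Set.singleton_subset_iff.2 ⟨i, rfl⟩
      · exact Set.disjoint_singleton_left.2 h6
      · ext s
        simp only [Set.mem_union, Set.mem_sdiff, Set.mem_singleton_iff, Set.mem_range]
        constructor
        · rintro ⟨x, rfl⟩
          by_cases hxi : x = i
          · exact .inr (hxi ▸ rfl)
          · refine .inl ⟨⟨x, h4 x hxi⟩, ?_⟩
            rw [← h5, ← h4 x hxi]
            exact fun h => hxi (w''.injective h)
        · rintro (⟨⟨x, rfl⟩, h'⟩ | rfl)
          · refine ⟨x, (h4 x ?_).symm⟩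
            rintro rfl
            exact h' h5
          · exact ⟨i, rfl⟩
    · intro x hx y hy hxy
      have hx' := hF x hx
      have hy' := hF y hy
      apply b.blockOp_commute <;> rw [Set.disjoint_singleton]
      · exact fun h => hx' ⟨x, h⟩
      · exact w.injective.ne hxy
      · exact fun h => hy' ⟨x, h⟩
      · exact fun h => hx' ⟨y, h.symm⟩
      · exact w'.injective.ne hxy
      · exact fun h => hy' ⟨y, h⟩

/-- The action of the trivial blocks `{x, w x}`, with `x ∈ F`. -/
theorem blockProd_pairs (w : X ↪ X.sum Y) (F : Finset X) (h : ∀ x ∉ F, w x = .inl x)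
    (hF : ∀ x ∈ F, w x ∈ Set.range (inrE X Y)) {P : Finset (Set (X ⊕ Y))}
    (hP : ∀ Q, Q ∈ P ↔ ∃ x ∈ F, Q = {.inl x, w x}) (m : M.obj X) :
    b.blockProd (S := X.sum Y) (Set.range (inlE X Y)) (Set.range (inrE X Y)) P
      (el (inlE X Y) m) = el w m := by
  classical
  have hne : ∀ x ∈ F, ∀ y, w x ≠ .inl y := by
    intro x hx y hxy
    obtain ⟨z, hz⟩ := hF x hx
    exact Sum.inr_ne_inl (hz.trans hxy)
  have hinj : Set.InjOn (fun x => ({.inl x, w x} : Set (X ⊕ Y))) F := by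
    intro x hx y hy hxy
    have h1 : (.inl x : X ⊕ Y) ∈ ({.inl y, w y} : Set (X ⊕ Y)) :=
      (congrArg (Sum.inl x ∈ ·) hxy).mp (Set.mem_insert _ _)
    rcases h1 with h1 | h1
    · exact Sum.inl_injective h1
    · exact absurd h1.symm (hne y hy x)
  have hPF : P = F.image fun x => ({.inl x, w x} : Set (X ⊕ Y)) := by
    ext Q
    rw [hP, Finset.mem_image]
    exact ⟨fun ⟨x, hx, h⟩ => ⟨x, hx, h.symm⟩, fun ⟨x, hx, h⟩ => ⟨x, hx, h.symm⟩⟩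
  have hd : (P : Set (Set (X ⊕ Y))).PairwiseDisjoint id := by
    intro Q hQ Q' hQ' hQQ'
    obtain ⟨x, hx, rfl⟩ := (hP _).1 hQ
    obtain ⟨y, hy, rfl⟩ := (hP _).1 hQ'
    have hxy : x ≠ y := by
      rintro rfl
      exact hQQ' rfl
    refine Set.disjoint_left.2 ?_
    rintro _ (rfl | rfl) (h' | h')
    · exact hxy (Sum.inl_injective h')
    · exact hne y hy x h'.symm
    · exact hne x hx y h'
    · exact hxy (w.injective h')
  have hpair := b.blockOp_pairwise (disjoint_range X Y) hd
  rw [blockProd]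
  rw [hPF] at hpair ⊢
  rw [commProd_image hinj hpair, ← b.commProd_move (inlE X Y) w F h fun x hx => ?_]
  · refine congrArg (fun f : Module.End k _ => f (el (inlE X Y) m)) (commProd_congr fun x hx => ?_)
    obtain ⟨y, hy⟩ := hF x hx
    have e1 : ({.inl x, w x} : Set (X ⊕ Y)) ∩ Set.range (inlE X Y) = {inlE X Y x} := by
      ext a
      constructor
      · rintro ⟨rfl | rfl, h2⟩
        · rfl
        · obtain ⟨z, hz⟩ := h2
          exact absurd hz.symm (hne x hx z)
      · rintro rfl
        exact ⟨.inl rfl, x, rfl⟩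
    have e2 : ({.inl x, w x} : Set (X ⊕ Y)) ∩ Set.range (inrE X Y) = {w x} := by
      ext a
      constructor
      · rintro ⟨rfl | rfl, h2⟩
        · obtain ⟨z, hz⟩ := h2
          exact absurd hz Sum.inr_ne_inl
        · rfl
      · rintro rfl
        exact ⟨.inr rfl, y, hy⟩
    change b.blockOp (_ ∩ _) (_ ∩ _) = _
    rw [e1, e2]
  · rintro ⟨y, hy⟩
    exact hne x hx y hy.symm

/-- The parts are the pairs {x, e x}, so together they move X to Y along e. -/
theorem diagram_graph (e : X ≃ Y) (m : M.obj X) :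
    b.diagram (graph e) m = M.map (⟨e⟩ : X ⟶ Y) m := by
  have h := b.blockProd_pairs (e.toEmbedding.trans (inrE X Y)) Finset.univ (by simp)
    (fun x _ => ⟨e x, rfl⟩) (P := parts (graph e) Set.univ) ?_ m
  · rw [el_diagram, el_trans] at h
    have := congrArg (cf (inrE X Y)) h
    rwa [cf_el_self, cf_el_self] at this
  · intro Q
    rw [mem_parts]
    have key : ∀ x, {y | (graph e) (.inl x) y} = {.inl x, .inr (e x)} := by
      intro x
      ext (y | y)
      · change e x = e y ↔ _
        simp [eq_comm]
      · change e x = y ↔ _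
        simp [eq_comm]
    constructor
    · rintro ⟨x | y, -, rfl⟩
      · exact ⟨x, Finset.mem_univ _, key x⟩
      · refine ⟨e.symm y, Finset.mem_univ _, (setOf_eq_iff.2 ?_).trans (key _)⟩
        change y = e (e.symm y)
        simp
    · rintro ⟨x, -, rfl⟩
      exact ⟨.inl x, trivial, (key x).symm⟩

/-- The diagram whose only non-trivial block consists of the points that lie in only one of the
images of `u` and `v`. -/
def blockDiagram (u : X ↪ S) (v : Y ↪ S) : Setoid (X ⊕ Y) :=
  (blockSetoid (symmDiff (Set.range u) (Set.range v))).comap (Sum.elim u v)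

/-- The trivial blocks first move the points of X that have a partner in Y; the big block then
performs one operation inside X ⊔ Y, which `op_trans` identifies with the operation inside S. For
equal images there is no big block: the diagram is a bijection, while `op` carries an extra δ. -/
theorem diagram_blockDiagram (u : X ↪ S) (v : Y ↪ S) (huv : Set.range u ≠ Set.range v)
    (m : M.obj X) : b.diagram (blockDiagram u v) m = b.op u v m := by
  classical
  let F : Finset X := Finset.univ.filter fun x => u x ∈ Set.range v
  have hF : ∀ x, x ∈ F ↔ u x ∈ Set.range v := by simp [F]
  -- A point x with u x = v y moves to y and all others stay. The image of w is the occupied set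
  -- after the trivial blocks have acted.
  let w₀ : X → X ⊕ Y := fun x => if h : u x ∈ Set.range v then .inr h.choose else .inl x
  have hw₀ : ∀ x, Sum.elim u v (w₀ x) = u x := by
    intro x
    by_cases h : u x ∈ Set.range v
    · simp only [w₀, dif_pos h, Sum.elim_inr, h.choose_spec]
    · simp only [w₀, dif_neg h, Sum.elim_inl]
  let w : X ↪ X.sum Y := ⟨w₀, fun x y hxy => u.injective (by
    rw [← hw₀ x, ← hw₀ y]
    exact congrArg (Sum.elim u v) hxy)⟩
  have hw : ∀ x, Sum.elim u v (w x) = u x := hw₀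
  have hwl : ∀ x ∉ F, w x = .inl x := fun x hx => dif_neg (by rwa [← hF])
  have hwr : ∀ x ∈ F, w x ∈ Set.range (inrE X Y) := fun x hx =>
    ⟨((hF x).1 hx).choose, (dif_pos (t := fun h : u x ∈ Set.range v => (.inr h.choose : X ⊕ Y))
      ((hF x).1 hx)).symm⟩
  set K : Set (X ⊕ Y) := Sum.elim u v ⁻¹' symmDiff (Set.range u) (Set.range v) with hK
  have hKl : ∀ x, .inl x ∈ K ↔ x ∉ F := by
    intro x
    rw [hF]
    simp [K, Set.mem_symmDiff]
  have hKr : ∀ y, .inr y ∈ K ↔ v y ∉ Set.range u := by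
    intro y
    simp [K, Set.mem_symmDiff]
  -- This is where the images have to differ: otherwise K is empty and is not a part.
  have hKne : K.Nonempty := by
    by_contra h
    rw [Set.not_nonempty_iff_eq_empty] at h
    apply huv
    apply Set.Subset.antisymm
    · rintro _ ⟨x, rfl⟩
      by_contra h'
      have : (.inl x : X ⊕ Y) ∈ K := (hKl x).2 (by rwa [hF])
      rwa [h] at this
    · rintro _ ⟨y, rfl⟩
      by_contra h'
      have : (.inr y : X ⊕ Y) ∈ K := (hKr y).2 h'
      rwa [h] at this
  have hKw : ∀ x ∈ F, w x ∉ K := by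
    intro x hx h
    have : Sum.elim u v (w x) ∈ symmDiff (Set.range u) (Set.range v) := h
    rw [hw, Set.mem_symmDiff] at this
    rcases this with h | h
    · exact h.2 ((hF x).1 hx)
    · exact h.2 ⟨x, rfl⟩
  let P : Finset (Set (X ⊕ Y)) := F.image fun x => {.inl x, w x}
  have hP : ∀ Q, Q ∈ P ↔ ∃ x ∈ F, Q = {.inl x, w x} := by
    intro Q
    rw [Finset.mem_image]
    exact ⟨fun ⟨x, hx, h⟩ => ⟨x, hx, h.symm⟩, fun ⟨x, hx, h⟩ => ⟨x, hx, h.symm⟩⟩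
  have hKP : K ∉ P := by
    intro h
    obtain ⟨x, hx, h⟩ := (hP K).1 h
    exact hKw x hx (h ▸ .inr rfl)
  have hcls : ∀ a c, blockDiagram u v a c ↔ (a ∈ K ∧ c ∈ K) ∨ Sum.elim u v a = Sum.elim u v c := by
    intro a c
    exact or_comm
  have key : ∀ x ∈ F, {a | (blockDiagram u v) (.inl x) a} = {.inl x, w x} := by
    intro x hx
    ext a
    rw [Set.mem_ofPred_eq, hcls, hKl]
    constructor
    · rintro (h | h)
      · exact absurd hx h.1
      · rcases a with a | a
        · exact .inl (congrArg Sum.inl (u.injective h).symm)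
        · obtain ⟨y, hy⟩ := hwr x hx
          refine .inr ?_
          have h1 : u x = v a := h
          have h2 : v y = u x := by
            rw [← hw x, ← hy]
            rfl
          rw [← v.injective (h2.trans h1)]
          exact hy
    · rintro (rfl | rfl)
      · exact .inr rfl
      · exact .inr (hw x).symm
  have hparts : parts (blockDiagram u v) Set.univ = insert K P := by
    have keyK : ∀ a ∈ K, {c | (blockDiagram u v) a c} = K := by
      intro a ha
      ext c
      rw [Set.mem_ofPred_eq, hcls]
      refine ⟨?_, fun h => .inl ⟨ha, h⟩⟩
      rintro (h | h)
      · exact h.2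
      · have : Sum.elim u v a ∈ symmDiff (Set.range u) (Set.range v) := ha
        rwa [h] at this
    ext Q
    rw [mem_parts, Finset.mem_insert, hP]
    constructor
    · rintro ⟨a, -, rfl⟩
      by_cases ha : a ∈ K
      · exact .inl (keyK a ha)
      · refine .inr ?_
        rcases a with x | y
        · rw [hKl, not_not] at ha
          exact ⟨x, ha, key x ha⟩
        · rw [hKr, not_not] at ha
          obtain ⟨x, hx⟩ := ha
          have hxF : x ∈ F := (hF x).2 ⟨y, hx.symm⟩
          refine ⟨x, hxF, (setOf_eq_iff.2 ?_).trans (key x hxF)⟩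
          exact (hcls _ _).2 (.inr hx.symm)
    · rintro (rfl | ⟨x, hx, rfl⟩)
      · obtain ⟨a, ha⟩ := hKne
        exact ⟨a, trivial, (keyK a ha).symm⟩
      · exact ⟨.inl x, trivial, (key x hx).symm⟩
  have hpair := b.blockOp_pairwise (disjoint_range X Y)
    (parts_pairwiseDisjoint (blockDiagram u v) Set.univ)
  have h := b.el_diagram (blockDiagram u v) m
  rw [hparts] at hpair h
  rw [blockProd, commProd_insert hKP hpair, Module.End.mul_apply] at h
  change b.blockOp (K ∩ Set.range (inlE X Y)) (K ∩ Set.range (inrE X Y))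
    (b.blockProd (S := X.sum Y) (Set.range (inlE X Y)) (Set.range (inrE X Y)) P
      (el (inlE X Y) m)) = _ at h
  rw [b.blockProd_pairs w F hwl hwr hP, b.blockOp_el w (inrE X Y)] at h
  · have h1 := congrArg (cf (inrE X Y)) h
    rw [cf_el_self, cf_el_self] at h1
    rw [← h1]
    -- The map X ⊔ Y → S identifies partners and need not be injective, but it is injective on w(X)
    -- ∪ Y. This subset maps to X ⊔ Y and to S, which links the two ambient sets.
    let W : Set (X.sum Y) := Set.range w ∪ Set.range (inrE X Y)
    have hj : Function.Injective fun a : W => Sum.elim u v a.1 := by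
      have h3 : ∀ x y, u x = v y → w x = .inr y := by
        intro x y hxy
        obtain ⟨z, hz⟩ := hwr x ((hF x).2 ⟨y, hxy.symm⟩)
        have : v z = v y := by
          rw [← hxy, ← hw x, ← hz]
          rfl
        rw [← hz, v.injective this]
        rfl
      rintro ⟨_, ⟨x, rfl⟩ | ⟨x, rfl⟩⟩ ⟨_, ⟨y, rfl⟩ | ⟨y, rfl⟩⟩ hxy <;> apply Subtype.ext
      · have : u x = u y := by rw [← hw x, ← hw y]; exact hxy
        change w x = w y
        rw [u.injective this]
      · exact h3 x y ((hw x).symm.trans hxy)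
      · exact (h3 y x ((hw y).symm.trans hxy.symm)).symm
      · exact congrArg Sum.inr (v.injective hxy)
    let j : (X.sum Y).sub W ↪ S := ⟨_, hj⟩
    let w' : X ↪ (X.sum Y).sub W := ⟨fun x => ⟨w x, .inl ⟨x, rfl⟩⟩, fun x y h =>
      w.injective (congrArg Subtype.val h)⟩
    let v' : Y ↪ (X.sum Y).sub W := ⟨fun y => ⟨.inr y, .inr ⟨y, rfl⟩⟩, fun x y h =>
      Sum.inr_injective (congrArg Subtype.val h)⟩
    have e1 : w'.trans j = u := Function.Embedding.ext hw
    have e2 : v'.trans j = v := rfl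
    have h4 := LinearMap.congr_fun (b.op_trans w' v' j) m
    have h5 := LinearMap.congr_fun (b.op_trans w' v' (incl W)) m
    rw [e1, e2] at h4
    rw [h4, ← h5]
    rfl
  · rintro _ ⟨ha, x, rfl⟩
    exact ⟨x, hwl x ((hKl x).1 ha)⟩
  · rw [Set.disjoint_left]
    rintro _ ⟨ha, y, rfl⟩ ⟨x, hx⟩
    refine (hKr y).1 ha ⟨x, ?_⟩
    rw [← hw x, hx]
    rfl
  · ext a
    constructor
    · rintro ⟨y, rfl⟩
      by_cases hy : v y ∈ Set.range u
      · obtain ⟨x, hx⟩ := hy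
        obtain ⟨z, hz⟩ := hwr x ((hF x).2 ⟨y, hx.symm⟩)
        have : v z = v y := by
          rw [← hx, ← hw x, ← hz]
          rfl
        refine .inl ⟨⟨x, ?_⟩, ?_⟩
        · rw [← hz, v.injective this]
        · rintro ⟨-, c, hc⟩
          exact Sum.inl_ne_inr hc
      · exact .inr ⟨(hKr y).2 hy, y, rfl⟩
    · rintro (⟨⟨x, rfl⟩, h'⟩ | ⟨-, h'⟩)
      · by_cases hx : x ∈ F
        · exact hwr x hx
        · exact absurd ⟨by rw [hwl x hx]; exact (hKl x).2 hx, x, (hwl x hx).symm⟩ h'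
      · exact h'

end BlockAction

end Species

/-! ### Gluing diagrams that are restricted from relations on one common set. -/

namespace PartitionDiagram

open PartitionCat (blockSetoid)

variable {S X Y Z : Type u}

/-- Gluing along Y identifies points of X ⊔ Y ⊔ Z lying over the same point of S. For x and z this
requires that a common point of u and w also comes from Y. The support conditions ensure that every
step of a chain for g or h between distinct points of S lifts to X ⊔ Y or Y ⊔ Z. -/
theorem glue_comap (u : X → S) (v : Y → S) (w : Z → S) {g h : Setoid S}
    (huw : Set.range u ∩ Set.range w ⊆ Set.range v)
    (hg : g ≤ blockSetoid (Set.range u ∪ Set.range v))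
    (hh : h ≤ blockSetoid (Set.range v ∪ Set.range w)) :
    glue (g.comap (Sum.elim u v)) (h.comap (Sum.elim v w)) =
      (g ⊔ h).comap (Sum.elim u (Sum.elim v w)) := by
  set G := glue (g.comap (Sum.elim u v)) (h.comap (Sum.elim v w)) with hG
  set p : X ⊕ (Y ⊕ Z) → S := Sum.elim u (Sum.elim v w) with hp
  have hl : ∀ a c, g (Sum.elim u v a) (Sum.elim u v c) →
      G (Sum.map id Sum.inl a) (Sum.map id Sum.inl c) := fun a c h => glue_left h
  have hr : ∀ a c, h (Sum.elim v w a) (Sum.elim v w c) → G (.inr a) (.inr c) :=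
    fun a c h => glue_right h
  have hpl : ∀ a, p (Sum.map id Sum.inl a) = Sum.elim u v a := by rintro (a | a) <;> rfl
  apply le_antisymm
  · rw [hG, glue_le]
    constructor
    · intro a c hac
      refine (le_sup_left : g ≤ g ⊔ h) ?_
      rw [hpl, hpl]
      exact hac
    · exact fun a c hac => (le_sup_right : h ≤ g ⊔ h) hac
  · have hux : ∀ x z, u x = w z → G (.inl x) (.inr (.inr z)) := by
      intro x z hxz
      obtain ⟨y, hy⟩ := huw ⟨⟨x, rfl⟩, z, hxz.symm⟩
      refine G.trans' (hl (.inl x) (.inr y) ?_) (hr (.inl y) (.inr z) ?_)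
      · change g (u x) (v y)
        rw [hy]
      · change h (v y) (w z)
        rw [hy, hxz]
    have hsat : ∀ a c, p a = p c → G a c := by
      rintro (a | a | a) (c | c | c) hac
      · exact hl (.inl a) (.inl c) (by change g (u a) (u c); rw [show u a = u c from hac])
      · exact hl (.inl a) (.inr c) (by change g (u a) (v c); rw [show u a = v c from hac])
      · exact hux a c hac
      · exact hl (.inr a) (.inl c) (by change g (v a) (u c); rw [show v a = u c from hac])
      · exact hl (.inr a) (.inr c) (by change g (v a) (v c); rw [show v a = v c from hac])
      · exact hr (.inl a) (.inr c) (by change h (v a) (w c); rw [show v a = w c from hac])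
      · exact G.symm' (hux c a hac.symm)
      · exact hr (.inr a) (.inl c) (by change h (w a) (v c); rw [show w a = v c from hac])
      · exact hr (.inr a) (.inr c) (by change h (w a) (w c); rw [show w a = w c from hac])
    let q : Setoid S :=
      { r := fun s t => s = t ∨ ∃ a c, p a = s ∧ p c = t ∧ G a c
        iseqv :=
          { refl := fun s => .inl rfl
            symm := by
              rintro s t (h | ⟨a, c, h1, h2, h3⟩)
              · exact .inl h.symm
              · exact .inr ⟨c, a, h2, h1, G.symm' h3⟩
            trans := by
              rintro r s t (rfl | ⟨a, c, h1, h2, h3⟩) (rfl | ⟨a', c', h1', h2', h3'⟩)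
              · exact .inl rfl
              · exact .inr ⟨a', c', h1', h2', h3'⟩
              · exact .inr ⟨a, c, h1, h2, h3⟩
              · exact .inr ⟨a, c', h1, h2',
                  G.trans' h3 (G.trans' (hsat _ _ (h2.trans h1'.symm)) h3')⟩ } }
    have hq : g ⊔ h ≤ q := by
      refine sup_le ?_ ?_
      · intro s t hst
        have hmem : ∀ {s}, s ∈ Set.range u ∪ Set.range v → ∃ a, Sum.elim u v a = s := by
          rintro _ (⟨x, rfl⟩ | ⟨x, rfl⟩)
          · exact ⟨.inl x, rfl⟩
          · exact ⟨.inr x, rfl⟩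
        rcases hg hst with h' | ⟨h1, h2⟩
        · exact .inl h'
        · obtain ⟨a, rfl⟩ := hmem h1
          obtain ⟨c, rfl⟩ := hmem h2
          exact .inr ⟨_, _, hpl a, hpl c, hl a c hst⟩
      · intro s t hst
        have hmem : ∀ {s}, s ∈ Set.range v ∪ Set.range w → ∃ a, Sum.elim v w a = s := by
          rintro _ (⟨x, rfl⟩ | ⟨x, rfl⟩)
          · exact ⟨.inl x, rfl⟩
          · exact ⟨.inr x, rfl⟩
        rcases hh hst with h' | ⟨h1, h2⟩
        · exact .inl h'
        · obtain ⟨a, rfl⟩ := hmem h1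
          obtain ⟨c, rfl⟩ := hmem h2
          exact .inr ⟨_, _, rfl, rfl, hr a c hst⟩
    intro a c hac
    rcases hq hac with h' | ⟨a', c', h1, h2, h3⟩
    · exact hsat a c h'
    · exact G.trans' (hsat _ _ h1.symm) (G.trans' h3 (hsat _ _ h2))

theorem comp_comap (u : X → S) (v : Y → S) (w : Z → S) {g h : Setoid S}
    (huw : Set.range u ∩ Set.range w ⊆ Set.range v)
    (hg : g ≤ blockSetoid (Set.range u ∪ Set.range v))
    (hh : h ≤ blockSetoid (Set.range v ∪ Set.range w)) :
    comp (g.comap (Sum.elim u v)) (h.comap (Sum.elim v w)) = (g ⊔ h).comap (Sum.elim u w) := by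
  rw [comp, glue_comap u v w huw hg hh]
  ext (a | a) (c | c) <;> rfl

theorem loops_comap_eq_zero (u : X → S) (v : Y → S) (w : Z → S) {g h : Setoid S}
    (huw : Set.range u ∩ Set.range w ⊆ Set.range v)
    (hg : g ≤ blockSetoid (Set.range u ∪ Set.range v))
    (hh : h ≤ blockSetoid (Set.range v ∪ Set.range w))
    (hv : ∀ y, ∃ s ∈ Set.range u ∪ Set.range w, (g ⊔ h) s (v y)) :
    loops (g.comap (Sum.elim u v)) (h.comap (Sum.elim v w)) = 0 := by
  rw [loops, glue_comap u v w huw hg hh]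
  refine countAvoiding_eq_zero _ _ ?_
  rintro (x | y | z)
  · exact ⟨_, ⟨.inl x, rfl⟩, Setoid.refl' _ _⟩
  · obtain ⟨_, ⟨x, rfl⟩ | ⟨z, rfl⟩, h⟩ := hv y
    · exact ⟨_, ⟨.inl x, rfl⟩, h⟩
    · exact ⟨_, ⟨.inr z, rfl⟩, h⟩
  · exact ⟨_, ⟨.inr z, rfl⟩, Setoid.refl' _ _⟩

theorem sup_blockSetoid_blockSetoid {A B : Set S} (h : (A ∩ B).Nonempty) :
    blockSetoid A ⊔ blockSetoid B = blockSetoid (A ∪ B) := by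
  apply le_antisymm
  · exact sup_le (blockSetoid_mono Set.subset_union_left) (blockSetoid_mono Set.subset_union_right)
  · obtain ⟨s, hA, hB⟩ := h
    have key : ∀ t ∈ A ∪ B, (blockSetoid A ⊔ blockSetoid B) t s := by
      rintro t (ht | ht)
      · exact (le_sup_left : blockSetoid A ≤ _) (.inr ⟨ht, hA⟩)
      · exact (le_sup_right : blockSetoid B ≤ blockSetoid A ⊔ _) (.inr ⟨ht, hB⟩)
    rintro x y (rfl | ⟨hx, hy⟩)
    · exact Setoid.refl' _ _
    · exact Setoid.trans' _ (key x hx) (Setoid.symm' _ (key y hy))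

theorem comap_blockSetoid_congr {A B : Set S} (p : X → S) (h : ∀ x, p x ∈ A ↔ p x ∈ B) :
    (blockSetoid A).comap p = (blockSetoid B).comap p := by
  ext x y
  exact or_congr_right (and_congr (h x) (h y))

end PartitionDiagram

namespace PartitionCat

variable {k : Type u} [CommRing k] {δ : k}

theorem ofDiagram_comp {X Y Z : FB.{u}} (r : Setoid (X ⊕ Y)) (s : Setoid (Y ⊕ Z)) :
    (ofDiagram r ≫ ofDiagram s : (⟨X⟩ : PartitionCat δ) ⟶ ⟨Z⟩) =
      δ ^ PartitionDiagram.loops r s • ofDiagram (PartitionDiagram.comp r s) := by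
  change compₗ δ X Y Z (Finsupp.single r 1) (Finsupp.single s 1) =
    δ ^ PartitionDiagram.loops r s • (Finsupp.single _ 1 : HomModule k X Z)
  rw [compₗ_single, Finsupp.smul_single, smul_eq_mul]
  simp

end PartitionCat

/-! ### The block action on a representation of the partition category. -/

namespace PartitionRep

open PartitionDiagram
open PartitionCat (blockSetoid ofDiagram)
open Species

variable {k : Type u} [CommRing k] {δ : k} (N : PartitionRep δ) {X Y Z S : FB.{u}}

/-- The action of a partition diagram on a representation of the partition category. -/
def diagram (r : Setoid (X ⊕ Y)) : N.species.obj X →ₗ[k] N.species.obj Y :=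
  (N.obj.map (ofDiagram r)).hom

theorem diagram_diagram (r : Setoid (X ⊕ Y)) (s : Setoid (Y ⊕ Z)) (x : N.species.obj X) :
    N.diagram s (N.diagram r x) = δ ^ loops r s • N.diagram (comp r s) x := by
  have := N.property.2
  have h := N.obj.map_comp (ofDiagram r) (ofDiagram s)
  rw [PartitionCat.ofDiagram_comp, Functor.map_smul] at h
  exact (congrArg (fun f => f x) h).symm

theorem diagram_graph (e : X ≃ Y) (x : N.species.obj X) :
    N.diagram (graph e) x = N.species.map (⟨e⟩ : X ⟶ Y) x := rfl

/-- The action of a diagram with at most one non-trivial block. -/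
def blockMap (u : X ↪ S) (v : Y ↪ S) : N.species.obj X →ₗ[k] N.species.obj Y :=
  N.diagram (BlockAction.blockDiagram u v)

theorem blockMap_comp_eq (u : X ↪ S) (v : Y ↪ S) (w : Z ↪ S) (x : N.species.obj X) :
    N.blockMap v w (N.blockMap u v x) =
      δ ^ loops (BlockAction.blockDiagram u v) (BlockAction.blockDiagram v w) •
        N.diagram (comp (BlockAction.blockDiagram u v) (BlockAction.blockDiagram v w)) x :=
  N.diagram_diagram _ _ x

variable (u : X ↪ S) (v : Y ↪ S) (w : Z ↪ S)

theorem symmDiff_le : blockSetoid (symmDiff (Set.range u) (Set.range v)) ≤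
    blockSetoid (Set.range u ∪ Set.range v) :=
  blockSetoid_mono Set.symmDiff_subset_union

/-- No loop arises, because every middle point is also an outer point of S. The joined relation is
symmetric in the two blocks, and this symmetry yields the commutation law. -/
theorem blockMap_comp_of_subset (huw : Set.range u ∩ Set.range w ⊆ Set.range v)
    (hv : Set.range v ⊆ Set.range u ∪ Set.range w) (x : N.species.obj X) :
    N.blockMap v w (N.blockMap u v x) =
      N.diagram ((blockSetoid (symmDiff (Set.range u) (Set.range v)) ⊔
        blockSetoid (symmDiff (Set.range v) (Set.range w))).comap (Sum.elim u w)) x := by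
  rw [blockMap_comp_eq, BlockAction.blockDiagram, BlockAction.blockDiagram,
    loops_comap_eq_zero u v w huw (symmDiff_le u v) (symmDiff_le v w),
    comp_comap u v w huw (symmDiff_le u v) (symmDiff_le v w), pow_zero, one_smul]
  intro y
  exact ⟨_, hv ⟨y, rfl⟩, Setoid.refl' _ _⟩

/-- The middle point v y lies in both blocks, so they join to one whose trace on the outer points is
u △ w. That trace is empty precisely when u and w have equal images; then the joined block is a loop
and contributes δ. -/
theorem blockMap_comp (huw : Set.range u ∩ Set.range w ⊆ Set.range v)
    (hv : ¬ Set.range v ⊆ Set.range u ∪ Set.range w) (x : N.species.obj X) :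
    N.blockMap v w (N.blockMap u v x) =
      (if Set.range u = Set.range w then δ else 1) • N.blockMap u w x := by
  obtain ⟨_, ⟨y, rfl⟩, hy⟩ := Set.not_subset.1 hv
  have hyu : v y ∉ Set.range u := fun h => hy (.inl h)
  have hyw : v y ∉ Set.range w := fun h => hy (.inr h)
  have hsup := sup_blockSetoid_blockSetoid (A := symmDiff (Set.range u) (Set.range v))
    (B := symmDiff (Set.range v) (Set.range w)) ⟨v y, .inr ⟨⟨y, rfl⟩, hyu⟩, .inl ⟨⟨y, rfl⟩, hyw⟩⟩
  have hcomp : comp (BlockAction.blockDiagram u v) (BlockAction.blockDiagram v w) =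
      BlockAction.blockDiagram u w := by
    rw [BlockAction.blockDiagram, BlockAction.blockDiagram,
      comp_comap u v w huw (symmDiff_le u v) (symmDiff_le v w), hsup, BlockAction.blockDiagram]
    refine comap_blockSetoid_congr _ fun a => ?_
    have ha : Sum.elim u w a ∈ Set.range u ∪ Set.range w := by
      rcases a with a | a
      · exact .inl ⟨a, rfl⟩
      · exact .inr ⟨a, rfl⟩
    have := @huw (Sum.elim u w a)
    simp only [Set.mem_union, Set.mem_symmDiff, Set.mem_inter_iff] at ha this ⊢
    tauto
  rw [blockMap_comp_eq, hcomp]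
  congr 1
  split_ifs with h
  -- For equal outer images, the one class avoiding X ⊔ Z consists of the middle points outside the
  -- image of u, and v y represents it.
  · suffices h1 : loops (BlockAction.blockDiagram u v) (BlockAction.blockDiagram v w) = 1 by
      rw [h1, pow_one]
    rw [loops, BlockAction.blockDiagram, BlockAction.blockDiagram,
      glue_comap u v w huw (symmDiff_le u v) (symmDiff_le v w), hsup, Setoid.countAvoiding,
      Set.ncard_eq_one]
    refine ⟨Quotient.mk _ (.inr (.inl y)), ?_⟩
    ext z
    obtain ⟨a, rfl⟩ := Quotient.exists_rep z
    have hK : ∀ s, s ∈ symmDiff (Set.range u) (Set.range v) ∪ symmDiff (Set.range v) (Set.range w) ↔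
        s ∈ Set.range v ∧ s ∉ Set.range u := by
      intro s
      have := @huw s
      rw [← h] at this ⊢
      simp only [Set.mem_union, Set.mem_symmDiff, Set.mem_inter_iff] at this ⊢
      tauto
    rw [Set.mem_compl_iff, Set.mem_singleton_iff]
    constructor
    · intro ha
      refine Quotient.sound (.inr ⟨?_, (hK _).2 ⟨⟨y, rfl⟩, hyu⟩⟩)
      rcases a with a | a | a
      · exact absurd ⟨_, ⟨.inl a, rfl⟩, rfl⟩ ha
      · refine (hK _).2 ⟨⟨a, rfl⟩, ?_⟩
        rintro ⟨x, hx⟩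
        exact ha ⟨_, ⟨.inl x, rfl⟩, Quotient.sound (.inl hx)⟩
      · exact absurd ⟨_, ⟨.inr a, rfl⟩, rfl⟩ ha
    · rw [Quotient.eq]
      rintro ha ⟨_, ⟨c, rfl⟩, hc⟩
      rcases Setoid.trans' _ (Quotient.exact hc) ha with h' | ⟨h', -⟩
      · rcases c with c | c
        · exact hyu ⟨c, h'⟩
        · exact hyw ⟨c, h'⟩
      · rw [hK] at h'
        rcases c with c | c
        · exact h'.2 ⟨c, rfl⟩
        · exact h'.2 (h ▸ ⟨c, rfl⟩)
  · rw [BlockAction.blockDiagram, BlockAction.blockDiagram,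
      loops_comap_eq_zero u v w huw (symmDiff_le u v) (symmDiff_le v w), pow_zero]
    intro y'
    by_cases hy' : v y' ∈ Set.range u ∪ Set.range w
    · exact ⟨_, hy', Setoid.refl' _ _⟩
    · obtain ⟨s, hs⟩ := Set.symmDiff_nonempty.2 h
      refine ⟨s, Set.symmDiff_subset_union hs, ?_⟩
      rw [hsup]
      have := @huw s
      refine .inr ⟨?_, .inl (.inr ⟨⟨y', rfl⟩, fun h => hy' (.inl h)⟩)⟩
      simp only [Set.mem_union, Set.mem_symmDiff, Set.mem_inter_iff] at this hs ⊢
      tauto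

open scoped Classical in
/-- The operations on a representation of the partition category. -/
def blockAction : BlockAction δ N.species where
  -- For equal images the diagram is a bijection, and the factor δ supplies the missing closed part
  -- that `op_self` demands.
  op u v := (if Set.range u = Set.range v then δ else 1) • N.blockMap u v
  op_trans u v j := by
    have h1 : Set.range (u.trans j) = Set.range (v.trans j) ↔ Set.range u = Set.range v := by
      rw [range_trans, range_trans, j.injective.image_injective.eq_iff]
    have h2 : BlockAction.blockDiagram (u.trans j) (v.trans j) = BlockAction.blockDiagram u v := by
      rw [BlockAction.blockDiagram, range_trans, range_trans, ← Set.image_symmDiff j.injective]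
      ext a c
      have ha : ∀ a, Sum.elim (u.trans j) (v.trans j) a = j (Sum.elim u v a) := by
        rintro (a | a) <;> rfl
      rw [Setoid.comap_rel, ha, ha]
      exact or_congr j.injective.eq_iff
        (and_congr j.injective.mem_set_image j.injective.mem_set_image)
    rw [blockMap, h2]
    simp only [h1]
    rfl
  op_equiv_left e u v x := by
    have h1 : Set.range (e.toEmbedding.trans u) = Set.range u := by
      rw [range_trans]; simp
    have h2 : Sum.elim (e.toEmbedding.trans u) v = Sum.elim u v ∘ Sum.map e id := by
      funext a
      rcases a with a | a <;> rfl
    have h3 : BlockAction.blockDiagram (e.toEmbedding.trans u) v =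
        (BlockAction.blockDiagram u v).comap (Sum.map e id) := by
      rw [BlockAction.blockDiagram, BlockAction.blockDiagram, h1, h2]
      rfl
    rw [LinearMap.smul_apply, LinearMap.smul_apply, h1, ← diagram_graph, blockMap, blockMap,
      diagram_diagram, loops_graph, pow_zero, one_smul, graph_comp, h3]
  op_equiv_right {X Y Y' S} e u v x := by
    have h1 : Set.range (e.toEmbedding.trans v) = Set.range v := by
      rw [range_trans]; simp
    -- The graph of e is restricted from the discrete relation on S, so `comp_comap` applies with a
    -- trivial second relation.
    have h2 : graph e = (⊥ : Setoid S).comap (Sum.elim (e.toEmbedding.trans v) v) := by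
      ext a c
      have ha : ∀ a, Sum.elim (e.toEmbedding.trans v) v a = v (Sum.elim e id a) := by
        rintro (a | a) <;> rfl
      change _ ↔ Sum.elim (e.toEmbedding.trans v) v a = Sum.elim (e.toEmbedding.trans v) v c
      rw [ha, ha]
      exact v.injective.eq_iff.symm
    have h3 : Set.range u ∩ Set.range v ⊆ Set.range (e.toEmbedding.trans v) := by
      rw [h1]
      exact Set.inter_subset_right
    rw [LinearMap.smul_apply, LinearMap.smul_apply, h1, map_smul, ← diagram_graph, blockMap,
      blockMap, diagram_diagram, h2, BlockAction.blockDiagram,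
      loops_comap_eq_zero _ _ _ h3 (symmDiff_le _ _) bot_le
        (fun y => ⟨v (e y), .inr ⟨e y, rfl⟩, Setoid.refl' _ _⟩),
      comp_comap _ _ _ h3 (symmDiff_le _ _) bot_le, pow_zero, one_smul, sup_bot_eq, h1]
    rfl
  op_self u x := by
    have h1 : BlockAction.blockDiagram u u = graph (Equiv.refl _) := by
      rw [BlockAction.blockDiagram, symmDiff_self]
      ext a c
      have ha : ∀ a, Sum.elim u u a = u (Sum.elim id id a) := by
        rintro (a | a) <;> rfl
      rw [Setoid.comap_rel, ha, ha]
      refine ⟨?_, fun h => .inl (congrArg u h)⟩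
      rintro (h | h)
      · exact u.injective h
      · exact h.1.elim
    rw [LinearMap.smul_apply, if_pos rfl, blockMap, h1, diagram_graph, map_refl]
  op_single {X Y S} u v e i h hi x := by
    have h1 : u i ∉ Set.range v := by
      rintro ⟨y, hy⟩
      by_cases hyi : e.symm y = i
      · apply hi
        rw [← hyi, Equiv.apply_symm_apply, hy, hyi]
      · have := h _ hyi
        rw [Equiv.apply_symm_apply, hy] at this
        exact hyi (u.injective this).symm
    have h2 : v (e i) ∉ Set.range u := by
      rintro ⟨x, hx⟩
      by_cases hxi : x = i
      · exact hi (hxi ▸ hx.symm)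
      · rw [← h x hxi] at hx
        exact hxi (e.injective (v.injective hx))
    have h3 : BlockAction.blockDiagram u v = graph e := by
      have hl : ∀ x, u x ∈ symmDiff (Set.range u) (Set.range v) ↔ x = i := by
        intro x
        constructor
        · intro hx
          by_contra hxi
          rcases hx with hx | hx
          · exact hx.2 ⟨e x, h x hxi⟩
          · exact hx.2 ⟨x, rfl⟩
        · rintro rfl
          exact .inl ⟨⟨_, rfl⟩, h1⟩
      have hr : ∀ x, v (e x) ∈ symmDiff (Set.range u) (Set.range v) ↔ x = i := by
        intro x
        constructor
        · intro hx
          by_contra hxi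
          rw [h x hxi, hl] at hx
          exact hxi hx
        · rintro rfl
          exact .inr ⟨⟨_, rfl⟩, h2⟩
      have hlr : ∀ x y, BlockAction.blockDiagram u v (.inl x) (.inr (e y)) ↔ x = y := by
        intro x y
        have : BlockAction.blockDiagram u v (.inl x) (.inr (e y)) ↔
          u x = v (e y) ∨ (x = i ∧ y = i) := or_congr_right (and_congr (hl x) (hr y))
        rw [this]
        constructor
        · rintro (h' | ⟨rfl, rfl⟩)
          · by_cases hy : y = i
            · exact absurd ⟨x, hy ▸ h'⟩ h2
            · rw [h y hy] at h'
              exact u.injective h'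
          · rfl
        · rintro rfl
          by_cases hx : x = i
          · exact .inr ⟨hx, hx⟩
          · exact .inl (h x hx).symm
      have key : ∀ a, BlockAction.blockDiagram u v a (.inr (Sum.elim e id a)) := by
        rintro (x | y)
        · exact (hlr x x).2 rfl
        · exact Setoid.refl' _ _
      ext a c
      have : BlockAction.blockDiagram u v a c ↔
          BlockAction.blockDiagram u v (.inr (Sum.elim e id a)) (.inr (Sum.elim e id c)) :=
        ⟨fun h' => Setoid.trans' _ (Setoid.symm' _ (key a)) (Setoid.trans' _ h' (key c)),
          fun h' => Setoid.trans' _ (key a) (Setoid.trans' _ h' (Setoid.symm' _ (key c)))⟩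
      rw [this]
      change _ ↔ Sum.elim e id a = Sum.elim e id c
      generalize Sum.elim e id a = y, Sum.elim e id c = z
      obtain ⟨y, rfl⟩ := e.surjective y
      obtain ⟨z, rfl⟩ := e.surjective z
      constructor
      · intro h'
        exact congrArg e ((hlr y z).1 (Setoid.trans' _ (key (.inl y)) h'))
      · intro h'
        rw [h']
    have h4 : Set.range u ≠ Set.range v := fun h => h1 (h ▸ ⟨i, rfl⟩)
    rw [LinearMap.smul_apply, if_neg h4, one_smul, blockMap, h3, diagram_graph]
  op_comp u v w huw hv x := by
    have h1 : Set.range u ≠ Set.range v := fun h => hv (h ▸ Set.subset_union_left)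
    have h2 : Set.range v ≠ Set.range w := fun h => hv (h ▸ Set.subset_union_right)
    rw [LinearMap.smul_apply, LinearMap.smul_apply, LinearMap.smul_apply, if_neg h1, if_neg h2,
      one_smul, one_smul, blockMap_comp N u v w huw hv]
  op_comm u v v' w huw hv hv' x := by
    -- Passing through v' instead of v interchanges the two blocks, and with them the two scalar
    -- factors.
    have h1 : symmDiff (Set.range u) (Set.range v') = symmDiff (Set.range v) (Set.range w) := by
      ext s
      have h1 := @huw s
      have h2 := @hv s
      rw [hv']
      simp only [Set.mem_union, Set.mem_symmDiff, Set.mem_inter_iff, Set.mem_sdiff] at h1 h2 ⊢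
      tauto
    have h2 : symmDiff (Set.range v') (Set.range w) = symmDiff (Set.range u) (Set.range v) := by
      ext s
      have h1 := @huw s
      have h2 := @hv s
      rw [hv']
      simp only [Set.mem_union, Set.mem_symmDiff, Set.mem_inter_iff, Set.mem_sdiff] at h1 h2 ⊢
      tauto
    have h3 : Set.range u = Set.range v' ↔ Set.range v = Set.range w := by
      rw [← symmDiff_eq_bot, h1, symmDiff_eq_bot]
    have h4 : Set.range v' = Set.range w ↔ Set.range u = Set.range v := by
      rw [← symmDiff_eq_bot, h2, symmDiff_eq_bot]
    have huw' : Set.range u ∩ Set.range w ⊆ Set.range v' := hv' ▸ Set.subset_union_left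
    have hvu' : Set.range v' ⊆ Set.range u ∪ Set.range w := by
      rw [hv']
      exact Set.union_subset (Set.inter_subset_left.trans Set.subset_union_left) Set.sdiff_subset
    simp only [LinearMap.smul_apply, map_smul, h3, h4]
    rw [blockMap_comp_of_subset N u v w huw hv, blockMap_comp_of_subset N u v' w huw' hvu', h1, h2,
      sup_comm, smul_comm]

end PartitionRep

/-! ### A representation of the partition category is determined by its block action. -/

namespace PartitionRep

open PartitionDiagram
open PartitionCat (blockSetoid ofDiagram)
open Species

variable {k : Type u} [CommRing k] {δ : k} (N : PartitionRep δ) {X Y Z S : FB.{u}}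

/-- The image of w is the set occupied after the blocks in P have acted. A further block Q is the
symmetric difference of the old and the new occupied set, so it acts as a one-block diagram.
Composing with it joins Q to the relation and closes no loop, because every point consumed by Q
belongs to X. -/
theorem el_partial (r : Setoid (X ⊕ Y)) (P : Finset (Set (X ⊕ Y))) (hP : P ⊆ parts r Set.univ)
    (w : Z ↪ X.sum Y)
    (hw : Set.range w = (Set.range (inlE X Y) \ ⋃₀ (P : Set (Set (X ⊕ Y)))) ∪
      (Set.range (inrE X Y) ∩ ⋃₀ (P : Set (Set (X ⊕ Y)))))
    (x : N.species.obj X) :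
    N.blockAction.blockProd (S := X.sum Y) (Set.range (inlE X Y)) (Set.range (inrE X Y)) P
      (el (inlE X Y) x) =
      el w (N.diagram ((P.sup blockSetoid).comap (Sum.elim (inlE X Y) w)) x) := by
  classical
  have hd := parts_pairwiseDisjoint r Set.univ
  have hlr := BlockAction.disjoint_range X Y
  induction P using Finset.induction_on generalizing Z w with
  | empty =>
    obtain ⟨e, he⟩ := exists_equiv_of_range_eq (inlE X Y) w (by simp [hw])
    have h1 : ((∅ : Finset (Set (X ⊕ Y))).sup blockSetoid).comap (Sum.elim (inlE X Y) w) =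
        graph e := by
      rw [← he]
      ext a c
      have ha : ∀ a, Sum.elim (e.toEmbedding.trans w) w a = w (Sum.elim e id a) := by
        rintro (a | a) <;> rfl
      change Sum.elim (e.toEmbedding.trans w) w a = Sum.elim (e.toEmbedding.trans w) w c ↔
        Sum.elim e id a = Sum.elim e id c
      rw [ha, ha, w.injective.eq_iff]
    rw [h1, diagram_graph, ← el_trans, he, BlockAction.blockProd, commProd_empty]
    rfl
  | insert Q P hQ ih =>
    have hP' : P ⊆ parts r Set.univ := (Finset.subset_insert _ _).trans hP
    have hQP : Disjoint Q (⋃₀ (P : Set (Set (X ⊕ Y)))) := by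
      rw [Set.disjoint_sUnion_right]
      intro Q' hQ'
      exact hd (hP (Finset.mem_insert_self _ _)) (hP' hQ') (by rintro rfl; exact hQ hQ')
    rw [BlockAction.blockProd, commProd_insert hQ
      (N.blockAction.blockOp_pairwise hlr (hd.subset (Finset.coe_subset.2 hP))),
      Module.End.mul_apply]
    have hle : P.sup blockSetoid ≤ blockSetoid (⋃₀ (P : Set (Set (X ⊕ Y)))) :=
      Finset.sup_le fun Q' hQ' => blockSetoid_mono (Set.subset_sUnion_of_mem hQ')
    have hne : Q.Nonempty := parts_nonempty (hP (Finset.mem_insert_self _ _))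
    rw [Finset.coe_insert, Set.sUnion_insert] at hw
    have huniv : ∀ a, a ∈ Set.range (inlE X Y) ∨ a ∈ Set.range (inrE X Y) := by
      rintro (a | a)
      · exact .inl ⟨a, rfl⟩
      · exact .inr ⟨a, rfl⟩
    have ih := ih hP' (incl ((Set.range (inlE X Y) \ ⋃₀ (P : Set (Set (X ⊕ Y)))) ∪
      (Set.range (inrE X Y) ∩ ⋃₀ (P : Set (Set (X ⊕ Y)))))) (range_incl _)
    rw [BlockAction.blockProd] at ih
    rw [ih, BlockAction.blockOp_el _ _ w]
    · congr 1
      have hv := range_incl (S := X.sum Y) ((Set.range (inlE X Y) \ ⋃₀ (P : Set (Set (X ⊕ Y)))) ∪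
        (Set.range (inrE X Y) ∩ ⋃₀ (P : Set (Set (X ⊕ Y)))))
      generalize (incl ((Set.range (inlE X Y) \ ⋃₀ (P : Set (Set (X ⊕ Y)))) ∪
        (Set.range (inrE X Y) ∩ ⋃₀ (P : Set (Set (X ⊕ Y)))))) = v at hv ⊢
      have hsd : symmDiff (Set.range v) (Set.range w) = Q := by
        rw [hv, hw]
        ext a
        have h1 := huniv a
        have h2 : a ∈ _ → a ∉ _ := fun h => Set.disjoint_left.1 hlr h
        have h3 : a ∈ _ → a ∉ _ := fun h => Set.disjoint_left.1 hQP h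
        simp only [Set.mem_symmDiff, Set.mem_union, Set.mem_inter_iff, Set.mem_sdiff]
        tauto
      have hvw : Set.range v ≠ Set.range w := by
        intro h
        rw [h, symmDiff_self] at hsd
        rw [← hsd] at hne
        exact Set.not_nonempty_empty hne
      change (_ • N.blockMap v w) _ = _
      have h1 : Set.range (inlE X Y) ∩ Set.range w ⊆ Set.range v := by
        rw [hv, hw]
        rintro a ⟨h1, h2⟩
        have h3 : a ∈ _ → a ∉ _ := fun h => Set.disjoint_left.1 hlr h
        simp only [Set.mem_union, Set.mem_inter_iff, Set.mem_sdiff] at h2 ⊢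
        tauto
      have h2 : P.sup blockSetoid ≤ blockSetoid (Set.range (inlE X Y) ∪ Set.range v) := by
        refine hle.trans (blockSetoid_mono ?_)
        rw [hv]
        intro a ha
        rcases huniv a with h | h
        · exact .inl h
        · exact .inr (.inr ⟨h, ha⟩)
      rw [if_neg hvw, one_smul, blockMap, diagram_diagram, BlockAction.blockDiagram,
        loops_comap_eq_zero (inlE X Y) v w h1 h2 (symmDiff_le v w),
        comp_comap (inlE X Y) v w h1 h2 (symmDiff_le v w), pow_zero, one_smul, hsd,
        Finset.sup_insert, sup_comm]
      intro y
      have hy : v y ∈ Set.range v := ⟨y, rfl⟩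
      rw [hv] at hy
      refine ⟨v y, ?_, Setoid.refl' _ _⟩
      rw [hw]
      rcases hy with hy | hy
      · exact .inl hy.1
      · exact .inr (.inr ⟨hy.1, .inr hy.2⟩)
    · rw [range_incl]
      rintro a ⟨h1, h2⟩
      exact .inl ⟨h2, Set.disjoint_left.1 hQP h1⟩
    · rw [range_incl, Set.disjoint_left]
      rintro a ⟨h1, h2⟩ (h3 | h3)
      · exact Set.disjoint_left.1 hlr h3.1 h2
      · exact Set.disjoint_left.1 hQP h1 h3.2
    · rw [range_incl, hw]
      ext a
      have h2 : a ∈ _ → a ∉ _ := fun h => Set.disjoint_left.1 hlr h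
      have h3 : a ∈ _ → a ∉ _ := fun h => Set.disjoint_left.1 hQP h
      simp only [Set.mem_union, Set.mem_inter_iff, Set.mem_sdiff]
      tauto

/-- With all parts included the occupied set is Y and the join of the parts is r itself. So the
single-block operations recover the action of every diagram. -/
theorem blockAction_diagram (r : Setoid (X ⊕ Y)) (x : N.species.obj X) :
    N.blockAction.diagram r x = N.diagram r x := by
  have h := N.el_partial r (parts r Set.univ) subset_rfl (inrE X Y)
    (by rw [sUnion_parts (le_blockSetoid_univ r)]; simp) x
  have h1 : (parts r Set.univ).sup blockSetoid = r := by
    have := sup_parts r (i := id)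
    simp only [Set.image_id] at this
    rw [this]
    ext a c
    rw [map_rel Function.injective_id]
    constructor
    · rintro (rfl | ⟨a, c, h, rfl, rfl⟩)
      · exact Setoid.refl' _ _
      · exact h
    · exact fun h => .inr ⟨a, c, h, rfl, rfl⟩
  have h2 : r.comap (Sum.elim (inlE X Y) (inrE X Y)) = r := by
    ext (a | a) (c | c) <;> rfl
  rw [h1, h2, BlockAction.el_diagram] at h
  have h3 := congrArg (cf (inrE X Y)) h
  rwa [cf_el_self, cf_el_self] at h3

end PartitionRep

/-! ### From block actions to representations of the partition category. -/

namespace Species.BlockAction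

open PartitionDiagram

variable {k : Type u} [CommRing k] {M : Species k} {δ : k} (b : BlockAction δ M)

/-- The action of a linear combination of partition diagrams. -/
def diagramₗ (X Y : FB.{u}) :
    PartitionCat.HomModule k X Y →ₗ[k] (M.obj X →ₗ[k] M.obj Y) :=
  Finsupp.lsum k fun r => LinearMap.toSpanSingleton k _ (b.diagram r)

@[simp] theorem diagramₗ_single {X Y : FB.{u}} (r : Setoid (X ⊕ Y)) (c : k) :
    b.diagramₗ X Y (Finsupp.single r c) = c • b.diagram r := by
  simp [diagramₗ]

theorem diagramₗ_comp {X Y Z : FB.{u}} (f : PartitionCat.HomModule k X Y)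
    (g : PartitionCat.HomModule k Y Z) :
    b.diagramₗ X Z (PartitionCat.compₗ δ X Y Z f g) = b.diagramₗ Y Z g ∘ₗ b.diagramₗ X Y f := by
  induction f using Finsupp.induction_linear with
  | zero => simp
  | add f f' hf hf' => simp only [map_add, LinearMap.add_apply, hf, hf', LinearMap.comp_add]
  | single r c =>
    induction g using Finsupp.induction_linear with
    | zero => simp
    | add g g' hg hg' => simp only [map_add, hg, hg', LinearMap.add_comp]
    | single s d =>
      rw [PartitionCat.compₗ_single, diagramₗ_single, diagramₗ_single, diagramₗ_single]
      refine LinearMap.ext fun x => ?_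
      simp only [LinearMap.smul_apply, LinearMap.comp_apply, map_smul, diagram_comp, smul_smul]
      congr 1
      ring

/-- The representation of the partition category given by a family of operations. -/
def toPartitionRep : PartitionRep δ where
  obj :=
    { obj X := M.obj X.set
      map {X Y} f := ModuleCat.ofHom (b.diagramₗ X.set Y.set f)
      map_id X := by
        refine ModuleCat.hom_ext (LinearMap.ext fun x => ?_)
        change b.diagramₗ X.set X.set (Finsupp.single (one X.set) 1) x = x
        rw [diagramₗ_single, one_smul, ← graph_refl, diagram_graph, map_refl]
      map_comp {X Y Z} f g := ModuleCat.hom_ext (b.diagramₗ_comp f g) }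
  property :=
    ⟨{ map_add := fun {X Y f g} => ModuleCat.hom_ext (map_add (b.diagramₗ X.set Y.set) f g) },
      { map_smul := fun {X Y} f c => ModuleCat.hom_ext (map_smul (b.diagramₗ X.set Y.set) c f) }⟩

theorem toPartitionRep_diagram {X Y : FB.{u}} (r : Setoid (X ⊕ Y)) :
    b.toPartitionRep.diagram r = b.diagram r := by
  change b.diagramₗ X Y (Finsupp.single r 1) = _
  rw [diagramₗ_single, one_smul]

end Species.BlockAction

/-! ### From block actions to Weyl representations. -/

namespace Species.BlockAction

variable {k : Type u} [CommRing k] {M : Species k} {δ : k} (b : BlockAction δ M)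
  {X Y Z S : FB.{u}}

open scoped Classical in
/-- The map `a : (Sym(𝐕) ⊗ M)(S) → (Div(𝐕) ⊗ M)(S)` given by a family of operations. -/
def actAt (S : FB.{u}) : (Sym k ⊗ₛ M).obj S →ₗ[k] (Sym k ⊗ₛ M).obj S :=
  -- Keeping only the pairs that cover S builds the vanishing of ω into the definition.
  ∑ p : Set S × Set S, if p.1 ∪ p.2 = Set.univ then
    el (incl p.2) ∘ₗ b.op (incl p.1) (incl p.2) ∘ₗ cf (incl p.1) else 0

open scoped Classical in
theorem cf_actAt_el (u : X ↪ S) (v : Y ↪ S) (x : M.obj X) :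
    cf v (b.actAt S (el u x)) =
      if Set.range u ∪ Set.range v = Set.univ then b.op u v x else 0 := by
  rw [actAt, LinearMap.sum_apply, map_sum, Finset.sum_eq_single (Set.range u, Set.range v)]
  · dsimp only
    split_ifs with h
    · obtain ⟨e, he⟩ := exists_equiv_of_range_eq u (incl (Set.range u)) (range_incl _).symm
      obtain ⟨f, hf⟩ := exists_equiv_of_range_eq v (incl (Set.range v)) (range_incl _).symm
      rw [LinearMap.comp_apply, LinearMap.comp_apply]
      have h1 : cf (incl (Set.range u)) (el u x) =
          M.map (⟨e⟩ : X ⟶ S.sub (Set.range u)) x := cf_el_equiv e he x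
      have h2 := b.op_equiv_left e (incl (Set.range u)) (incl (Set.range v)) x
      rw [he] at h2
      have h3 := b.op_equiv_right f u (incl (Set.range v)) x
      rw [hf] at h3
      rw [h1, ← h2, ← h3, ← el_trans, hf, cf_el_self]
    · rw [LinearMap.zero_apply, map_zero]
  · rintro ⟨U, V⟩ - hne
    dsimp only
    split_ifs with h
    · rw [LinearMap.comp_apply, LinearMap.comp_apply]
      by_cases hU : U = Set.range u
      · rw [cf_el_ne]
        rw [range_incl]
        rintro rfl
        exact hne (by rw [hU])
      · rw [cf_el_ne (incl U) u (by rwa [range_incl]), map_zero, map_zero, map_zero]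
    · rw [LinearMap.zero_apply, map_zero]
  · simp

/-- The map `a : Sym(𝐕) ⊗ M ⟶ Div(𝐕) ⊗ M` given by a family of operations. -/
def act : Sym k ⊗ₛ M ⟶ Div k ⊗ₛ M where
  app S := ModuleCat.ofHom (b.actAt S)
  naturality S S' g := by
    refine ModuleCat.hom_ext (linear_ext_el fun {X} u x => ext_cf fun V => ?_)
    change cf (incl V) (b.actAt S' ((Sym k ⊗ₛ M).map (⟨g.toEquiv⟩ : S ⟶ S') (el u x))) =
      cf (incl V) ((Sym k ⊗ₛ M).map (⟨g.toEquiv⟩ : S ⟶ S') (b.actAt S (el u x)))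
    have hV : ((incl V).trans g.toEquiv.symm.toEmbedding).trans g.toEquiv.toEmbedding = incl V := by
      ext
      simp
    rw [← hV, cf_map, map_el, cf_actAt_el, cf_actAt_el, range_trans, range_trans _ g.toEquiv.toEmbedding,
      ← Set.image_union, b.op_trans]
    congr 1
    rw [eq_iff_iff, ← Set.image_univ_of_surjective (f := g.toEquiv.toEmbedding) g.toEquiv.surjective,
      g.toEquiv.toEmbedding.injective.image_injective.eq_iff]

open scoped Classical in
theorem op_act (u : X ↪ S) (v : Y ↪ S) (x : M.obj X) :
    Species.op b.act u v x =
      if Set.range u ∪ Set.range v = Set.univ then b.op u v x else 0 := b.cf_actAt_el u v x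

theorem op_act_eq (u : X ↪ S) (v : Y ↪ S) (h : Set.range u ∪ Set.range v = Set.univ) :
    Species.op b.act u v = b.op u v := LinearMap.ext fun x => by rw [op_act, if_pos h]

theorem opn_act_eq {T : Set S} (u : X ↪ S) (v : Y ↪ S) (h : T = Set.range u ∪ Set.range v) :
    opn b.act T u v = b.op u v := by
  subst h
  rw [opn, dif_pos ⟨fun x => .inl ⟨x, rfl⟩, fun x => .inr ⟨x, rfl⟩⟩, op_act_eq]
  · exact (b.op_trans _ _ (incl (Set.range u ∪ Set.range v))).symm
  · rw [range_codRestrict, range_codRestrict, ← Set.preimage_union]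
    exact Set.eq_univ_of_forall fun t => t.2

theorem opn_act_ne {T : Set S} (u : X ↪ S) (v : Y ↪ S) (h : T ≠ Set.range u ∪ Set.range v) :
    opn b.act T u v = 0 := by
  rw [opn]
  split_ifs with h'
  · ext x
    rw [op_act, if_neg]
    · rfl
    · rw [range_codRestrict, range_codRestrict, ← Set.preimage_union]
      intro h2
      refine h (Set.Subset.antisymm (fun t ht => ?_)
        (Set.union_subset (Set.range_subset_iff.2 h'.1) (Set.range_subset_iff.2 h'.2)))
      exact (Set.ext_iff.1 h2 ⟨t, ht⟩).2 trivial
  · rfl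

open scoped Classical in
theorem opn_act_opn_act {T T' K : Set S} (u : X ↪ S) (w : Z ↪ S) (x : M.obj X) :
    opn b.act T' (incl K) w (opn b.act T u (incl K) x) =
      if T' = K ∪ Set.range w ∧ T = Set.range u ∪ K then b.op (incl K) w (b.op u (incl K) x)
      else 0 := by
  by_cases h1 : T = Set.range u ∪ K
  · rw [b.opn_act_eq u (incl K) (by rwa [range_incl])]
    by_cases h2 : T' = K ∪ Set.range w
    · rw [if_pos ⟨h2, h1⟩, b.opn_act_eq (incl K) w (by rwa [range_incl])]
    · rw [if_neg fun h => h2 h.1, b.opn_act_ne (incl K) w (by rwa [range_incl])]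
      rfl
  · rw [if_neg fun h => h1 h.2, b.opn_act_ne u (incl K) (by rwa [range_incl]), LinearMap.zero_apply,
      map_zero]

open scoped Classical in
theorem cf_act₁₂_act {X' Y' : FB.{u}} (u : Y ↪ S) (v : X ↪ Y) (u' : Y' ↪ S) (v' : X' ↪ Y') (x : M.obj X) :
    cf v' (cf u' ((act₁₂ b.act).app S (el u (el v x)))) =
    if Set.range u ∪ Set.range (v'.trans u') = Set.univ ∧ Set.range u ⊆
      Set.range (v.trans u) ∪ Set.range (v'.trans u') ∪ (Set.range u')ᶜ then
    b.op (incl (Set.range u ∩ (Set.range (v'.trans u') ∪ (Set.range u')ᶜ))) (v'.trans u')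
      (b.op (v.trans u) (incl (Set.range u ∩ (Set.range (v'.trans u') ∪ (Set.range u')ᶜ))) x)
    else 0 := by
  have hv : Set.range (v.trans u) ⊆ Set.range u := by
    rw [range_trans]; exact Set.image_subset_range _ _
  have hv' : Set.range (v'.trans u') ⊆ Set.range u' := by
    rw [range_trans]; exact Set.image_subset_range _ _
  by_cases h : Set.range u' ⊆ Set.range u ∪ Set.range (v'.trans u')
  · rw [cf_act₁₂ _ _ _ _ _ _ h, opn_act_opn_act]
    refine if_congr ?_ rfl rfl
    generalize Set.range (v'.trans u') = W at *
    generalize Set.range (v.trans u) = U at *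
    generalize Set.range u = Y at *
    generalize Set.range u' = Y' at *
    simp only [Set.ext_iff, Set.subset_def, Set.mem_union, Set.mem_inter_iff, Set.mem_compl_iff,
      Set.mem_univ, iff_true, ← forall_and] at *
    refine forall_congr' fun s => ?_
    have := hv s
    have := hv' s
    have := h s
    tauto
  · rw [cf_act₁₂_zero _ _ _ _ _ _ h, if_neg]
    rintro ⟨h1, -⟩
    exact h (h1 ▸ Set.subset_univ _)

open scoped Classical in
theorem cf_act₂₁_act {X' Y' : FB.{u}} (u : Y ↪ S) (v : X ↪ Y) (u' : Y' ↪ S) (v' : X' ↪ Y') (x : M.obj X) :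
    cf v' (cf u' ((act₂₁ b.act).app S (el u (el v x)))) =
    if Set.range u' ∪ Set.range (v.trans u) = Set.univ ∧ Set.range u' ⊆
      Set.range (v.trans u) ∪ Set.range (v'.trans u') ∪ (Set.range u)ᶜ then
    b.op (incl (Set.range u' ∩ (Set.range (v.trans u) ∪ (Set.range u)ᶜ))) (v'.trans u')
      (b.op (v.trans u) (incl (Set.range u' ∩ (Set.range (v.trans u) ∪ (Set.range u)ᶜ))) x)
    else 0 := by
  have hv : Set.range (v.trans u) ⊆ Set.range u := by
    rw [range_trans]; exact Set.image_subset_range _ _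
  have hv' : Set.range (v'.trans u') ⊆ Set.range u' := by
    rw [range_trans]; exact Set.image_subset_range _ _
  by_cases h : Set.range u ⊆ Set.range u' ∪ Set.range (v.trans u)
  · rw [cf_act₂₁ _ _ _ _ _ _ h, opn_act_opn_act]
    refine if_congr ?_ rfl rfl
    generalize Set.range (v'.trans u') = W at *
    generalize Set.range (v.trans u) = U at *
    generalize Set.range u = Y at *
    generalize Set.range u' = Y' at *
    simp only [Set.ext_iff, Set.subset_def, Set.mem_union, Set.mem_inter_iff, Set.mem_compl_iff,
      Set.mem_univ, iff_true, ← forall_and] at *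
    refine forall_congr' fun s => ?_
    have := hv s
    have := hv' s
    have := h s
    tauto
  · rw [cf_act₂₁_zero _ _ _ _ _ _ h, if_neg]
    rintro ⟨h1, -⟩
    exact h (h1 ▸ Set.subset_univ _)

theorem sum_opn_act (t : X ↪ S) (w : Z ↪ S) (p : Set S → Prop) [DecidablePred p] (x : M.obj X) :
    ∑ E : Set S with p E, opn b.act Eᶜ t w x =
      if p (Set.range t ∪ Set.range w)ᶜ then b.op t w x else 0 := by
  rw [← b.opn_act_eq t w rfl]
  convert sum_opn b.act t w (fun T hT => b.opn_act_ne _ _ hT) p x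

open scoped Classical in
-- Let R be the complement of the two images. The condition of the first composite amounts to R ⊆ Y₁
-- and R ∩ Y₂ = ∅, which is also the condition of the first term on the right; the second terms
-- match in the same way. For nonempty R at most one pair of terms is present, and `op_comp` equates
-- its two members. For empty R all four terms are present: the right side cancels, and the left
-- side does so by `op_comm`.
theorem op_rel (t : X ↪ S) (w : Z ↪ S) (Y₁ Y₂ : Set S) (hv : Set.range t ⊆ Y₁)
    (hv' : Set.range w ⊆ Y₂) (x : M.obj X) :
    (if Y₁ ∪ Set.range w = Set.univ ∧ Y₁ ⊆ Set.range t ∪ Set.range w ∪ Y₂ᶜ then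
      b.op (incl (Y₁ ∩ (Set.range w ∪ Y₂ᶜ))) w (b.op t (incl (Y₁ ∩ (Set.range w ∪ Y₂ᶜ))) x)
      else 0) -
    (if Y₂ ∪ Set.range t = Set.univ ∧ Y₂ ⊆ Set.range t ∪ Set.range w ∪ Y₁ᶜ then
      b.op (incl (Y₂ ∩ (Set.range t ∪ Y₁ᶜ))) w (b.op t (incl (Y₂ ∩ (Set.range t ∪ Y₁ᶜ))) x)
      else 0) =
    (if (Set.range t ∪ Set.range w)ᶜ ⊆ Y₁ ∧ Disjoint (Set.range t ∪ Set.range w)ᶜ Y₂ then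
      b.op t w x else 0) -
    (if (Set.range t ∪ Set.range w)ᶜ ⊆ Y₂ ∧ Disjoint (Set.range t ∪ Set.range w)ᶜ Y₁ then
      b.op t w x else 0) := by
  have hK₁ := range_incl (Y₁ ∩ (Set.range w ∪ Y₂ᶜ))
  have hK₂ := range_incl (Y₂ ∩ (Set.range t ∪ Y₁ᶜ))
  by_cases hE : (Set.range t ∪ Set.range w)ᶜ.Nonempty
  · obtain ⟨s, hs⟩ := hE
    have hs' : s ∉ Set.range t ∧ s ∉ Set.range w := not_or.1 hs
    -- A point of the complement that lies in both or in neither of Y₁ and Y₂ violates all four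
    -- conditions.
    by_cases hP : ∃ p ∈ (Set.range t ∪ Set.range w)ᶜ, (p ∈ Y₁ ↔ p ∈ Y₂)
    · obtain ⟨p, hp, hp'⟩ := hP
      have hp'' : p ∉ Set.range t ∧ p ∉ Set.range w := not_or.1 hp
      rw [if_neg, if_neg, if_neg, if_neg]
      · rintro ⟨h1, h2⟩
        exact Set.disjoint_left.1 h2 hp (hp'.2 (h1 hp))
      · rintro ⟨h1, h2⟩
        exact Set.disjoint_left.1 h2 hp (hp'.1 (h1 hp))
      · rintro ⟨h1, h2⟩
        have h1 := (Set.ext_iff.1 h1 p).2 trivial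
        have h2 := @h2 p
        simp only [Set.mem_union, Set.mem_compl_iff] at h1 h2
        tauto
      · rintro ⟨h1, h2⟩
        have h1 := (Set.ext_iff.1 h1 p).2 trivial
        have h2 := @h2 p
        simp only [Set.mem_union, Set.mem_compl_iff] at h1 h2
        tauto
    · push Not at hP
      have hP' : ∀ p, p ∉ Set.range t → p ∉ Set.range w → (p ∈ Y₁ ↔ p ∉ Y₂) := by
        intro p h1 h2
        have := hP p (by rintro (h | h); exacts [h1 h, h2 h])
        tauto
      clear hP
      -- Every point of the complement now lies in exactly one of Y₁ and Y₂, and a point in Y₁ rules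
      -- out both second terms.
      by_cases hA : ∃ p ∈ (Set.range t ∪ Set.range w)ᶜ, p ∈ Y₁
      · obtain ⟨p, hp, hp'⟩ := hA
        have hp'' : p ∉ Set.range t ∧ p ∉ Set.range w := not_or.1 hp
        have hp₂ : p ∉ Y₂ := (hP' p hp''.1 hp''.2).1 hp'
        rw [if_neg (c := Y₂ ∪ Set.range t = Set.univ ∧ _), if_neg (c := _ ⊆ Y₂ ∧ _)]
        · by_cases hB : ∃ q ∈ (Set.range t ∪ Set.range w)ᶜ, q ∈ Y₂
          · obtain ⟨q, hq, hq'⟩ := hB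
            have hq'' : q ∉ Set.range t ∧ q ∉ Set.range w := not_or.1 hq
            have hq₁ : q ∉ Y₁ := fun h => (hP' q hq''.1 hq''.2).1 h hq'
            rw [if_neg, if_neg]
            · rintro ⟨h1, -⟩
              exact hq₁ (h1 hq)
            · rintro ⟨h1, -⟩
              rcases (Set.ext_iff.1 h1 q).2 trivial with h | h
              · exact hq₁ h
              · exact hq''.2 h
          · push Not at hB
            have hB' : ∀ q, q ∉ Set.range t → q ∉ Set.range w → q ∉ Y₂ := by
              intro q h1 h2
              exact hB q (by rintro (h | h); exacts [h1 h, h2 h])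
            clear hB
            rw [if_pos, if_pos, sub_zero, sub_zero]
            · apply b.op_comp
              · rw [hK₁]
                intro r hr
                exact ⟨hv hr.1, .inl hr.2⟩
              · rw [hK₁]
                intro h
                exact hp (h ⟨hp', .inr hp₂⟩)
            · refine ⟨fun r hr => ?_, Set.disjoint_left.2 fun r hr => ?_⟩
              · have hr' : r ∉ Set.range t ∧ r ∉ Set.range w := not_or.1 hr
                exact (hP' r hr'.1 hr'.2).2 (hB' r hr'.1 hr'.2)
              · have hr' : r ∉ Set.range t ∧ r ∉ Set.range w := not_or.1 hr
                exact hB' r hr'.1 hr'.2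
            · refine ⟨Set.eq_univ_of_forall fun r => ?_, fun r hr => ?_⟩
              · have := hP' r
                have := hB' r
                have := @hv r
                simp only [Set.mem_union]
                tauto
              · have := hB' r
                simp only [Set.mem_union, Set.mem_compl_iff]
                tauto
        · rintro ⟨h1, -⟩
          exact hp₂ (h1 hp)
        · rintro ⟨h1, -⟩
          rcases (Set.ext_iff.1 h1 p).2 trivial with h | h
          · exact hp₂ h
          · exact hp''.1 h
      · push Not at hA
        have hA' : ∀ q, q ∉ Set.range t → q ∉ Set.range w → q ∉ Y₁ := by
          intro q h1 h2
          exact hA q (by rintro (h | h); exacts [h1 h, h2 h])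
        clear hA
        have hs₁ : s ∉ Y₁ := hA' s hs'.1 hs'.2
        have hs₂ : s ∈ Y₂ := by
          have := hP' s hs'.1 hs'.2
          tauto
        rw [if_neg (c := Y₁ ∪ Set.range w = Set.univ ∧ _), if_neg (c := _ ⊆ Y₁ ∧ _),
          if_pos, if_pos, zero_sub, zero_sub, neg_inj]
        · apply b.op_comp
          · rw [hK₂]
            intro r hr
            exact ⟨hv' hr.2, .inl hr.1⟩
          · rw [hK₂]
            intro h
            exact hs (h ⟨hs₂, .inr hs₁⟩)
        · refine ⟨fun r hr => ?_, Set.disjoint_left.2 fun r hr => ?_⟩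
          · have hr' : r ∉ Set.range t ∧ r ∉ Set.range w := not_or.1 hr
            have := hP' r hr'.1 hr'.2
            have := hA' r hr'.1 hr'.2
            tauto
          · have hr' : r ∉ Set.range t ∧ r ∉ Set.range w := not_or.1 hr
            exact hA' r hr'.1 hr'.2
        · refine ⟨Set.eq_univ_of_forall fun r => ?_, fun r hr => ?_⟩
          · have := hP' r
            have := hA' r
            have := @hv' r
            simp only [Set.mem_union]
            tauto
          · have := hA' r
            simp only [Set.mem_union, Set.mem_compl_iff]
            tauto
        · rintro ⟨h1, -⟩
          exact hs₁ (h1 hs)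
        · rintro ⟨h1, -⟩
          rcases (Set.ext_iff.1 h1 s).2 trivial with h | h
          · exact hs₁ h
          · exact hs'.2 h
  -- Here the images cover S, so all conditions hold and the claim is the commutation law.
  · rw [Set.not_nonempty_iff_eq_empty, Set.compl_empty_iff] at hE
    have hst : ∀ s, s ∈ Set.range t ∨ s ∈ Set.range w := fun s => (Set.ext_iff.1 hE s).2 trivial
    rw [hE, Set.compl_univ, if_pos, if_pos, if_pos (by simp), if_pos (by simp), sub_self, sub_eq_zero]
    · apply b.op_comm
      · rw [hK₁]
        intro s hs
        exact ⟨hv hs.1, .inl hs.2⟩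
      · rw [hE]
        exact Set.subset_univ _
      · rw [hK₁, hK₂, hE]
        ext s
        have := hst s
        have := @hv s
        have := @hv' s
        simp only [Set.mem_union, Set.mem_inter_iff, Set.mem_sdiff, Set.mem_univ,
          Set.mem_compl_iff] at *
        tauto
    · rw [← Set.univ_subset_iff, ← hE]
      exact ⟨fun s hs => hs.symm.imp (fun h => hv' h) id, fun s _ => .inl (hst s)⟩
    · rw [← Set.univ_subset_iff, ← hE]
      exact ⟨fun s hs => hs.imp (fun h => hv h) id, fun s _ => .inl (hst s)⟩

theorem weyl_rel : act₁₂ b.act - act₂₁ b.act = act' b.act - act'' b.act := by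
  classical
  rw [weyl_rel_iff]
  intro S X Y X' Y' u v u' v' x
  rw [cf_act', cf_act'', cf_act₁₂_act, cf_act₂₁_act,
    b.sum_opn_act _ _ fun E => E ⊆ Set.range u ∧ Disjoint E (Set.range u'),
    b.sum_opn_act _ _ fun E => E ⊆ Set.range u' ∧ Disjoint E (Set.range u)]
  convert b.op_rel (v.trans u) (v'.trans u') (Set.range u) (Set.range u') ?_ ?_ x
  · rw [range_trans]; exact Set.image_subset_range _ _
  · rw [range_trans]; exact Set.image_subset_range _ _

end Species.BlockAction

/-! ### The defining conditions of the subcategory, and naturality. -/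

namespace Species

variable {k : Type u} [CommRing k] {M N : Species k} {δ : k} {X Y S : FB.{u}}

theorem act_eq_of_op {a a' : Sym k ⊗ₛ M ⟶ Div k ⊗ₛ M}
    (h : ∀ {X Y S : FB.{u}} (u : X ↪ S) (v : Y ↪ S) (x : M.obj X), op a u v x = op a' u v x) :
    a = a' := by
  ext S : 2
  exact ModuleCat.hom_ext (linear_ext_el fun {X} u x => ext_cf fun V => h u (incl V) x)

theorem comm_iff_op {f : M ⟶ N} {a : Sym k ⊗ₛ M ⟶ Div k ⊗ₛ M} {a' : Sym k ⊗ₛ N ⟶ Div k ⊗ₛ N} :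
    whiskerLeft (Sym k) f ≫ a' = a ≫ whiskerLeft (Div k) f ↔
      ∀ {X Y S : FB.{u}} (u : X ↪ S) (v : Y ↪ S) (x : M.obj X),
        f.app Y (op a u v x) = op a' u v (f.app X x) := by
  have h1 : ∀ {X Y S : FB.{u}} (u : X ↪ S) (v : Y ↪ S) (x : M.obj X),
      op a' u v (f.app X x) = cf v ((whiskerLeft (Sym k) f ≫ a').app S (el u x)) := by
    intro X Y S u v x
    change cf v (a'.app S (el u (f.app X x))) =
      cf v (a'.app S ((whiskerLeft (Sym k) f).app S (el u x)))
    rw [tensorHom_el]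
  have h2 : ∀ {X Y S : FB.{u}} (u : X ↪ S) (v : Y ↪ S) (x : M.obj X),
      f.app Y (op a u v x) = cf v ((a ≫ whiskerLeft (Div k) f).app S (el u x)) := by
    intro X Y S u v x
    exact (cf_tensorHom f v (a.app S (el u x))).symm
  constructor
  · intro h X Y S u v x
    rw [h1, h2, h]
  · intro h
    ext S : 2
    refine ModuleCat.hom_ext (linear_ext_el fun {X} u x => ext_cf fun V => ?_)
    exact (h1 u (incl V) x).symm.trans ((h u (incl V) x).symm.trans (h2 u (incl V) x))

theorem op_opn {f : M ⟶ N} {a : Sym k ⊗ₛ M ⟶ Div k ⊗ₛ M} {a' : Sym k ⊗ₛ N ⟶ Div k ⊗ₛ N}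
    (h : ∀ {X Y S : FB.{u}} (u : X ↪ S) (v : Y ↪ S) (x : M.obj X),
        f.app Y (op a u v x) = op a' u v (f.app X x)) (T : Set S) (u : X ↪ S) (v : Y ↪ S)
    (x : M.obj X) : f.app Y (opn a T u v x) = opn a' T u v (f.app X x) := by
  rw [opn, opn]
  split_ifs with h'
  · exact h _ _ x
  · exact map_zero _

/-- It makes `stdIncl` injective after tensoring with M, so the standardness condition may be
checked on coefficients in Sym ⊗ M. -/
theorem std_left_inverse (z : (stdSpecies k ⊗ₛ M).obj S) :
    (tensorHom (divProj k) (𝟙 M)).app S ((tensorHom (stdIncl k) (𝟙 M)).app S z) = z := by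
  refine LinearMap.congr_fun (f := ((tensorHom (divProj k) (𝟙 M)).app S).hom ∘ₗ
    ((tensorHom (stdIncl k) (𝟙 M)).app S).hom) (g := LinearMap.id)
    (tensor_ext_linear fun {A B} e c x => ?_) z
  change (tensorHom (divProj k) (𝟙 M)).app S ((tensorHom (stdIncl k) (𝟙 M)).app S (tmul e c x)) = _
  rw [tensorHom_tmul, tensorHom_tmul]
  have h : (divProj k).app A ((stdIncl k).app A c) = c := by
    apply Subtype.ext
    change (if Nat.card A = 1 then c.1 else 0) = c.1
    split_ifs with h
    · rfl
    · exact (c.2 h).symm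
  rw [h]
  rfl

namespace BlockAction

variable (b : BlockAction δ M)

/-- The representation of the curried Weyl Lie algebra given by a family of operations. -/
def toWeylRep : WeylRep k := ⟨M, b.act, b.weyl_rel⟩

theorem hasCentralCharacter : b.toWeylRep.HasCentralCharacter δ := by
  intro S
  refine ModuleCat.hom_ext (LinearMap.ext fun x => ?_)
  let e : S.sub (∅ : Set S)ᶜ ≃ S := Equiv.subtypeUnivEquiv (p := (· ∈ (∅ : Set S)ᶜ)) (fun _ h => h)
  change M.map (⟨e⟩ : S.sub (∅ : Set S)ᶜ ⟶ S) (coeff ∅ (b.act.app S (symTmul ∅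
    (M.map (⟨e.symm⟩ : S ⟶ S.sub (∅ : Set S)ᶜ) x)))) = δ • x
  rw [symTmul_eq_el, coeff_eq_cf, ← op_apply, op_act_eq, b.op_self, map_smul]
  · congr 1
    exact map_map_symm e x
  · rw [range_incl, Set.compl_empty, Set.union_univ]

theorem omegaOperation_act (A B : Set S) : omegaOperation b.act A B = 0 := by
  have h : operation b.act (extendSet 1 A) (extendSet 1 B) = 0 := by
    ext x
    rw [operation_eq_op, op_act, if_neg]
    · rfl
    · rw [range_incl, range_incl]
      intro h
      rcases (Set.ext_iff.1 h (.inr 0)).2 trivial with h | h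
      · exact h fun x hx => absurd hx Sum.inr_ne_inl
      · exact h fun x hx => absurd hx Sum.inr_ne_inl
  change -(_ ≫ operation b.act (extendSet 1 A) (extendSet 1 B) ≫ _) = 0
  rw [h, Limits.zero_comp, Limits.comp_zero, neg_zero]

theorem omegaVanishes : b.toWeylRep.OmegaVanishes := fun _ A B _ => b.omegaOperation_act A B

theorem op_iota (i j : S) (hij : i ≠ j) (x : M.obj (S.sub {j}ᶜ)) :
    b.op (incl {j}ᶜ) (incl {i}ᶜ) x = M.map ⟨iota i j⟩ x := by
  refine b.op_single _ _ (iota i j) ⟨i, hij⟩ (fun s hs => ?_) ?_ x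
  · exact iota_of_ne i j s fun h => hs (Subtype.ext h)
  · change (iota i j ⟨i, hij⟩ : S) ≠ i
    rw [iota_left i j _ rfl]
    exact hij.symm

theorem isStandardGl_act : IsStandardGl 0 (glRestrict b.act) := by
  classical
  intro S j x
  have hinj : Function.Injective ((tensorHom (stdIncl k) (𝟙 M)).app S) :=
    Function.LeftInverse.injective std_left_inverse
  apply hinj
  refine ext_cf fun U => ?_
  have h1 : cf (incl U) ((tensorHom (stdIncl k) (𝟙 M)).app S
      ((0 : k) • summand {j} (stdBasis j) x + ∑ i ∈ Finset.univ.erase j,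
        summand {i} (stdBasis i) (M.map ⟨iota i j⟩ x))) =
      ∑ i ∈ Finset.univ.erase j, cf (incl U) (el (incl {i}ᶜ) (M.map ⟨iota i j⟩ x)) := by
    rw [zero_smul, zero_add, map_sum, map_sum]
    exact Finset.sum_congr rfl fun i _ => congrArg (cf (incl U)) (stdIncl_summand i _)
  refine Eq.trans ?_ h1.symm
  refine (cf_glRestrict b.act j (incl U) x).trans ?_
  rw [range_incl]
  by_cases hU : ∃ i, U = {i}ᶜ
  · obtain ⟨i, rfl⟩ := hU
    rw [if_pos (by rw [compl_compl]; simp), op_act, range_incl, range_incl]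
    have hne : ∀ i', i' ≠ i → cf (incl {i}ᶜ) (el (incl {i'}ᶜ) (M.map ⟨iota i' j⟩ x)) = 0 := by
      intro i' hi'
      rw [cf_el_ne]
      rw [range_incl, range_incl]
      exact fun h => hi' (Set.singleton_injective (compl_injective h)).symm
    -- For i = j both images miss the point j, so the coefficient of `act` is zero. This is why the
    -- representation is 0-standard, even though `op_self` involves δ.
    by_cases hij : i = j
    · subst hij
      rw [if_neg, Finset.sum_eq_zero]
      · exact fun i' hi' => hne i' (Finset.mem_erase.1 hi').1
      · rw [Set.union_self]
        exact fun h => (Set.ext_iff.1 h i).2 trivial rfl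
    · rw [if_pos, b.op_iota i j hij, Finset.sum_eq_single i, cf_el_self]
      · exact fun i' _ hi' => hne i' hi'
      · exact fun h => absurd (Finset.mem_erase.2 ⟨hij, Finset.mem_univ _⟩) h
      · refine Set.eq_univ_of_forall fun s => ?_
        by_cases hs : s = j
        · exact .inr fun h => hij (h.symm.trans hs)
        · exact .inl hs
  · rw [if_neg, Finset.sum_eq_zero]
    · intro i _
      rw [cf_el_ne]
      rw [range_incl, range_incl]
      exact fun h => hU ⟨i, h⟩
    · intro h
      obtain ⟨i, hi⟩ := Set.ncard_eq_one.1 (h : Uᶜ.ncard = 1)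
      exact hU ⟨i, by rw [← hi, compl_compl]⟩

theorem isStandard : b.toWeylRep.IsStandard 0 := b.isStandardGl_act

/-- The object of `Rep^δ(𝔞(𝐕 ⊕ 𝐕*))'` given by a family of operations. -/
def toPrimeRep : WeylRep.PrimeRep δ :=
  ⟨b.toWeylRep, b.hasCentralCharacter, b.isStandard, b.omegaVanishes⟩

theorem ext_op {b b' : BlockAction δ M}
    (h : ∀ {X Y S : FB.{u}} (u : X ↪ S) (v : Y ↪ S), b.op u v = b'.op u v) : b = b' := by
  have h' : @b.op = @b'.op := by
    funext X Y S u v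
    exact h u v
  cases b
  cases b'
  cases h'
  rfl

variable {b} {b' : BlockAction δ N} {f : M ⟶ N}

theorem blockOp_naturality (h : ∀ {X Y S : FB.{u}} (u : X ↪ S) (v : Y ↪ S) (x : M.obj X),
    f.app Y (b.op u v x) = b'.op u v (f.app X x)) (A B : Set S) (z : (Sym k ⊗ₛ M).obj S) :
    (whiskerLeft (Sym k) f).app S (b.blockOp A B z) =
      b'.blockOp A B ((whiskerLeft (Sym k) f).app S z) := by
  refine LinearMap.congr_fun (f := ((whiskerLeft (Sym k) f).app S).hom ∘ₗ b.blockOp A B)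
    (g := b'.blockOp A B ∘ₗ ((whiskerLeft (Sym k) f).app S).hom)
    (linear_ext_el fun {X} u x => ?_) z
  change (whiskerLeft (Sym k) f).app S (b.blockOp A B (el u x)) =
      b'.blockOp A B ((whiskerLeft (Sym k) f).app S (el u x))
  rw [tensorHom_el]
  by_cases hAB : A ⊆ Set.range u ∧ Disjoint B (Set.range u)
  · rw [b.blockOp_el u (incl ((Set.range u \ A) ∪ B)) hAB.1 hAB.2 (range_incl _),
      b'.blockOp_el u (incl ((Set.range u \ A) ∪ B)) hAB.1 hAB.2 (range_incl _), ← h]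
    exact tensorHom_el f _ _
  · rw [b.blockOp_el_zero u hAB, b'.blockOp_el_zero u hAB]
    exact map_zero _

theorem diagram_naturality (h : ∀ {X Y S : FB.{u}} (u : X ↪ S) (v : Y ↪ S) (x : M.obj X),
    f.app Y (b.op u v x) = b'.op u v (f.app X x)) (r : Setoid (X ⊕ Y)) (x : M.obj X) :
    f.app Y (b.diagram r x) = b'.diagram r (f.app X x) := by
  classical
  have key : ∀ P : Finset (Set (X ⊕ Y)), P ⊆ PartitionDiagram.parts r Set.univ → ∀ z,
      (whiskerLeft (Sym k) f).app (X.sum Y) (b.blockProd (S := X.sum Y) (Set.range (inlE X Y))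
        (Set.range (inrE X Y)) P z) = b'.blockProd (S := X.sum Y) (Set.range (inlE X Y))
        (Set.range (inrE X Y)) P ((whiskerLeft (Sym k) f).app (X.sum Y) z) := by
    intro P hP z
    have hd := (PartitionDiagram.parts_pairwiseDisjoint r Set.univ).subset (Finset.coe_subset.2 hP)
    clear hP
    induction P using Finset.induction_on with
    | empty =>
      rw [blockProd, blockProd, commProd_empty, commProd_empty]
      rfl
    | insert Q P hQ ih =>
      have hp := b.blockOp_pairwise (disjoint_range X Y) hd
      have hp' := b'.blockOp_pairwise (disjoint_range X Y) hd
      have ih := ih (hd.subset (by simp))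
      rw [blockProd, blockProd] at ih ⊢
      rw [commProd_insert hQ hp, commProd_insert hQ hp', Module.End.mul_apply, Module.End.mul_apply,
        ← ih]
      exact blockOp_naturality h _ _ _
  change f.app Y (cf (inrE X Y) _) = cf (inrE X Y) (b'.blockProd _ _ _ (el (inlE X Y) (f.app X x)))
  rw [← cf_tensorHom]
  refine congrArg (cf (inrE X Y)) ((key _ subset_rfl _).trans ?_)
  rw [tensorHom_el]

theorem diagramₗ_naturality (h : ∀ {X Y S : FB.{u}} (u : X ↪ S) (v : Y ↪ S) (x : M.obj X),
    f.app Y (b.op u v x) = b'.op u v (f.app X x)) (r : PartitionCat.HomModule k X Y)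
    (x : M.obj X) : f.app Y (b.diagramₗ X Y r x) = b'.diagramₗ X Y r (f.app X x) := by
  induction r using Finsupp.induction_linear with
  | zero => simp
  | add r s hr hs => simp only [map_add, LinearMap.add_apply, hr, hs]
  | single r c =>
    rw [diagramₗ_single, diagramₗ_single, LinearMap.smul_apply, LinearMap.smul_apply, map_smul,
      diagram_naturality h]

end BlockAction

end Species

/-! ### The two functors and their compositions. -/

namespace Species

variable {k : Type u} [CommRing k] {δ : k}

namespace WeylRep

/-- The map e plays the role of the identity. Since the species agree only propositionally, it
expresses agreement of the operations without a transport along h. -/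
theorem ext_op {M N : WeylRep k} (h : M.species = N.species)
    (e : ∀ X, M.species.obj X → N.species.obj X)
    (he : ∀ X x, e X x = eqToHom (Functor.congr_obj h X) x)
    (hop : ∀ {X Y S : FB.{u}} (u : X ↪ S) (v : Y ↪ S) (x : M.species.obj X),
      e Y (op M.act u v x) = op N.act u v (e X x)) : M = N := by
  obtain ⟨M, a, ha⟩ := M
  obtain ⟨N, a', ha'⟩ := N
  obtain rfl : M = N := h
  obtain rfl : e = fun X x => x := funext fun X => funext (he X)
  obtain rfl : a = a' := act_eq_of_op hop
  rfl

variable (M N : PrimeRep δ)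

/-- The operations on an object of `Rep^δ(𝔞(𝐕 ⊕ 𝐕*))'`. -/
def PrimeRep.blockAction : BlockAction δ M.obj.species :=
  Species.blockAction M.obj M.property.1 M.property.2.1 M.property.2.2

theorem PrimeRep.blockAction_op {X Y S : FB.{u}} (u : X ↪ S) (v : Y ↪ S) :
    (PrimeRep.blockAction M).op u v = opn M.obj.act (Set.range u ∪ Set.range v) u v := rfl

variable {M N}

/-- No coefficient is lost in the block action: those of non-covering pairs are zero on the original
side by `op_eq_zero_of_ne_univ`, and on the other side by construction. -/
theorem PrimeRep.op_eq {X Y S : FB.{u}} (u : X ↪ S) (v : Y ↪ S) :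
    op (PrimeRep.blockAction M).act u v = op M.obj.act u v := by
  by_cases h : Set.range u ∪ Set.range v = Set.univ
  · rw [BlockAction.op_act_eq _ _ _ h, PrimeRep.blockAction_op, h, opn_univ]
  · ext x
    rw [BlockAction.op_act, if_neg h,
      op_eq_zero_of_ne_univ M.obj.act M.obj.rel M.property.2.2 _ _ h]
    rfl

theorem PrimeRep.hom_op (f : M ⟶ N) {X Y S : FB.{u}} (u : X ↪ S) (v : Y ↪ S)
    (x : M.obj.species.obj X) : f.hom.hom.app Y ((PrimeRep.blockAction M).op u v x) =
      (PrimeRep.blockAction N).op u v (f.hom.hom.app X x) :=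
  op_opn (comm_iff_op.1 f.hom.comm) _ u v x

variable (δ)

/-- The functor from `Rep^δ(𝔞(𝐕 ⊕ 𝐕*))'` to the representations of the partition category. -/
def toPartitionRep : PrimeRep δ ⥤ PartitionRep δ where
  obj M := (PrimeRep.blockAction M).toPartitionRep
  map {M N} f := ObjectProperty.homMk
    { app X := f.hom.hom.app X.set
      naturality X Y r := ModuleCat.hom_ext (LinearMap.ext fun x =>
        BlockAction.diagramₗ_naturality (PrimeRep.hom_op f) r x) }

end WeylRep

end Species

namespace PartitionRep

open Species

variable {k : Type u} [CommRing k] {δ : k}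

theorem hom_diagram {N N' : PartitionRep δ} (f : N ⟶ N') {X Y : FB.{u}} (r : Setoid (X ⊕ Y))
    (x : N.species.obj X) :
    f.hom.app ⟨Y⟩ (N.diagram r x) = N'.diagram r (f.hom.app ⟨X⟩ x) :=
  NatTrans.naturality_apply f.hom (PartitionCat.ofDiagram r) x

theorem hom_op_act {N N' : PartitionRep δ} (f : N ⟶ N') {X Y S : FB.{u}} (u : X ↪ S) (v : Y ↪ S)
    (x : N.species.obj X) :
    ((forget δ).map f).app Y (op N.blockAction.act u v x) =
      op N'.blockAction.act u v (((forget δ).map f).app X x) := by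
  classical
  refine (congrArg (f.hom.app ⟨Y⟩) (N.blockAction.op_act u v x)).trans
    (Eq.trans ?_ (N'.blockAction.op_act u v (f.hom.app ⟨X⟩ x)).symm)
  split_ifs with h
  · change f.hom.app ⟨Y⟩ ((if Set.range u = Set.range v then δ else 1) •
      N.diagram (BlockAction.blockDiagram u v) x) = (if Set.range u = Set.range v then δ else 1) •
      N'.diagram (BlockAction.blockDiagram u v) (f.hom.app ⟨X⟩ x)
    exact ((f.hom.app ⟨Y⟩).hom.map_smul _ _).trans
      (congrArg ((if Set.range u = Set.range v then δ else 1) • ·) (hom_diagram f _ x))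
  · exact map_zero _

variable (δ) in
/-- The functor from the representations of the partition category to `Rep^δ(𝔞(𝐕 ⊕ 𝐕*))'`. -/
def toPrimeRep : PartitionRep δ ⥤ WeylRep.PrimeRep δ where
  obj N := N.blockAction.toPrimeRep
  map f := ObjectProperty.homMk ⟨(forget δ).map f, comm_iff_op.2 (hom_op_act f)⟩

theorem blockAction_toPrimeRep (N : PartitionRep δ) :
    WeylRep.PrimeRep.blockAction ((toPrimeRep δ).obj N) = N.blockAction :=
  BlockAction.ext_op fun u v => N.blockAction.opn_act_eq u v rfl

theorem blockAction_diagramₗ (N : PartitionRep δ) {X Y : PartitionCat δ} (f : X ⟶ Y)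
    (x : N.species.obj X.set) :
    N.blockAction.diagramₗ X.set Y.set f x = N.obj.map f x := by
  have := N.property.1
  have := N.property.2
  induction f using Finsupp.induction_linear with
  | zero =>
    refine Eq.trans ?_ (congrArg (fun g => g x) (N.obj.map_zero X Y)).symm
    rw [map_zero]
    rfl
  | add f g hf hg =>
    refine Eq.trans ?_ (congrArg (fun g => g x) (N.obj.map_add (f := f) (g := g))).symm
    rw [map_add]
    exact congrArg₂ (· + ·) hf hg
  | single r c =>
    have h : (Finsupp.single r c : X ⟶ Y) = c • PartitionCat.ofDiagram r := by
      change _ = c • Finsupp.single r 1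
      rw [Finsupp.smul_single, smul_eq_mul, mul_one]
    refine Eq.trans ?_ (congrArg (fun g => N.obj.map g x) h).symm
    refine Eq.trans ?_ (congrArg (fun g => g x) (N.obj.map_smul c (PartitionCat.ofDiagram r))).symm
    rw [BlockAction.diagramₗ_single, LinearMap.smul_apply, blockAction_diagram]
    rfl

theorem blockAction_toPartitionRep (N : PartitionRep δ) : N.blockAction.toPartitionRep = N := by
  have h : N.blockAction.toPartitionRep.obj = N.obj := by
    refine CategoryTheory.Functor.ext (fun X => rfl) fun X Y f => ?_
    refine ModuleCat.hom_ext (LinearMap.ext fun x => ?_)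
    exact N.blockAction_diagramₗ f x
  obtain ⟨F, hF⟩ := N
  exact ObjectProperty.FullSubcategory.ext h

theorem toPrimeRep_obj_toPartitionRep_obj (N : PartitionRep δ) :
    (WeylRep.toPartitionRep δ).obj ((toPrimeRep δ).obj N) = N := by
  change (WeylRep.PrimeRep.blockAction ((toPrimeRep δ).obj N)).toPartitionRep = N
  rw [blockAction_toPrimeRep]
  exact N.blockAction_toPartitionRep

theorem toPrimeRep_toPartitionRep :
    toPrimeRep δ ⋙ WeylRep.toPartitionRep δ = 𝟭 (PartitionRep δ) := by
  refine CategoryTheory.Functor.ext toPrimeRep_obj_toPartitionRep_obj fun N N' f => ?_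
  -- The object equalities leave the modules unchanged, so every component of the `eqToHom` terms is
  -- an identity.
  apply (ObjectProperty.ι _).map_injective
  rw [Functor.map_comp, Functor.map_comp, eqToHom_map, eqToHom_map]
  refine NatTrans.ext (funext fun X => ?_)
  rw [NatTrans.comp_app, NatTrans.comp_app, eqToHom_app, eqToHom_app]
  exact ((Category.id_comp _).trans (Category.comp_id _)).symm

end PartitionRep

namespace Species

variable {k : Type u} [CommRing k] {δ : k}

theorem BlockAction.toPartitionRep_species {M : Species k} (b : BlockAction δ M) :
    b.toPartitionRep.species = M := by
  refine CategoryTheory.Functor.ext (fun X => rfl) fun X Y f => ?_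
  refine ModuleCat.hom_ext (LinearMap.ext fun x => ?_)
  refine (LinearMap.congr_fun (b.toPartitionRep_diagram (PartitionDiagram.graph f.toEquiv)) x).trans ?_
  exact b.diagram_graph f.toEquiv x

/-- For different images this is `diagram_blockDiagram`. For equal images the diagram is a
bijection, and the factor δ in the definition matches `op_self`. -/
theorem BlockAction.toPartitionRep_op {M : Species k} (b : BlockAction δ M) {X Y S : FB.{u}}
    (u : X ↪ S) (v : Y ↪ S) (x : M.obj X) :
    b.toPartitionRep.blockAction.op u v x = b.op u v x := by
  classical
  change (if Set.range u = Set.range v then δ else 1) •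
    b.diagramₗ X Y (Finsupp.single (BlockAction.blockDiagram u v) 1) x = _
  rw [diagramₗ_single, one_smul]
  by_cases h : Set.range u = Set.range v
  · obtain ⟨e, rfl⟩ := exists_equiv_of_range_eq u v h
    rw [if_pos h, b.op_equiv_left, b.op_self, ← diagram_graph]
    congr 3
    ext a c
    have ha : ∀ a, Sum.elim (e.toEmbedding.trans v) v a = v (Sum.elim e id a) := by
      rintro (a | a) <;> rfl
    rw [blockDiagram, h, symmDiff_self, Setoid.comap_rel, ha, ha]
    constructor
    · rintro (h | ⟨h, -⟩)
      · exact v.injective h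
      · exact h.elim
    · exact fun h => .inl (congrArg v h)
  · rw [if_neg h, one_smul, b.diagram_blockDiagram u v h]

theorem BlockAction.toPartitionRep_op_act {M : Species k} (b : BlockAction δ M) {X Y S : FB.{u}}
    (u : X ↪ S) (v : Y ↪ S) (x : M.obj X) :
    Species.op b.toPartitionRep.blockAction.act u v x = Species.op b.act u v x := by
  classical
  refine (b.toPartitionRep.blockAction.op_act u v x).trans (Eq.trans ?_ (b.op_act u v x).symm)
  exact if_congr Iff.rfl (b.toPartitionRep_op u v x) rfl

namespace WeylRep

theorem toPartitionRep_obj_toPrimeRep_obj (M : PrimeRep δ) :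
    (PartitionRep.toPrimeRep δ).obj ((toPartitionRep δ).obj M) = M := by
  have h : ((PartitionRep.toPrimeRep δ).obj ((toPartitionRep δ).obj M)).obj = M.obj := by
    refine ext_op (PrimeRep.blockAction M).toPartitionRep_species (fun X x => x)
      (fun X x => rfl) fun {X Y S} u v x => ?_
    exact ((PrimeRep.blockAction M).toPartitionRep_op_act u v x).trans
      (LinearMap.congr_fun (PrimeRep.op_eq (M := M) u v) x)
  obtain ⟨M, hM⟩ := M
  exact ObjectProperty.FullSubcategory.ext h

theorem toPartitionRep_toPrimeRep :
    toPartitionRep δ ⋙ PartitionRep.toPrimeRep δ = 𝟭 (PrimeRep δ) := by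
  refine CategoryTheory.Functor.ext toPartitionRep_obj_toPrimeRep_obj fun M N f => ?_
  -- A morphism is determined by its map of species, where the `eqToHom` terms become identities.
  have hinj : ∀ {M N : PrimeRep δ} {f g : M ⟶ N},
      (ObjectProperty.ι _ ⋙ forget k).map f = (ObjectProperty.ι _ ⋙ forget k).map g → f = g :=
    fun h => ObjectProperty.hom_ext _ (Hom.ext h)
  apply hinj
  rw [Functor.map_comp, Functor.map_comp, eqToHom_map, eqToHom_map]
  refine NatTrans.ext (funext fun X => ?_)
  rw [NatTrans.comp_app, NatTrans.comp_app, eqToHom_app, eqToHom_app]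
  exact ((Category.id_comp _).trans (Category.comp_id _)).symm

end WeylRep

end Species

namespace PartitionRep

open Species

variable {k : Type u} [CommRing k] {δ : k} (N : PartitionRep δ)

/-- Disjointness of A and B has two effects: their complements cover S, so the coefficient is not
cut off, and the symmetric difference of the complements is A ∪ B. Nonemptiness makes the
complements different, so the exceptional factor δ does not occur. -/
theorem operation_act_eq_eta {S : FB.{u}} (A B : Set S) (hAB : Disjoint A B)
    (h : (A ∪ B).Nonempty) :
    operation N.blockAction.act A B = N.obj.map (PartitionCat.eta δ A B) := by
  have h1 : Set.range (incl Bᶜ) ∪ Set.range (incl Aᶜ) = Set.univ := by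
    rw [range_incl, range_incl, ← Set.compl_inter, Set.inter_comm, hAB.inter_eq, Set.compl_empty]
  have h2 : Set.range (incl Bᶜ) ≠ Set.range (incl Aᶜ) := by
    rw [range_incl, range_incl]
    intro h'
    rw [compl_injective h'] at h hAB
    rw [disjoint_self.1 hAB] at h
    simp at h
  have h3 : BlockAction.blockDiagram (incl Bᶜ) (incl Aᶜ) =
      (PartitionCat.blockSetoid (A ∪ B)).comap (Sum.elim Subtype.val Subtype.val) := by
    rw [BlockAction.blockDiagram, range_incl, range_incl]
    have : symmDiff Bᶜ Aᶜ = A ∪ B := by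
      rw [compl_symmDiff_compl, symmDiff_comm, hAB.symmDiff_eq_sup]
      rfl
    rw [this]
    rfl
  refine ModuleCat.hom_ext (LinearMap.ext fun x => ?_)
  refine (operation_eq_op _ A B x).trans ?_
  rw [BlockAction.op_act_eq _ _ _ h1]
  change (if Set.range (incl Bᶜ) = Set.range (incl Aᶜ) then δ else 1) •
    N.diagram (BlockAction.blockDiagram (incl Bᶜ) (incl Aᶜ)) x = _
  rw [if_neg h2, one_smul, h3]
  rfl

end PartitionRep

end

theorem mainTheorem4 {k : Type u} [CommRing k] (δ : k) :
    ∃ (Φ : Species.WeylRep.PrimeRep δ ⥤ PartitionRep δ)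
      (Ψ : PartitionRep δ ⥤ Species.WeylRep.PrimeRep δ),
      Φ ⋙ Ψ = 𝟭 (Species.WeylRep.PrimeRep δ) ∧ Ψ ⋙ Φ = 𝟭 (PartitionRep δ) ∧
      Ψ ⋙ ObjectProperty.ι _ ⋙ Species.WeylRep.forget k = PartitionRep.forget δ ∧
      ∀ N : PartitionRep δ,
        ∃ (a : Species.Sym k ⊗ₛ N.species ⟶ Species.Div k ⊗ₛ N.species)
          (h : Species.act₁₂ a - Species.act₂₁ a = Species.act' a - Species.act'' a),
          (Ψ.obj N).obj = ⟨N.species, a, h⟩ ∧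
          ∀ (S : FB.{u}) (A B : Set S), Disjoint A B → (A ∪ B).Nonempty →
            Species.operation a A B = N.obj.map (PartitionCat.eta δ A B) :=
  ⟨Species.WeylRep.toPartitionRep δ, PartitionRep.toPrimeRep δ,
    -- Compatibility with the forgetful functors holds by definition, because the functor to Weyl
    -- representations keeps the species and the maps.
    Species.WeylRep.toPartitionRep_toPrimeRep, PartitionRep.toPrimeRep_toPartitionRep, rfl,
    fun N => ⟨N.blockAction.act, N.blockAction.weyl_rel, rfl, fun _ => N.operation_act_eq_eta⟩⟩
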